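/- **Local catalytic ground state tomography.** Let $\Lambda=[L]^D$ be a lattice with one qubit or one fermionic mode per site, and let $H=\sum_{S\subset\Lambda}h_S$ be a local Hamiltonian with parameters $(D,q,R)$: each $h_S$ is Hermitian and supported on $S$ (of even degree in the fermionic case), $\|h_S\|\le 1$, and $h_S=0$ if $|S|>q$ or if the Manhattan diameter of $S$ is at least $R$. Suppose that $H$ is $\Delta$-gapped: it has a unique ground state $|\psi_0\rangle$, of energy $E_0$, and all other eigenvalues are at least $E_0+\Delta$, where $\Delta>0$. Let $A$ be a Hermitian observable with $\|A\|\le1$ supported on a non-empty region $X\subset\Lambda$, given through a block encoding $V$ with $b$ ancilla qubits, i.e. a unitary with $\langle 0^b|V|0^b\rangle=A$. For $r\in\mathbb N$ let $H_r=\sum_{S\subset X_r}h_S$ be the truncation of $H$ to the patch $X_r$ of all sites within Manhattan distance $r$ of $X$. A measurement protocol for evolution under a Hamiltonian $G$ is a circuit that starts with one copy of the state $|\psi_0\rangle$ and ancillas in a fixed basis state, and is composed of unitaries on the ancillas and of controlled Heisenberg-evolved calls $e^{iGt}V^{(\dagger)}e^{-iGt}$ to the block encoding, with the time $t$ controlled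 by an ancilla register. Finally the ancillas are measured and an estimate is computed from the outcome. The evolution time of a call is the largest $|t|$ that occurs in it, and that of the protocol is the sum over its calls. There is an absolute constant $c>0$, and for all $D,q,R$ there is a constant $C>0$ depending only on $D,q,R$, such that for all $\Delta>0$, $0<\epsilon\le1$, $0<\delta\le\frac12$, all $a\ge1$ and all $b\ge 0$ there are a measurement protocol and a radius $r\in\mathbb N$ with * total controlled Heisenberg evolution time at most $c\,\dfrac{\log(1/\delta)\,(\log(1/\delta)+\log(1/\epsilon))}{\Delta\,\epsilon}$, * at most $c\,\dfrac{\log(1/\delta)}{\epsilon}$ calls to the block encoding of $A$, * $r\le C\Big(\dfrac{\log(1/\delta)+\log(1/\epsilon)}{\Delta}+\log\dfrac{a}{\delta}\Big)$, such that for every $L$, every $\Delta$-gapped local Hamiltonian $H$ as above with ground state $|\psi_0\rangle$, every region $X$ with $|X|=a$, every $A$ and every $V$ as above, this protocol run with Heisenberg evolution under $H$, and likewise the same protocol run with Heisenberg evolution under the truncated Hamiltonian $H_r$ only, returns a number that is within $\epsilon$ of $\langle\psi_0|A|\psi_0\rangle$ with probability at least $1-\delta$, and returns a system state (averaged over the measurement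 outcomes) at trace distance at most $\delta$ from $|\psi_0\rangle\langle\psi_0|$. -/

import Mathlib

open scoped Matrix Kronecker

namespace CatalyticTomography

/-! ### Linear algebra on finite-dimensional state spaces -/

/-- Operator norm of a matrix, with respect to the Euclidean norm on `ℂ^Q`. -/
noncomputable def opNorm {Q : Type} [Fintype Q] [DecidableEq Q] (M : Matrix Q Q ℂ) : ℝ :=
  ‖Matrix.toEuclideanCLM (n := Q) (𝕜 := ℂ) M‖

/-- The expectation value `⟨ψ|A|ψ⟩` (a real number when `A` is Hermitian). -/
def expectation {Q : Type} [Fintype Q] (A : Matrix Q Q ℂ) (ψ : Q → ℂ) : ℝ :=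
  (star ψ ⬝ᵥ (A *ᵥ ψ)).re

/-- The trace norm: the sum of the singular values, i.e. of the square roots of the eigenvalues
of `Mᴴ * M`. -/
noncomputable def traceNorm {Q : Type} [Fintype Q] [DecidableEq Q] (M : Matrix Q Q ℂ) : ℝ :=
  ∑ i, √((Matrix.isHermitian_conjTranspose_mul_self M).eigenvalues i)

/-- The trace distance `‖ρ - ρ'‖₁ / 2`. -/
noncomputable def traceDist {Q : Type} [Fintype Q] [DecidableEq Q] (ρ ρ' : Matrix Q Q ℂ) : ℝ :=
  traceNorm (ρ - ρ') / 2

/-- The projector `|ψ⟩⟨ψ|`. -/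
def pureState {Q : Type} (ψ : Q → ℂ) : Matrix Q Q ℂ :=
  Matrix.vecMulVec ψ (star ψ)

/-- The unit vector `ψ` is the unique ground state of `H`, and `H` has spectral gap at least `Δ`:
every eigenvector of `H` orthogonal to `ψ` has energy at least `E₀ + Δ`. -/
def IsGappedGroundState {Q : Type} [Fintype Q] (H : Matrix Q Q ℂ) (Δ : ℝ) (ψ : Q → ℂ) : Prop :=
  star ψ ⬝ᵥ ψ = 1 ∧ ∃ E₀ : ℝ, H *ᵥ ψ = (E₀ : ℂ) • ψ ∧
    ∀ (E : ℝ) (φ : Q → ℂ), φ ≠ 0 → H *ᵥ φ = (E : ℂ) • φ → star ψ ⬝ᵥ φ = 0 → E₀ + Δ ≤ E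

/-- The evolution operator `e^{iHt}`. -/
noncomputable def evolution {Q : Type} [Fintype Q] [DecidableEq Q] (H : Matrix Q Q ℂ) (t : ℝ) :
    Matrix Q Q ℂ :=
  NormedSpace.exp ((Complex.I * (t : ℂ)) • H)

/-! ### Lattice, spins and fermions -/

/-- The sites of the lattice `[L]^D`. -/
abbrev Site (D L : ℕ) : Type := Fin D → Fin L

/-- Basis states of the `2^n`-dimensional state space, `n = L^D`: one bit for each site (spin up or
down; fermionic mode empty or occupied). -/
abbrev Config (D L : ℕ) : Type := Site D L → Fin 2

/-- Operators on the state space of the lattice system. -/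
abbrev Op (D L : ℕ) : Type := Matrix (Config D L) (Config D L) ℂ

/-- The Manhattan distance. -/
def manhattan {D L : ℕ} (x y : Site D L) : ℕ :=
  ∑ i, ((x i : ℤ) - (y i : ℤ)).natAbs

/-- The diameter in Manhattan distance. -/
def diam {D L : ℕ} (S : Finset (Site D L)) : ℕ :=
  (S ×ˢ S).sup fun p => manhattan p.1 p.2

/-- The patch of radius `r` around `X`: all sites within Manhattan distance `r` of `X`. -/
def patch {D L : ℕ} (X : Finset (Site D L)) (r : ℕ) : Finset (Site D L) :=
  {x | ∃ a ∈ X, manhattan x a ≤ r}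

/-- The operator `m` acting on the qubit at `x`, tensored with the identity elsewhere. -/
def onQubit {D L : ℕ} (x : Site D L) (m : Matrix (Fin 2) (Fin 2) ℂ) : Op D L :=
  Matrix.of fun σ τ => if ∀ y, y ≠ x → σ y = τ y then m (σ x) (τ x) else 0

/-- The fermionic annihilation operator at `x` on Fock space in the occupation number basis, with
the sign given by the number of occupied modes that precede `x` in a fixed enumeration. -/
def annihilate {D L : ℕ} (x : Site D L) : Op D L :=
  Matrix.of fun σ τ =>
    if τ x = 1 ∧ σ = Function.update τ x 0 then
      (-1) ^ ({y | finFunctionFinEquiv y < finFunctionFinEquiv x ∧ τ y = 1} :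
        Finset (Site D L)).card
    else 0

/-- The annihilation and creation operators of the modes in `S`. -/
def modes {D L : ℕ} (S : Finset (Site D L)) : Set (Op D L) :=
  {c | ∃ x ∈ S, c = annihilate x ∨ c = (annihilate x)ᴴ}

/-- The two kinds of degrees of freedom. -/
inductive Kind
  | spin
  | fermion

/-- The algebra of all operators supported on `S`. -/
noncomputable def localAlgebra {D L : ℕ} (k : Kind) (S : Finset (Site D L)) :
    Subalgebra ℂ (Op D L) :=
  match k with
  | .spin => Algebra.adjoin ℂ {M | ∃ x ∈ S, ∃ m, M = onQubit x m}
  | .fermion => Algebra.adjoin ℂ (modes S)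

/-- The algebra of operators on `S` that may occur as Hamiltonian terms: all operators supported
on `S` for spins, the even-degree operators supported on `S` for fermions. -/
noncomputable def termAlgebra {D L : ℕ} (k : Kind) (S : Finset (Site D L)) :
    Subalgebra ℂ (Op D L) :=
  match k with
  | .spin => localAlgebra .spin S
  | .fermion => Algebra.adjoin ℂ {M | ∃ c ∈ modes S, ∃ d ∈ modes S, M = c * d}

/-- The family `h` consists of the terms of a geometrically local Hamiltonian: `h S` is Hermitian
of norm at most one, is supported on `S`, and vanishes if `S` has more than `q` sites or diameter
at least `R`. (Terms on disjoint sets automatically commute.) -/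
structure IsLocalInteraction {D L : ℕ} (k : Kind) (q R : ℕ) (h : Finset (Site D L) → Op D L) :
    Prop where
  isHermitian : ∀ S, (h S).IsHermitian
  opNorm_le : ∀ S, opNorm (h S) ≤ 1
  mem_termAlgebra : ∀ S, h S ∈ termAlgebra k S
  eq_zero_of_card : ∀ S, q < S.card → h S = 0
  eq_zero_of_diam : ∀ S, R ≤ diam S → h S = 0

/-- The Hamiltonian `H = ∑_S h_S`. -/
def hamiltonian {D L : ℕ} (h : Finset (Site D L) → Op D L) : Op D L :=
  ∑ S, h S

/-- The Hamiltonian truncated to the patch of radius `r` around `X`: the sum of the terms that act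
inside this patch. -/
def patchHamiltonian {D L : ℕ} (h : Finset (Site D L) → Op D L) (X : Finset (Site D L)) (r : ℕ) :
    Op D L :=
  ∑ S with S ⊆ patch X r, h S

/-! ### Measurement protocols with oracle access to evolution and to a block encoding

A protocol is an oracle circuit: its description contains neither the Hamiltonian, nor the
observable, nor the state. -/

/-- Basis states of `b` qubits; `0` is the state `|0^b⟩`. -/
abbrev Reg (b : ℕ) : Type := Fin b → Fin 2

/-- `V` is a block encoding of `A` with `b` ancilla qubits: a unitary with `⟨0^b|V|0^b⟩ = A`. -/
def IsBlockEncoding {Q : Type} [Fintype Q] [DecidableEq Q] {b : ℕ}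
    (V : Matrix (Q × Reg b) (Q × Reg b) ℂ) (A : Matrix Q Q ℂ) : Prop :=
  V ∈ Matrix.unitaryGroup (Q × Reg b) ℂ ∧ ∀ σ τ, V (σ, 0) (τ, 0) = A σ τ

/-- The gates of a protocol with `b` block-encoding ancilla qubits and a `w`-dimensional
workspace. The system itself is touched only by controlled Heisenberg evolutions. -/
inductive Gate (b w : ℕ)
  /-- A unitary on the ancillas (block-encoding register and workspace) only. -/
  | ancilla (U : Matrix.unitaryGroup (Reg b × Fin w) ℂ)
  /-- One call to the block encoding `V` (or to `V†` if `inverse`), Heisenberg-evolved for a time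
  `t j` controlled by the workspace basis state `j`, and applied only if `control j`. -/
  | call (inverse : Bool) (control : Fin w → Bool) (t : Fin w → ℝ)

/-- The unitary that a gate implements on system, block-encoding register and workspace when the
Hamiltonian that is evolved is `H` and the block encoding is `V`. A call is
`∑ⱼ e^{iHt(j)} V e^{-iHt(j)} ⊗ |j⟩⟨j|`, with the identity in place of `V` where the control is
off. -/
noncomputable def Gate.toMatrix {Q : Type} [Fintype Q] [DecidableEq Q] {b w : ℕ}
    (H : Matrix Q Q ℂ) (V : Matrix (Q × Reg b) (Q × Reg b) ℂ) :
    Gate b w → Matrix ((Q × Reg b) × Fin w) ((Q × Reg b) × Fin w) ℂ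
  | .ancilla U =>
      ((1 : Matrix Q Q ℂ) ⊗ₖ (U : Matrix (Reg b × Fin w) (Reg b × Fin w) ℂ)).submatrix
        (Equiv.prodAssoc Q (Reg b) (Fin w)) (Equiv.prodAssoc Q (Reg b) (Fin w))
  | .call inverse control t =>
      Matrix.blockDiagonal fun j =>
        if control j then
          (evolution H (t j) ⊗ₖ (1 : Matrix (Reg b) (Reg b) ℂ)) * (if inverse then Vᴴ else V) *
            (evolution H (-t j) ⊗ₖ (1 : Matrix (Reg b) (Reg b) ℂ))
        else 1

/-- The Heisenberg evolution time used by a gate: the largest `|t j|` (`‖t‖` is the sup norm). -/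
noncomputable def Gate.time {b w : ℕ} : Gate b w → ℝ
  | .ancilla _ => 0
  | .call _ _ t => ‖t‖

/-- The number of calls to the block encoding in a gate. -/
def Gate.calls {b w : ℕ} : Gate b w → ℕ
  | .ancilla _ => 0
  | .call _ _ _ => 1

/-- A measurement protocol: the gates (in order of application) act on one copy of the input
state, on `|0^b⟩`, and on the workspace state `|start⟩`; then the ancillas are measured in the
computational basis, and `estimate` turns the outcome into the returned number. -/
structure Protocol (b : ℕ) where
  w : ℕ
  start : Fin w
  gates : List (Gate b w)
  estimate : Reg b × Fin w → ℝ

/-- The total controlled Heisenberg evolution time. -/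
noncomputable def Protocol.time {b : ℕ} (P : Protocol b) : ℝ :=
  (P.gates.map Gate.time).sum

/-- The total number of calls to the block encoding. -/
def Protocol.calls {b : ℕ} (P : Protocol b) : ℕ :=
  (P.gates.map Gate.calls).sum

/-- The joint state before the ancillas are measured, for input state `ψ`. -/
noncomputable def Protocol.finalState {Q : Type} [Fintype Q] [DecidableEq Q] {b : ℕ}
    (P : Protocol b) (H : Matrix Q Q ℂ) (V : Matrix (Q × Reg b) (Q × Reg b) ℂ) (ψ : Q → ℂ) :
    (Q × Reg b) × Fin P.w → ℂ :=
  P.gates.foldl (fun v g => g.toMatrix H V *ᵥ v)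
    fun p => if p.1.2 = 0 ∧ p.2 = P.start then ψ p.1.1 else 0

open Classical in
/-- The probability that the returned estimate is within `ε` of `x`. -/
noncomputable def Protocol.successProb {Q : Type} [Fintype Q] [DecidableEq Q] {b : ℕ}
    (P : Protocol b) (H : Matrix Q Q ℂ) (V : Matrix (Q × Reg b) (Q × Reg b) ℂ) (ψ : Q → ℂ)
    (x ε : ℝ) : ℝ :=
  ∑ a : Reg b × Fin P.w with |P.estimate a - x| ≤ ε,
    ∑ σ : Q, ‖P.finalState H V ψ ((σ, a.1), a.2)‖ ^ 2

/-- The state of the system that the protocol returns (ancillas traced out, i.e. averaged over the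
measurement outcomes). -/
noncomputable def Protocol.outputState {Q : Type} [Fintype Q] [DecidableEq Q] {b : ℕ}
    (P : Protocol b) (H : Matrix Q Q ℂ) (V : Matrix (Q × Reg b) (Q × Reg b) ℂ) (ψ : Q → ℂ) :
    Matrix Q Q ℂ :=
  Matrix.of fun σ τ => ∑ a : Reg b × Fin P.w,
    P.finalState H V ψ ((σ, a.1), a.2) * star (P.finalState H V ψ ((τ, a.1), a.2))

/-- Run on `ψ` with evolution under `H` and block encoding `V`, the protocol returns an estimate of
`⟨ψ|A|ψ⟩` that is `ε`-approximate with probability at least `1 - δ`, and a system state `δ`-close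
to `ψ` in trace distance. -/
def Protocol.Succeeds {Q : Type} [Fintype Q] [DecidableEq Q] {b : ℕ}
    (P : Protocol b) (H : Matrix Q Q ℂ) (V : Matrix (Q × Reg b) (Q × Reg b) ℂ)
    (A : Matrix Q Q ℂ) (ψ : Q → ℂ) (ε δ : ℝ) : Prop :=
  1 - δ ≤ P.successProb H V ψ (expectation A ψ) ε ∧
    traceDist (P.outputState H V ψ) (pureState ψ) ≤ δ

end CatalyticTomography

open CatalyticTomography

/-!
The gapped ground state `ψ` is in general not an eigenvector of `A`, so measuring `A` would destroy
it. It is, however, an approximate eigenvector, with eigenvalue `⟨A⟩`, of the time average of `A`: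
in the energy basis the component of `A ψ` at excitation energy `ω` is multiplied by the frequency
response of the averaging, and there is no component with `0 < ω < Δ`. Averaging over sums of `n`
times, each uniform on `0, τ, …, (M - 1) τ` with `M τ ≈ 2π / Δ`, suppresses the frequencies between
`Δ` and `π / τ` by the factor `2⁻ⁿ` (`norm_response_callTime_le`). Higher frequencies hardly occur,
because `[H, A]` has norm `O(|X|)` by locality (`opNorm_commutator_le`); since `τ` does not enter
the cost, the cutoff can be chosen as large as needed. The result is
`vnorm_timeAverage_mulVec_sub_le`.

A superposition over the call times, together with a register whose branches exchange `V` and `V†`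
or are idle, turns the block encoding of `A` into a self-inverse block encoding of half the time
average. Its product with the reflection about the encoding vector is a walk operator. On the span of
the encoded `ψ` and its image the walk has the two eigenphases `z` and `z̄` with `2 Re z = ⟨A⟩`
(`vnorm_walk_mulVec_sub_le`); as `|⟨A⟩| ≤ 1`, their imaginary parts are bounded away from zero.
Phase estimation of the walk reveals `⟨A⟩` up to `ε` with `O(1 / ε)` steps, but also tells `z` from
`z̄`, which would disturb the encoded state. Therefore the sign of the imaginary part is first
computed into an auxiliary register by majority vote over coarse phase estimations, it then decides
whether the walk or its inverse is used in the precise estimation, and it is finally uncomputed. Now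
both eigenvectors leave the registers in the same state
(`vnorm_registerCircuit_sub_idealVector_le`), so the final state is close to a product of `ψ` with a
state of the ancillas, and the majority value of `O(log (1 / δ))` independent estimates is accurate
(`tomography_succeeds`). The variance of a single estimate is controlled by a parabolic window,
for which all sums are explicit (`sum_norm_sub_sq_mul_amplitude`).

The protocol succeeds under truncated evolution as well, since the time average of `A` under `H_r`
is close in norm to the one under `H`. This is a Lieb–Robinson bound
(`norm_heisenbergOp_sub_patch_le`): in the interaction picture the two evolutions of an observable
differ only as far as the evolutions of the terms touching it do, and iterating this step yields
`(v t)ⁿ / n!` when the patch extends `n` interaction ranges beyond the observable. The radius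
required for this is of the form claimed because the gap is bounded in terms of `D` and `R`
(`gap_le`): a site carries an operator `c` with `c² = 0` and `c c† + c† c = 1`, which moves the
ground state at bounded energy cost.
-/

namespace CatalyticTomography

set_option linter.unusedSectionVars false

/-! ### Euclidean norm of coordinate vectors -/

/-- The Euclidean norm of a vector of amplitudes. -/
noncomputable def vnorm {ι : Type*} [Fintype ι] (v : ι → ℂ) : ℝ :=
  ‖(WithLp.toLp 2 v : EuclideanSpace ℂ ι)‖

section vnorm

variable {ι κ : Type*} [Fintype ι] [Fintype κ]

lemma vnorm_sq (v : ι → ℂ) : vnorm v ^ 2 = ∑ i, ‖v i‖ ^ 2 := by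
  simp [vnorm, EuclideanSpace.norm_sq_eq]

lemma vnorm_nonneg (v : ι → ℂ) : 0 ≤ vnorm v := norm_nonneg _

lemma vnorm_add_le (v w : ι → ℂ) : vnorm (v + w) ≤ vnorm v + vnorm w := by
  simpa [vnorm] using norm_add_le (WithLp.toLp 2 v : EuclideanSpace ℂ ι) (WithLp.toLp 2 w)

lemma vnorm_sub_le (v w : ι → ℂ) : vnorm (v - w) ≤ vnorm v + vnorm w := by
  simpa [vnorm] using norm_sub_le (WithLp.toLp 2 v : EuclideanSpace ℂ ι) (WithLp.toLp 2 w)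

lemma vnorm_sub_le_add (u v w : ι → ℂ) : vnorm (u - w) ≤ vnorm (u - v) + vnorm (v - w) := by
  have := vnorm_add_le (u - v) (v - w)
  simpa using this

lemma vnorm_smul (c : ℂ) (v : ι → ℂ) : vnorm (c • v) = ‖c‖ * vnorm v := by
  simpa [vnorm] using norm_smul c (WithLp.toLp 2 v : EuclideanSpace ℂ ι)

lemma vnorm_zero : vnorm (0 : ι → ℂ) = 0 := by simp [vnorm]

lemma vnorm_le_of_sq_le {v : ι → ℂ} {c : ℝ} (hc : 0 ≤ c) (h : ∑ i, ‖v i‖ ^ 2 ≤ c ^ 2) :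
    vnorm v ≤ c := by
  rw [← vnorm_sq] at h
  exact (abs_le_of_sq_le_sq' h hc).2

lemma vnorm_mono {v w : ι → ℂ} (h : ∀ i, ‖v i‖ ≤ ‖w i‖) : vnorm v ≤ vnorm w := by
  refine vnorm_le_of_sq_le (vnorm_nonneg _) ?_
  rw [vnorm_sq]
  exact Finset.sum_le_sum fun i _ => by gcongr; exact h i

lemma vnorm_comp_equiv (e : ι ≃ κ) (v : κ → ℂ) : vnorm (fun i => v (e i)) = vnorm v := by
  have : vnorm (fun i => v (e i)) ^ 2 = vnorm v ^ 2 := by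
    rw [vnorm_sq, vnorm_sq]; exact e.sum_comp fun k => ‖v k‖ ^ 2
  exact (sq_eq_sq₀ (vnorm_nonneg _) (vnorm_nonneg _)).mp this

lemma vnorm_prod_mul (v : ι → ℂ) (w : κ → ℂ) :
    vnorm (fun p : ι × κ => v p.1 * w p.2) = vnorm v * vnorm w := by
  refine (sq_eq_sq₀ (vnorm_nonneg _) (mul_nonneg (vnorm_nonneg _) (vnorm_nonneg _))).mp ?_
  rw [mul_pow, vnorm_sq, vnorm_sq, vnorm_sq, Fintype.sum_prod_type, Finset.sum_mul_sum]
  simp [mul_pow]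

lemma norm_dotProduct_le (v w : ι → ℂ) : ‖star v ⬝ᵥ w‖ ≤ vnorm v * vnorm w := by
  have := norm_inner_le_norm (𝕜 := ℂ) (WithLp.toLp 2 v : EuclideanSpace ℂ ι) (WithLp.toLp 2 w)
  rwa [EuclideanSpace.inner_toLp_toLp, dotProduct_comm] at this

lemma star_dotProduct_self (v : ι → ℂ) : star v ⬝ᵥ v = ((vnorm v ^ 2 : ℝ) : ℂ) := by
  rw [vnorm_sq, dotProduct]
  push_cast
  refine Finset.sum_congr rfl fun i _ => ?_
  simp [← Complex.conj_mul']

lemma vnorm_eq_one {v : ι → ℂ} (h : star v ⬝ᵥ v = 1) : vnorm v = 1 := by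
  rw [star_dotProduct_self] at h
  have : vnorm v ^ 2 = 1 := by exact_mod_cast h
  nlinarith [vnorm_nonneg v]

lemma sum_norm_mul_le (v w : ι → ℂ) : ∑ i, ‖v i‖ * ‖w i‖ ≤ vnorm v * vnorm w := by
  have := Real.sum_mul_le_sqrt_mul_sqrt Finset.univ (fun i => ‖v i‖) fun i => ‖w i‖
  rwa [← vnorm_sq, ← vnorm_sq, Real.sqrt_sq (vnorm_nonneg _), Real.sqrt_sq (vnorm_nonneg _)] at this

variable [DecidableEq ι]

lemma vnorm_mulVec_of_unitary {U : Matrix ι ι ℂ} (hU : U ∈ Matrix.unitaryGroup ι ℂ) (v : ι → ℂ) :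
    vnorm (U *ᵥ v) = vnorm v := by
  have h : star (U *ᵥ v) ⬝ᵥ (U *ᵥ v) = star v ⬝ᵥ v := by
    rw [Matrix.star_mulVec, Matrix.dotProduct_mulVec, Matrix.vecMul_vecMul,
      ← Matrix.star_eq_conjTranspose, Matrix.mem_unitaryGroup_iff'.mp hU, Matrix.vecMul_one]
  rw [star_dotProduct_self, star_dotProduct_self] at h
  exact (sq_eq_sq₀ (vnorm_nonneg _) (vnorm_nonneg _)).mp (by exact_mod_cast h)

end vnorm

lemma vnorm_mulVec_le {Q : Type} [Fintype Q] [DecidableEq Q] (M : Matrix Q Q ℂ) (v : Q → ℂ) :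
    vnorm (M *ᵥ v) ≤ opNorm M * vnorm v := by
  exact (Matrix.toEuclideanCLM (n := Q) (𝕜 := ℂ) M).le_opNorm (WithLp.toLp 2 v)

lemma opNorm_le_of_vnorm_le {Q : Type} [Fintype Q] [DecidableEq Q] {M : Matrix Q Q ℂ} {c : ℝ}
    (hc : 0 ≤ c) (h : ∀ v, vnorm (M *ᵥ v) ≤ c * vnorm v) : opNorm M ≤ c :=
  ContinuousLinearMap.opNorm_le_bound _ hc fun x => h x.ofLp

/-! ### Distance of measurement statistics and output states -/

lemma sum_sq_diff_le {ι : Type*} [Fintype ι] (s : Finset ι) (v w : ι → ℂ) :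
    ∑ i ∈ s, ‖w i‖ ^ 2 - ∑ i ∈ s, ‖v i‖ ^ 2 ≤ vnorm (v - w) * (vnorm v + vnorm w) := by
  calc ∑ i ∈ s, ‖w i‖ ^ 2 - ∑ i ∈ s, ‖v i‖ ^ 2
      = ∑ i ∈ s, (‖w i‖ - ‖v i‖) * (‖v i‖ + ‖w i‖) := by
        rw [← Finset.sum_sub_distrib]; exact Finset.sum_congr rfl fun i _ => by ring
    _ ≤ ∑ i ∈ s, (‖(v - w) i‖ * ‖v i‖ + ‖(v - w) i‖ * ‖w i‖) := by
        refine Finset.sum_le_sum fun i _ => ?_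
        have : ‖w i‖ - ‖v i‖ ≤ ‖(v - w) i‖ := by
          rw [Pi.sub_apply, norm_sub_rev]; exact norm_sub_norm_le _ _
        nlinarith [norm_nonneg (v i), norm_nonneg (w i)]
    _ ≤ ∑ i, (‖(v - w) i‖ * ‖v i‖ + ‖(v - w) i‖ * ‖w i‖) :=
        Finset.sum_le_sum_of_subset_of_nonneg (Finset.subset_univ _) fun i _ _ => by positivity
    _ ≤ _ := by
        rw [Finset.sum_add_distrib, mul_add]
        exact add_le_add (sum_norm_mul_le _ _) (sum_norm_mul_le _ _)

section traceNorm

variable {Q : Type} [Fintype Q] [DecidableEq Q] {α : Type*} [Fintype α]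

/-- The left and right singular vectors of a matrix, both satisfying Bessel's inequality (the left
singular vectors that belong to the singular value zero are chosen to be zero). -/
lemma exists_singular_vectors (M : Matrix Q Q ℂ) :
    ∃ g u : Q → Q → ℂ, (∀ y, ∑ i, ‖star (g i) ⬝ᵥ y‖ ^ 2 ≤ vnorm y ^ 2) ∧
      (∀ y, ∑ i, ‖star y ⬝ᵥ u i‖ ^ 2 ≤ vnorm y ^ 2) ∧
      ∀ i, √((Matrix.isHermitian_conjTranspose_mul_self M).eigenvalues i) ≤
        ‖star (g i) ⬝ᵥ (M *ᵥ u i)‖ := by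
  set hM := Matrix.isHermitian_conjTranspose_mul_self M
  set b := hM.eigenvectorBasis
  set ev := hM.eigenvalues
  have hinner (x y : EuclideanSpace ℂ Q) : inner ℂ x y = star x.ofLp ⬝ᵥ y.ofLp := by
    rw [EuclideanSpace.inner_eq_star_dotProduct, dotProduct_comm]
  have hMM (i j : Q) : star (M *ᵥ (b i).ofLp) ⬝ᵥ (M *ᵥ (b j).ofLp) =
      if i = j then (ev i : ℂ) else 0 := by
    have h1 : star (M *ᵥ (b i).ofLp) ⬝ᵥ (M *ᵥ (b j).ofLp) =
        star (b i).ofLp ⬝ᵥ ((Mᴴ * M) *ᵥ (b j).ofLp) := by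
      rw [Matrix.star_mulVec, Matrix.dotProduct_mulVec, Matrix.vecMul_vecMul,
        Matrix.dotProduct_mulVec]
    rw [h1, hM.mulVec_eigenvectorBasis, dotProduct_smul, ← hinner,
      orthonormal_iff_ite.mp b.orthonormal]
    split_ifs with h
    · subst h; simp [ev]
    · simp
  have hev (i : Q) : 0 ≤ ev i := by
    have h := hMM i i
    rw [star_dotProduct_self, if_pos rfl] at h
    have h' : vnorm (M *ᵥ (b i).ofLp) ^ 2 = ev i := by exact_mod_cast h
    rw [← h']; positivity
  have hsq (i : Q) : ((√(ev i) : ℝ) : ℂ) * (√(ev i) : ℝ) = ev i := by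
    rw [← Complex.ofReal_mul, Real.mul_self_sqrt (hev i)]
  set g : Q → Q → ℂ := fun i => ((√(ev i))⁻¹ : ℂ) • (M *ᵥ (b i).ofLp)
  refine ⟨g, fun i => (b i).ofLp, fun y => ?_, fun y => ?_, fun i => ?_⟩
  · let v : {i // ev i ≠ 0} → EuclideanSpace ℂ Q := fun i => WithLp.toLp 2 (g i)
    have hv : Orthonormal ℂ v := by
      rw [orthonormal_iff_ite]
      intro i j
      rw [hinner]
      simp only [v, g, star_smul, smul_dotProduct, dotProduct_smul, hMM]
      by_cases hij : i = j
      · subst hij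
        have h0 : ((√(ev i) : ℝ) : ℂ) ≠ 0 := by
          rw [Complex.ofReal_ne_zero]
          exact (Real.sqrt_pos.mpr (lt_of_le_of_ne (hev i) (Ne.symm i.2))).ne'
        simp only [if_true, smul_eq_mul]
        rw [← hsq]
        simp
        field_simp
      · have : (i : Q) ≠ j := fun h => hij (Subtype.ext h)
        simp [hij, this]
    have hb := hv.sum_inner_products_le (WithLp.toLp 2 y) (s := Finset.univ)
    have h1 : ∑ i, ‖star (g i) ⬝ᵥ y‖ ^ 2 = ∑ i : {i // ev i ≠ 0}, ‖star (g i) ⬝ᵥ y‖ ^ 2 := by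
      rw [← Finset.sum_filter_of_ne (p := fun i => ev i ≠ 0),
        Finset.sum_subtype _ (p := fun i => ev i ≠ 0) (by simp)]
      intro i _ h h0
      exact h (by simp [g, h0])
    rw [h1]
    refine le_trans (le_of_eq ?_) hb
    refine Finset.sum_congr rfl fun i _ => ?_
    rw [hinner]
  · have hb := b.orthonormal.sum_inner_products_le (WithLp.toLp 2 y) (s := Finset.univ)
    refine le_trans (le_of_eq ?_) hb
    refine Finset.sum_congr rfl fun i _ => ?_
    rw [norm_inner_symm, hinner]
  · simp only [g, star_smul, smul_dotProduct, hMM, if_true, smul_eq_mul]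
    rw [← hsq]
    by_cases h0 : √(ev i) = 0
    · rw [h0]; simp
    · have h0' : ((√(ev i) : ℝ) : ℂ) ≠ 0 := by rwa [Complex.ofReal_ne_zero]
      rw [show star ((√(ev i) : ℂ)⁻¹) = ((√(ev i) : ℝ) : ℂ)⁻¹ by simp, inv_mul_cancel_left₀ h0',
        Complex.norm_real]
      exact le_abs_self _

/-- The partial trace is Lipschitz as a map from vectors to density matrices in trace norm. -/
lemma traceNorm_sub_partial_trace_le (v w : Q × α → ℂ) :
    traceNorm ((Matrix.of fun σ τ => ∑ a, v (σ, a) * star (v (τ, a))) -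
      Matrix.of fun σ τ => ∑ a, w (σ, a) * star (w (τ, a))) ≤
      vnorm (v - w) * (vnorm v + vnorm w) := by
  set M : Matrix Q Q ℂ := (Matrix.of fun σ τ => ∑ a, v (σ, a) * star (v (τ, a))) -
      Matrix.of fun σ τ => ∑ a, w (σ, a) * star (w (τ, a)) with hM
  obtain ⟨g, u, hg, hu, hs⟩ := exists_singular_vectors M
  let va : α → Q → ℂ := fun a σ => v (σ, a)
  let wa : α → Q → ℂ := fun a σ => w (σ, a)
  have hMu (i : Q) : star (g i) ⬝ᵥ (M *ᵥ u i) = ∑ a,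
      ((star (g i) ⬝ᵥ (va a - wa a)) * (star (va a) ⬝ᵥ u i) +
        (star (g i) ⬝ᵥ wa a) * (star (va a - wa a) ⬝ᵥ u i)) := by
    have h1 : M *ᵥ u i = ∑ a, ((star (va a) ⬝ᵥ u i) • va a - (star (wa a) ⬝ᵥ u i) • wa a) := by
      rw [hM, Matrix.sub_mulVec]
      ext σ
      simp only [Pi.sub_apply, Matrix.mulVec, dotProduct, Matrix.of_apply,
        Finset.sum_apply, Pi.smul_apply, smul_eq_mul, Finset.sum_sub_distrib, Finset.sum_mul,
        Pi.star_apply, va, wa]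
      congr 1
      · rw [Finset.sum_comm]
        exact Finset.sum_congr rfl fun a _ => Finset.sum_congr rfl fun τ _ => by ring
      · rw [Finset.sum_comm]
        exact Finset.sum_congr rfl fun a _ => Finset.sum_congr rfl fun τ _ => by ring
    rw [h1, dotProduct_sum]
    refine Finset.sum_congr rfl fun a _ => ?_
    simp only [dotProduct_sub, dotProduct_smul, smul_eq_mul, star_sub, sub_dotProduct]
    ring
  have hcs (p q : Q → ℂ) (f f' : Q → ℝ) (hf : ∑ i, f i ^ 2 ≤ vnorm p ^ 2)
      (hf' : ∑ i, f' i ^ 2 ≤ vnorm q ^ 2) : ∑ i, f i * f' i ≤ vnorm p * vnorm q := by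
    refine (Real.sum_mul_le_sqrt_mul_sqrt Finset.univ f f').trans ?_
    exact mul_le_mul (Real.sqrt_le_iff.mpr ⟨vnorm_nonneg _, hf⟩)
      (Real.sqrt_le_iff.mpr ⟨vnorm_nonneg _, hf'⟩) (Real.sqrt_nonneg _) (vnorm_nonneg _)
  have hsum (x : Q × α → ℂ) : ∑ a, vnorm (fun σ => x (σ, a)) ^ 2 = vnorm x ^ 2 := by
    simp only [vnorm_sq, Fintype.sum_prod_type]
    exact Finset.sum_comm
  have hcs' (x y : Q × α → ℂ) :
      ∑ a, vnorm (fun σ => x (σ, a)) * vnorm (fun σ => y (σ, a)) ≤ vnorm x * vnorm y := by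
    refine (Real.sum_mul_le_sqrt_mul_sqrt Finset.univ _ _).trans ?_
    rw [hsum, hsum, Real.sqrt_sq (vnorm_nonneg _), Real.sqrt_sq (vnorm_nonneg _)]
  calc traceNorm M ≤ ∑ i, ‖star (g i) ⬝ᵥ (M *ᵥ u i)‖ := Finset.sum_le_sum fun i _ => hs i
    _ ≤ ∑ i, ∑ a, (‖star (g i) ⬝ᵥ (va a - wa a)‖ * ‖star (va a) ⬝ᵥ u i‖ +
        ‖star (g i) ⬝ᵥ wa a‖ * ‖star (va a - wa a) ⬝ᵥ u i‖) := by
        refine Finset.sum_le_sum fun i _ => ?_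
        rw [hMu]
        refine (norm_sum_le _ _).trans (Finset.sum_le_sum fun a _ => ?_)
        refine (norm_add_le _ _).trans ?_
        rw [norm_mul, norm_mul]
    _ ≤ ∑ a, (vnorm (va a - wa a) * vnorm (va a) + vnorm (wa a) * vnorm (va a - wa a)) := by
        rw [Finset.sum_comm]
        refine Finset.sum_le_sum fun a _ => ?_
        rw [Finset.sum_add_distrib]
        exact add_le_add (hcs _ _ _ _ (hg _) (hu _)) (hcs _ _ _ _ (hg _) (hu _))
    _ ≤ vnorm (v - w) * vnorm v + vnorm w * vnorm (v - w) := by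
        rw [Finset.sum_add_distrib]
        exact add_le_add (hcs' (v - w) v) (hcs' w (v - w))
    _ = _ := by ring

end traceNorm

/-- If the final joint state is `κ`-close to a product `ψ ⊗ χ`, then the protocol succeeds as soon
as measuring `χ` gives a good estimate with high probability. -/
lemma Protocol.succeeds_of_near_product {Q : Type} [Fintype Q] [DecidableEq Q] {b : ℕ}
    (P : Protocol b) (H : Matrix Q Q ℂ) (V : Matrix (Q × Reg b) (Q × Reg b) ℂ) (A : Matrix Q Q ℂ)
    (ψ : Q → ℂ) (χ : Reg b × Fin P.w → ℂ) {ε δ κ : ℝ} (hψ : vnorm ψ = 1) (hχ : vnorm χ = 1)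
    (hv : vnorm (P.finalState H V ψ) = 1)
    (hclose : vnorm (fun p : (Q × Reg b) × Fin P.w =>
      P.finalState H V ψ p - ψ p.1.1 * χ (p.1.2, p.2)) ≤ κ)
    (hκ : 4 * κ ≤ δ) (s : Finset (Reg b × Fin P.w))
    (hs : ∀ a ∈ s, |P.estimate a - expectation A ψ| ≤ ε)
    (hprob : 1 - δ / 2 ≤ ∑ a ∈ s, ‖χ a‖ ^ 2) :
    P.Succeeds H V A ψ ε δ := by
  classical
  let e : Q × (Reg b × Fin P.w) ≃ (Q × Reg b) × Fin P.w := (Equiv.prodAssoc _ _ _).symm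
  let v : Q × (Reg b × Fin P.w) → ℂ := fun p => P.finalState H V ψ (e p)
  let w : Q × (Reg b × Fin P.w) → ℂ := fun p => ψ p.1 * χ p.2
  have hv1 : vnorm v = 1 := (vnorm_comp_equiv e _).trans hv
  have hw1 : vnorm w = 1 := by
    rw [show w = fun p => ψ p.1 * χ p.2 from rfl, vnorm_prod_mul, hψ, hχ, one_mul]
  have hvw : vnorm (v - w) ≤ κ := by
    rw [← vnorm_comp_equiv e] at hclose
    exact hclose
  have hκ0 : 0 ≤ κ := (vnorm_nonneg _).trans hvw
  constructor
  · unfold Protocol.successProb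
    have h1 : ∑ a ∈ s, ∑ σ : Q, ‖v (σ, a)‖ ^ 2 ≤
        ∑ a : Reg b × Fin P.w with |P.estimate a - expectation A ψ| ≤ ε,
          ∑ σ : Q, ‖P.finalState H V ψ ((σ, a.1), a.2)‖ ^ 2 := by
      refine Finset.sum_le_sum_of_subset_of_nonneg (fun a ha => ?_) fun a _ _ => by positivity
      simpa using hs a ha
    have h2 : ∑ a ∈ s, ∑ σ : Q, ‖w (σ, a)‖ ^ 2 = ∑ a ∈ s, ‖χ a‖ ^ 2 := by
      refine Finset.sum_congr rfl fun a _ => ?_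
      simp only [w, norm_mul, mul_pow]
      rw [← Finset.sum_mul, ← vnorm_sq, hψ]; simp
    have h3 := sum_sq_diff_le (Finset.univ ×ˢ s) v w
    rw [Finset.sum_product_right, Finset.sum_product_right, h2, hv1, hw1] at h3
    linarith
  · unfold traceDist
    have h1 : P.outputState H V ψ = Matrix.of fun σ τ => ∑ a, v (σ, a) * star (v (τ, a)) := rfl
    have h2 : pureState ψ = Matrix.of fun σ τ => ∑ a, w (σ, a) * star (w (τ, a)) := by
      ext σ τ
      have : ∑ a, w (σ, a) * star (w (τ, a)) = ψ σ * star (ψ τ) * (star χ ⬝ᵥ χ) := by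
        simp only [w, dotProduct, Finset.mul_sum, Pi.star_apply, star_mul']
        exact Finset.sum_congr rfl fun a _ => by ring
      rw [Matrix.of_apply, this, star_dotProduct_self, hχ]
      simp [pureState, Matrix.vecMulVec_apply]
    rw [h1, h2]
    have h3 := traceNorm_sub_partial_trace_le v w
    rw [hv1, hw1] at h3
    linarith

/-! ### Circuits on a structured workspace -/

lemma blockDiagonal_mulVec {m o : Type*} [Fintype m] [Fintype o] [DecidableEq o]
    (M : o → Matrix m m ℂ) (v : m × o → ℂ) (i : m) (k : o) :
    (Matrix.blockDiagonal M *ᵥ v) (i, k) = (M k *ᵥ fun i' => v (i', k)) i := by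
  simp only [Matrix.mulVec, dotProduct, Matrix.blockDiagonal_apply, Fintype.sum_prod_type]
  refine Finset.sum_congr rfl fun i' _ => ?_
  rw [Finset.sum_eq_single k (fun k' _ h => by simp [Ne.symm h]) (by simp)]
  simp

lemma blockDiagonal_mem_unitaryGroup {m o : Type*} [Fintype m] [DecidableEq m] [Fintype o]
    [DecidableEq o] {M : o → Matrix m m ℂ} (hM : ∀ k, M k ∈ Matrix.unitaryGroup m ℂ) :
    Matrix.blockDiagonal M ∈ Matrix.unitaryGroup (m × o) ℂ := by
  rw [Matrix.mem_unitaryGroup_iff, Matrix.star_eq_conjTranspose, Matrix.blockDiagonal_conjTranspose,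
    ← Matrix.blockDiagonal_mul, ← Matrix.blockDiagonal_one]
  congr 1
  funext k
  exact Matrix.mem_unitaryGroup_iff.mp (hM k)

lemma submatrix_mem_unitaryGroup {m n : Type*} [Fintype m] [DecidableEq m] [Fintype n]
    [DecidableEq n] {M : Matrix n n ℂ} (hM : M ∈ Matrix.unitaryGroup n ℂ) (e : m ≃ n) :
    M.submatrix e e ∈ Matrix.unitaryGroup m ℂ := by
  rw [Matrix.mem_unitaryGroup_iff, Matrix.star_eq_conjTranspose, Matrix.conjTranspose_submatrix,
    Matrix.submatrix_mul_equiv, ← Matrix.star_eq_conjTranspose, Matrix.mem_unitaryGroup_iff.mp hM,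
    Matrix.submatrix_one_equiv]

lemma one_kronecker_mem_unitaryGroup (m : Type*) {n : Type*} [Fintype m] [DecidableEq m]
    [Fintype n] [DecidableEq n] {M : Matrix n n ℂ} (hM : M ∈ Matrix.unitaryGroup n ℂ) :
    (1 : Matrix m m ℂ) ⊗ₖ M ∈ Matrix.unitaryGroup (m × n) ℂ :=
  Matrix.kronecker_mem_unitary (one_mem _) hM

lemma one_kronecker_mulVec {m n : Type*} [Fintype m] [DecidableEq m] [Fintype n]
    (M : Matrix n n ℂ) (v : m × n → ℂ) (i : m) (j : n) :
    (((1 : Matrix m m ℂ) ⊗ₖ M) *ᵥ v) (i, j) = (M *ᵥ fun j' => v (i, j')) j := by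
  simp only [Matrix.mulVec, dotProduct, Matrix.kroneckerMap_apply, Fintype.sum_prod_type,
    Matrix.one_apply]
  rw [Finset.sum_eq_single i (fun i' _ h => by simp [Ne.symm h]) (by simp)]
  simp

lemma submatrix_mulVec_comp {m n : Type*} [Fintype m] [Fintype n]
    (M : Matrix n n ℂ) (e : m ≃ n) (v : m → ℂ) (i : m) :
    (M.submatrix e e *ᵥ v) i = (M *ᵥ fun j => v (e.symm j)) (e i) := by
  simp only [Matrix.mulVec, dotProduct, Matrix.submatrix_apply]
  exact Fintype.sum_equiv e _ _ fun j => by simp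

section evolution

variable {Q : Type} [Fintype Q] [DecidableEq Q]

lemma evolution_mem_unitaryGroup {H : Matrix Q Q ℂ} (hH : H.IsHermitian) (t : ℝ) :
    evolution H t ∈ Matrix.unitaryGroup Q ℂ := by
  rw [Matrix.mem_unitaryGroup_iff, evolution, Matrix.star_eq_conjTranspose,
    ← Matrix.exp_conjTranspose, Matrix.conjTranspose_smul, hH.eq, ← Matrix.exp_add_of_commute]
  · simp
  · exact (Commute.refl H).smul_left _ |>.smul_right _

lemma evolution_neg {H : Matrix Q Q ℂ} (hH : H.IsHermitian) (t : ℝ) :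
    evolution H (-t) = (evolution H t)ᴴ := by
  rw [evolution, evolution, ← Matrix.exp_conjTranspose, Matrix.conjTranspose_smul, hH.eq]
  simp

end evolution

section Workspace

variable {Q : Type} [Fintype Q] [DecidableEq Q] {b w : ℕ}
  {Enc K : Type} [Fintype Enc] [DecidableEq Enc] [Fintype K] [DecidableEq K]

/-- An operator on block-encoding register and encoding register, acting also on the system as the
identity. -/
def liftAncilla (Q : Type) [DecidableEq Q] (U : Matrix (Reg b × Enc) (Reg b × Enc) ℂ) :
    Matrix ((Q × Reg b) × Enc) ((Q × Reg b) × Enc) ℂ :=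
  ((1 : Matrix Q Q ℂ) ⊗ₖ U).submatrix (Equiv.prodAssoc Q (Reg b) Enc)
    (Equiv.prodAssoc Q (Reg b) Enc)

/-- The Heisenberg-evolved block encoding, with evolution time and control read off from the
encoding register. -/
noncomputable def callMatrix (H : Matrix Q Q ℂ) (V : Matrix (Q × Reg b) (Q × Reg b) ℂ)
    (inverse : Bool) (control : Enc → Bool) (t : Enc → ℝ) :
    Matrix ((Q × Reg b) × Enc) ((Q × Reg b) × Enc) ℂ :=
  Matrix.blockDiagonal fun j =>
    if control j then
      (evolution H (t j) ⊗ₖ (1 : Matrix (Reg b) (Reg b) ℂ)) * (if inverse then Vᴴ else V) *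
        (evolution H (-t j) ⊗ₖ (1 : Matrix (Reg b) (Reg b) ℂ))
    else 1

lemma liftAncilla_mem_unitaryGroup {U : Matrix (Reg b × Enc) (Reg b × Enc) ℂ}
    (hU : U ∈ Matrix.unitaryGroup (Reg b × Enc) ℂ) :
    liftAncilla Q U ∈ Matrix.unitaryGroup ((Q × Reg b) × Enc) ℂ :=
  submatrix_mem_unitaryGroup (one_kronecker_mem_unitaryGroup Q hU) _

lemma liftAncilla_mul (U U' : Matrix (Reg b × Enc) (Reg b × Enc) ℂ) :
    liftAncilla Q (U * U') = liftAncilla Q U * liftAncilla Q U' := by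
  rw [liftAncilla, liftAncilla, liftAncilla, Matrix.submatrix_mul_equiv, ← Matrix.mul_kronecker_mul,
    mul_one]

lemma liftAncilla_one :
    liftAncilla Q (1 : Matrix (Reg b × Enc) (Reg b × Enc) ℂ) = 1 := by
  simp [liftAncilla]

lemma liftAncilla_mulVec (U : Matrix (Reg b × Enc) (Reg b × Enc) ℂ)
    (v : (Q × Reg b) × Enc → ℂ) (σ : Q) (β : Reg b) (e : Enc) :
    (liftAncilla Q U *ᵥ v) ((σ, β), e) = (U *ᵥ fun a => v ((σ, a.1), a.2)) (β, e) := by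
  rw [liftAncilla, submatrix_mulVec_comp]
  exact one_kronecker_mulVec _ _ _ _

lemma evolved_mem_unitaryGroup {H : Matrix Q Q ℂ} (hH : H.IsHermitian)
    {V : Matrix (Q × Reg b) (Q × Reg b) ℂ} (hV : V ∈ Matrix.unitaryGroup (Q × Reg b) ℂ) (t : ℝ) :
    (evolution H t ⊗ₖ (1 : Matrix (Reg b) (Reg b) ℂ)) * V *
      (evolution H (-t) ⊗ₖ (1 : Matrix (Reg b) (Reg b) ℂ)) ∈ Matrix.unitaryGroup (Q × Reg b) ℂ :=
  mul_mem (mul_mem (Matrix.kronecker_mem_unitary (evolution_mem_unitaryGroup hH _) (one_mem _)) hV)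
    (Matrix.kronecker_mem_unitary (evolution_mem_unitaryGroup hH _) (one_mem _))

lemma callMatrix_mem_unitaryGroup {H : Matrix Q Q ℂ} (hH : H.IsHermitian)
    {V : Matrix (Q × Reg b) (Q × Reg b) ℂ} (hV : V ∈ Matrix.unitaryGroup (Q × Reg b) ℂ)
    (inverse : Bool) (control : Enc → Bool) (t : Enc → ℝ) :
    callMatrix H V inverse control t ∈ Matrix.unitaryGroup ((Q × Reg b) × Enc) ℂ := by
  refine blockDiagonal_mem_unitaryGroup fun j => ?_
  split_ifs with h1 h2
  · exact evolved_mem_unitaryGroup hH (Unitary.star_mem hV) _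
  · exact evolved_mem_unitaryGroup hH hV _
  · exact one_mem _

/-- The part of a joint state on which the registers are in the basis state `k`. -/
def slice (e : Enc × K ≃ Fin w) (v : (Q × Reg b) × Fin w → ℂ) (k : K) : (Q × Reg b) × Enc → ℂ :=
  fun p => v (p.1, e (p.2, k))

/-- The block-encoding register and workspace, split into block-encoding and encoding registers on
the one hand and the remaining registers on the other. -/
def ancillaEquiv (b : ℕ) (e : Enc × K ≃ Fin w) : Reg b × Fin w ≃ (Reg b × Enc) × K :=
  ((Equiv.refl _).prodCongr e.symm).trans (Equiv.prodAssoc _ _ _).symm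

/-- Apply `U k` to the block-encoding and encoding registers, controlled by the register state
`k`. -/
def controlledGate (e : Enc × K ≃ Fin w) (U : K → Matrix.unitaryGroup (Reg b × Enc) ℂ) :
    Gate b w :=
  .ancilla ⟨(Matrix.blockDiagonal fun k => (U k).1).submatrix (ancillaEquiv b e) (ancillaEquiv b e),
    submatrix_mem_unitaryGroup (blockDiagonal_mem_unitaryGroup fun k => (U k).2) _⟩

/-- Apply a unitary to the registers. -/
def registerGate (e : Enc × K ≃ Fin w) (U : Matrix.unitaryGroup K ℂ) : Gate b w :=
  .ancilla ⟨((1 : Matrix (Reg b × Enc) (Reg b × Enc) ℂ) ⊗ₖ U.1).submatrix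
      (ancillaEquiv b e) (ancillaEquiv b e),
    submatrix_mem_unitaryGroup (one_kronecker_mem_unitaryGroup _ U.2) _⟩

/-- A call with evolution time read off from the encoding register. -/
def callGate (e : Enc × K ≃ Fin w) (inverse : Bool) (control : K → Enc → Bool) (t : Enc → ℝ) :
    Gate b w :=
  .call inverse (fun j => control (e.symm j).2 (e.symm j).1) fun j => t (e.symm j).1

lemma ancilla_mulVec (H : Matrix Q Q ℂ) (V : Matrix (Q × Reg b) (Q × Reg b) ℂ)
    (U : Matrix.unitaryGroup (Reg b × Fin w) ℂ) (v : (Q × Reg b) × Fin w → ℂ)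
    (σ : Q) (β : Reg b) (j : Fin w) :
    ((Gate.ancilla U).toMatrix H V *ᵥ v) ((σ, β), j) =
      (U.1 *ᵥ fun a => v ((σ, a.1), a.2)) (β, j) := by
  rw [Gate.toMatrix, submatrix_mulVec_comp]
  exact one_kronecker_mulVec _ _ _ _

lemma slice_controlledGate (H : Matrix Q Q ℂ) (V : Matrix (Q × Reg b) (Q × Reg b) ℂ)
    (e : Enc × K ≃ Fin w) (U : K → Matrix.unitaryGroup (Reg b × Enc) ℂ)
    (v : (Q × Reg b) × Fin w → ℂ) (k : K) :
    slice e ((controlledGate e U).toMatrix H V *ᵥ v) k = liftAncilla Q (U k).1 *ᵥ slice e v k := by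
  ext ⟨⟨σ, β⟩, x⟩
  rw [liftAncilla_mulVec, slice, controlledGate, ancilla_mulVec, submatrix_mulVec_comp]
  simp only [ancillaEquiv, Equiv.trans_apply, Equiv.prodCongr_apply, Prod.map_apply,
    Equiv.symm_apply_apply, Equiv.prodAssoc_symm_apply, Equiv.refl_apply]
  rw [blockDiagonal_mulVec]
  rfl

lemma slice_registerGate (H : Matrix Q Q ℂ) (V : Matrix (Q × Reg b) (Q × Reg b) ℂ)
    (e : Enc × K ≃ Fin w) (U : Matrix.unitaryGroup K ℂ)
    (v : (Q × Reg b) × Fin w → ℂ) (k : K) :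
    slice e ((registerGate e U).toMatrix H V *ᵥ v) k = ∑ k', U.1 k k' • slice e v k' := by
  ext ⟨⟨σ, β⟩, x⟩
  rw [slice, registerGate, ancilla_mulVec, submatrix_mulVec_comp]
  simp only [ancillaEquiv, Equiv.trans_apply, Equiv.prodCongr_apply, Prod.map_apply,
    Equiv.symm_apply_apply, Equiv.prodAssoc_symm_apply, Equiv.refl_apply]
  rw [one_kronecker_mulVec]
  simp only [Matrix.mulVec, dotProduct, Finset.sum_apply, Pi.smul_apply, smul_eq_mul]
  rfl

lemma slice_callGate (H : Matrix Q Q ℂ) (V : Matrix (Q × Reg b) (Q × Reg b) ℂ)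
    (e : Enc × K ≃ Fin w) (inverse : Bool) (control : K → Enc → Bool) (t : Enc → ℝ)
    (v : (Q × Reg b) × Fin w → ℂ) (k : K) :
    slice e ((callGate e inverse control t).toMatrix H V *ᵥ v) k =
      callMatrix H V inverse (control k) t *ᵥ slice e v k := by
  ext ⟨p, x⟩
  rw [slice, callGate, Gate.toMatrix, blockDiagonal_mulVec, callMatrix, blockDiagonal_mulVec]
  simp only [Equiv.symm_apply_apply]
  rfl

/-- The state after running a list of gates. -/
noncomputable def runGates (H : Matrix Q Q ℂ) (V : Matrix (Q × Reg b) (Q × Reg b) ℂ)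
    (gs : List (Gate b w)) (v : (Q × Reg b) × Fin w → ℂ) : (Q × Reg b) × Fin w → ℂ :=
  gs.foldl (fun v g => g.toMatrix H V *ᵥ v) v

lemma runGates_append (H : Matrix Q Q ℂ) (V : Matrix (Q × Reg b) (Q × Reg b) ℂ)
    (gs gs' : List (Gate b w)) (v : (Q × Reg b) × Fin w → ℂ) :
    runGates H V (gs ++ gs') v = runGates H V gs' (runGates H V gs v) := List.foldl_append ..

end Workspace

/-! ### The qubitized walk -/

section Walk

variable {Q : Type} [Fintype Q] [DecidableEq Q] {b w : ℕ}
  {J K : Type} [Fintype J] [DecidableEq J] [Fintype K] [DecidableEq K]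

/-- The operator on the branch register that exchanges the branches `V` and `V†` (`0` and `1`) and
has opposite signs on the two idle branches (`2` and `3`). -/
def branchMatrix : Matrix (Fin 4) (Fin 4) ℂ :=
  !![0, 1, 0, 0; 1, 0, 0, 0; 0, 0, 1, 0; 0, 0, 0, -1]

lemma branchMatrix_mem_unitaryGroup : branchMatrix ∈ Matrix.unitaryGroup (Fin 4) ℂ := by
  rw [Matrix.mem_unitaryGroup_iff]
  ext i j
  fin_cases i <;> fin_cases j <;>
    simp [branchMatrix, Matrix.mul_apply, Matrix.star_apply, Fin.sum_univ_succ]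

/-- `branchMatrix` as an operator on block-encoding and encoding registers. -/
def branchUnitary (b : ℕ) (J : Type) [Fintype J] [DecidableEq J] :
    Matrix.unitaryGroup (Reg b × (J × Fin 4)) ℂ :=
  ⟨(1 : Matrix (Reg b) (Reg b) ℂ) ⊗ₖ ((1 : Matrix J J ℂ) ⊗ₖ branchMatrix),
    one_kronecker_mem_unitaryGroup _ (one_kronecker_mem_unitaryGroup _
      branchMatrix_mem_unitaryGroup)⟩

/-- The uniform superposition over the encoding register, with block-encoding register
`|0^b⟩`. -/
noncomputable def encodingVector (b : ℕ) (J : Type) [Fintype J] : Reg b × (J × Fin 4) → ℂ :=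
  fun a => if a.1 = 0 then ((2 * √(Fintype.card J : ℝ) : ℝ) : ℂ)⁻¹ else 0

lemma star_encodingVector (b : ℕ) (J : Type) [Fintype J] :
    star (encodingVector b J) = encodingVector b J := by
  ext a
  simp only [encodingVector, Pi.star_apply]
  split_ifs <;> simp

lemma encodingVector_dotProduct (b : ℕ) [Nonempty J] (v : Reg b × (J × Fin 4) → ℂ) :
    encodingVector b J ⬝ᵥ v =
      ((2 * √(Fintype.card J : ℝ) : ℝ) : ℂ)⁻¹ * ∑ x : J × Fin 4, v (0, x) := by
  rw [dotProduct, Fintype.sum_prod_type, Finset.sum_eq_single 0 (fun β _ h => by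
    simp [encodingVector, h]) (by simp), Finset.mul_sum]
  simp [encodingVector]

lemma encodingVector_dotProduct_self (b : ℕ) [Nonempty J] :
    encodingVector b J ⬝ᵥ encodingVector b J = 1 := by
  rw [encodingVector_dotProduct]
  simp only [encodingVector, if_true, Finset.sum_const, Finset.card_univ, Fintype.card_prod,
    Fintype.card_fin, nsmul_eq_mul]
  have h0 : (0 : ℝ) < Fintype.card J := by exact_mod_cast Fintype.card_pos
  have h : (2 * √(Fintype.card J : ℝ)) * (2 * √(Fintype.card J : ℝ)) = Fintype.card J * 4 := by
    nlinarith [Real.mul_self_sqrt h0.le]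
  have h' : ((2 * √(Fintype.card J : ℝ) : ℝ) : ℂ) * ((2 * √(Fintype.card J : ℝ) : ℝ) : ℂ) =
      Fintype.card J * 4 := by exact_mod_cast congrArg (fun x : ℝ => (x : ℂ)) h
  have h1 : ((2 * √(Fintype.card J : ℝ) : ℝ) : ℂ) ≠ 0 := by
    rw [Complex.ofReal_ne_zero]; positivity
  rw [Nat.cast_mul, Nat.cast_ofNat, ← h']
  field_simp

lemma vnorm_encodingVector (b : ℕ) [Nonempty J] : vnorm (encodingVector b J) = 1 :=
  vnorm_eq_one (by rw [star_encodingVector, encodingVector_dotProduct_self])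

/-- The reflection `2|r⟩⟨r| - 1` about the encoding vector. -/
noncomputable def reflection (b : ℕ) (J : Type) [Fintype J] [DecidableEq J] :
    Matrix (Reg b × (J × Fin 4)) (Reg b × (J × Fin 4)) ℂ :=
  (2 : ℂ) • Matrix.vecMulVec (encodingVector b J) (encodingVector b J) - 1

lemma reflection_mulVec (b : ℕ) (v : Reg b × (J × Fin 4) → ℂ) :
    reflection b J *ᵥ v = (2 * (encodingVector b J ⬝ᵥ v)) • encodingVector b J - v := by
  rw [reflection, Matrix.sub_mulVec, Matrix.smul_mulVec, Matrix.one_mulVec,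
    Matrix.vecMulVec_mulVec]
  ext i
  simp
  ring

lemma reflection_mul_self (b : ℕ) [Nonempty J] : reflection b J * reflection b J = 1 := by
  refine Matrix.ext_of_mulVec_single fun i => ?_
  rw [← Matrix.mulVec_mulVec, Matrix.one_mulVec, reflection_mulVec, reflection_mulVec,
    dotProduct_sub, dotProduct_smul, encodingVector_dotProduct_self]
  ext j
  simp
  ring

lemma reflection_mem_unitaryGroup (b : ℕ) [Nonempty J] :
    reflection b J ∈ Matrix.unitaryGroup (Reg b × (J × Fin 4)) ℂ := by
  have h : star (reflection b J) = reflection b J := by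
    rw [Matrix.star_eq_conjTranspose, reflection, Matrix.conjTranspose_sub,
      Matrix.conjTranspose_smul, Matrix.conjTranspose_vecMulVec, star_encodingVector]
    simp
  rw [Matrix.mem_unitaryGroup_iff, h, reflection_mul_self]

/-- The reflection as a gate. -/
noncomputable def reflectionUnitary (b : ℕ) (J : Type) [Fintype J] [DecidableEq J] [Nonempty J] :
    Matrix.unitaryGroup (Reg b × (J × Fin 4)) ℂ :=
  ⟨reflection b J, reflection_mem_unitaryGroup b⟩

/-- The self-inverse block encoding of (half) the time average of `V`: conditioned on the branch
register it applies `V` or `V†` and exchanges the two branches, or a sign. -/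
noncomputable def selfInverseEncoding (H : Matrix Q Q ℂ) (V : Matrix (Q × Reg b) (Q × Reg b) ℂ)
    (t : J → ℝ) : Matrix ((Q × Reg b) × (J × Fin 4)) ((Q × Reg b) × (J × Fin 4)) ℂ :=
  liftAncilla Q (branchUnitary b J).1 *
    (callMatrix H V true (fun x => x.2 = 1) (fun x => t x.1) *
      callMatrix H V false (fun x => x.2 = 0) (fun x => t x.1))

/-- The Heisenberg evolution of `V`, with block-encoding register untouched. -/
noncomputable def heisenberg (H : Matrix Q Q ℂ) (V : Matrix (Q × Reg b) (Q × Reg b) ℂ) (t : ℝ) :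
    Matrix (Q × Reg b) (Q × Reg b) ℂ :=
  (evolution H t ⊗ₖ (1 : Matrix (Reg b) (Reg b) ℂ)) * V *
    (evolution H (-t) ⊗ₖ (1 : Matrix (Reg b) (Reg b) ℂ))

lemma conjTranspose_heisenberg {H : Matrix Q Q ℂ} (hH : H.IsHermitian)
    (V : Matrix (Q × Reg b) (Q × Reg b) ℂ) (t : ℝ) :
    (heisenberg H V t)ᴴ = heisenberg H Vᴴ t := by
  rw [heisenberg, heisenberg, Matrix.conjTranspose_mul, Matrix.conjTranspose_mul,
    Matrix.conjTranspose_kronecker, Matrix.conjTranspose_kronecker, evolution_neg hH,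
    Matrix.conjTranspose_conjTranspose, Matrix.conjTranspose_one, mul_assoc]

lemma branchUnitary_mulVec (v : Reg b × (J × Fin 4) → ℂ) (β : Reg b) (j : J) (s : Fin 4) :
    ((branchUnitary b J).1 *ᵥ v) (β, (j, s)) = (branchMatrix *ᵥ fun s' => v (β, (j, s'))) s := by
  rw [branchUnitary, one_kronecker_mulVec, one_kronecker_mulVec]

lemma branchMatrix_mulVec (u : Fin 4 → ℂ) : branchMatrix *ᵥ u = ![u 1, u 0, u 2, -u 3] := by
  ext s
  fin_cases s <;> simp [branchMatrix, Matrix.mulVec, dotProduct, Fin.sum_univ_four]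

lemma callMatrix_mulVec {Enc : Type} [Fintype Enc] [DecidableEq Enc] (H : Matrix Q Q ℂ)
    (V : Matrix (Q × Reg b) (Q × Reg b) ℂ) (inverse : Bool) (control : Enc → Bool) (t : Enc → ℝ)
    (v : (Q × Reg b) × Enc → ℂ) (p : Q × Reg b) (x : Enc) :
    (callMatrix H V inverse control t *ᵥ v) (p, x) =
      if control x then
        (heisenberg H (if inverse then Vᴴ else V) (t x) *ᵥ fun p' => v (p', x)) p
      else v (p, x) := by
  rw [callMatrix, blockDiagonal_mulVec]
  split_ifs <;> simp [heisenberg]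

lemma selfInverseEncoding_mulVec (H : Matrix Q Q ℂ) (V : Matrix (Q × Reg b) (Q × Reg b) ℂ)
    (t : J → ℝ) (v : (Q × Reg b) × (J × Fin 4) → ℂ) (p : Q × Reg b) (j : J) :
    (selfInverseEncoding H V t *ᵥ v) (p, (j, 0)) =
        (heisenberg H Vᴴ (t j) *ᵥ fun p' => v (p', (j, 1))) p ∧
      (selfInverseEncoding H V t *ᵥ v) (p, (j, 1)) =
        (heisenberg H V (t j) *ᵥ fun p' => v (p', (j, 0))) p ∧
      (selfInverseEncoding H V t *ᵥ v) (p, (j, 2)) = v (p, (j, 2)) ∧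
      (selfInverseEncoding H V t *ᵥ v) (p, (j, 3)) = -v (p, (j, 3)) := by
  obtain ⟨σ, β⟩ := p
  simp only [selfInverseEncoding, ← Matrix.mulVec_mulVec]
  refine ⟨?_, ?_, ?_, ?_⟩ <;>
  · rw [liftAncilla_mulVec, branchUnitary_mulVec, branchMatrix_mulVec]
    simp [callMatrix_mulVec]

lemma heisenberg_mem_unitaryGroup {H : Matrix Q Q ℂ} (hH : H.IsHermitian)
    {V : Matrix (Q × Reg b) (Q × Reg b) ℂ} (hV : V ∈ Matrix.unitaryGroup (Q × Reg b) ℂ) (t : ℝ) :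
    heisenberg H V t ∈ Matrix.unitaryGroup (Q × Reg b) ℂ := evolved_mem_unitaryGroup hH hV t

lemma selfInverseEncoding_mul_self {H : Matrix Q Q ℂ} (hH : H.IsHermitian)
    {V : Matrix (Q × Reg b) (Q × Reg b) ℂ} (hV : V ∈ Matrix.unitaryGroup (Q × Reg b) ℂ)
    (t : J → ℝ) : selfInverseEncoding H V t * selfInverseEncoding H V t = 1 := by
  have h1 (s : ℝ) : heisenberg H V s * heisenberg H Vᴴ s = 1 := by
    rw [← conjTranspose_heisenberg hH]
    exact Matrix.mem_unitaryGroup_iff.mp (heisenberg_mem_unitaryGroup hH hV s)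
  have h2 (s : ℝ) : heisenberg H Vᴴ s * heisenberg H V s = 1 := by
    rw [← conjTranspose_heisenberg hH]
    exact Matrix.mem_unitaryGroup_iff'.mp (heisenberg_mem_unitaryGroup hH hV s)
  refine Matrix.ext_of_mulVec_single fun i => ?_
  generalize (Pi.single i 1 : (Q × Reg b) × (J × Fin 4) → ℂ) = v
  rw [← Matrix.mulVec_mulVec, Matrix.one_mulVec]
  ext ⟨p, j, s⟩
  have key (u) := selfInverseEncoding_mulVec H V t u p j
  fin_cases s
  · refine (key _).1.trans ?_
    simp only [(selfInverseEncoding_mulVec H V t v _ j).2.1]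
    change (heisenberg H Vᴴ (t j) *ᵥ (heisenberg H V (t j) *ᵥ fun p' => v (p', (j, 0)))) p = _
    rw [Matrix.mulVec_mulVec, h2, Matrix.one_mulVec]
    rfl
  · refine (key _).2.1.trans ?_
    simp only [(selfInverseEncoding_mulVec H V t v _ j).1]
    change (heisenberg H V (t j) *ᵥ (heisenberg H Vᴴ (t j) *ᵥ fun p' => v (p', (j, 1)))) p = _
    rw [Matrix.mulVec_mulVec, h1, Matrix.one_mulVec]
    rfl
  · exact (key _).2.2.1.trans (key _).2.2.1
  · refine (key _).2.2.2.trans ?_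
    rw [(key _).2.2.2, neg_neg]
    rfl

lemma selfInverseEncoding_mem_unitaryGroup {H : Matrix Q Q ℂ} (hH : H.IsHermitian)
    {V : Matrix (Q × Reg b) (Q × Reg b) ℂ} (hV : V ∈ Matrix.unitaryGroup (Q × Reg b) ℂ)
    (t : J → ℝ) :
    selfInverseEncoding H V t ∈ Matrix.unitaryGroup ((Q × Reg b) × (J × Fin 4)) ℂ :=
  mul_mem (liftAncilla_mem_unitaryGroup (branchUnitary b J).2)
    (mul_mem (callMatrix_mem_unitaryGroup hH hV _ _ _) (callMatrix_mem_unitaryGroup hH hV _ _ _))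

lemma kronecker_one_mulVec {m n : Type*} [Fintype m] [Fintype n] [DecidableEq n]
    (M : Matrix m m ℂ) (v : m × n → ℂ) (i : m) (j : n) :
    ((M ⊗ₖ (1 : Matrix n n ℂ)) *ᵥ v) (i, j) = (M *ᵥ fun i' => v (i', j)) i := by
  simp only [Matrix.mulVec, dotProduct, Matrix.kroneckerMap_apply, Fintype.sum_prod_type,
    Matrix.one_apply]
  refine Finset.sum_congr rfl fun i' _ => ?_
  rw [Finset.sum_eq_single j (fun j' _ h => by simp [Ne.symm h]) (by simp)]
  simp

/-- The Heisenberg evolution of a block encoding is a block encoding of the Heisenberg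
evolution. -/
lemma heisenberg_mulVec_zero {V : Matrix (Q × Reg b) (Q × Reg b) ℂ} {A : Matrix Q Q ℂ}
    (hV : ∀ σ τ, V (σ, 0) (τ, 0) = A σ τ) (H : Matrix Q Q ℂ) (t : ℝ) (ψ : Q → ℂ) (σ : Q) :
    (heisenberg H V t *ᵥ fun p => if p.2 = 0 then ψ p.1 else 0) (σ, 0) =
      ((evolution H t * A * evolution H (-t)) *ᵥ ψ) σ := by
  have h1 : (evolution H (-t) ⊗ₖ (1 : Matrix (Reg b) (Reg b) ℂ)) *ᵥ
      (fun p : Q × Reg b => if p.2 = 0 then ψ p.1 else 0) =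
        fun p => if p.2 = 0 then (evolution H (-t) *ᵥ ψ) p.1 else 0 := by
    ext ⟨τ, β⟩
    rw [kronecker_one_mulVec]
    by_cases hβ : β = 0
    · simp [hβ]
    · simp only [hβ, if_false]
      exact congrFun (Matrix.mulVec_zero _) τ
  have h2 (φ : Q → ℂ) (τ : Q) : (V *ᵥ fun p => if p.2 = 0 then φ p.1 else 0) (τ, 0) =
      (A *ᵥ φ) τ := by
    simp [Matrix.mulVec, dotProduct, Fintype.sum_prod_type, hV]
  rw [heisenberg, ← Matrix.mulVec_mulVec, ← Matrix.mulVec_mulVec, h1, kronecker_one_mulVec]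
  simp only [h2]
  change (evolution H t *ᵥ (A *ᵥ (evolution H (-t) *ᵥ ψ))) σ = _
  rw [Matrix.mulVec_mulVec, Matrix.mulVec_mulVec, mul_assoc]

/-- The state `ψ` of the system, tensored with the encoding vector. -/
noncomputable def encoded (b : ℕ) (J : Type) [Fintype J] (ψ : Q → ℂ) :
    (Q × Reg b) × (J × Fin 4) → ℂ :=
  fun p => ψ p.1.1 * encodingVector b J (p.1.2, p.2)

lemma vnorm_encoded [Nonempty J] (ψ : Q → ℂ) : vnorm (encoded b J ψ) = vnorm ψ := by
  have := vnorm_prod_mul ψ (encodingVector b J)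
  rw [vnorm_encodingVector, mul_one] at this
  rw [← this, ← vnorm_comp_equiv (Equiv.prodAssoc Q (Reg b) (J × Fin 4))]
  rfl

lemma encoded_sub (ψ φ : Q → ℂ) : encoded b J (ψ - φ) = encoded b J ψ - encoded b J φ := by
  ext p; simp [encoded, sub_mul]

lemma encoded_smul (c : ℂ) (ψ : Q → ℂ) : encoded b J (c • ψ) = c • encoded b J ψ := by
  ext p; simp [encoded, mul_assoc]

lemma liftAncilla_reflection_mulVec (v : (Q × Reg b) × (J × Fin 4) → ℂ) :
    liftAncilla Q (reflection b J) *ᵥ v =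
      (2 : ℂ) • encoded b J (fun σ => encodingVector b J ⬝ᵥ fun a => v ((σ, a.1), a.2)) - v := by
  ext ⟨⟨σ, β⟩, x⟩
  rw [liftAncilla_mulVec, reflection_mulVec]
  simp [encoded, mul_assoc]

lemma liftAncilla_reflection_mulVec_encoded [Nonempty J] (ψ : Q → ℂ) :
    liftAncilla Q (reflection b J) *ᵥ encoded b J ψ = encoded b J ψ := by
  rw [liftAncilla_reflection_mulVec]
  have (σ : Q) : (encodingVector b J ⬝ᵥ fun a => encoded b J ψ ((σ, a.1), a.2)) = ψ σ := by
    change (encodingVector b J ⬝ᵥ (ψ σ • encodingVector b J)) = ψ σ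
    rw [dotProduct_smul, encodingVector_dotProduct_self, smul_eq_mul, mul_one]
  simp only [this, two_smul, add_sub_cancel_right]

/-- The average of the Heisenberg evolutions of `A` over the times `t j`. -/
noncomputable def timeAverage (H A : Matrix Q Q ℂ) (t : J → ℝ) : Matrix Q Q ℂ :=
  (Fintype.card J : ℂ)⁻¹ • ∑ j, evolution H (t j) * A * evolution H (-t j)

lemma encodingVector_dotProduct_selfInverseEncoding [Nonempty J] {H : Matrix Q Q ℂ}
    {V : Matrix (Q × Reg b) (Q × Reg b) ℂ} {A : Matrix Q Q ℂ} (hA : A.IsHermitian)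
    (hV : ∀ σ τ, V (σ, 0) (τ, 0) = A σ τ) (t : J → ℝ) (ψ : Q → ℂ) (σ : Q) :
    (encodingVector b J ⬝ᵥ fun a => (selfInverseEncoding H V t *ᵥ encoded b J ψ) ((σ, a.1), a.2)) =
      ((2 : ℂ)⁻¹ • (timeAverage H A t *ᵥ ψ)) σ := by
  have hV' : ∀ σ τ, Vᴴ (σ, 0) (τ, 0) = A σ τ := fun σ τ => by
    rw [Matrix.conjTranspose_apply, hV, ← Matrix.conjTranspose_apply, hA.eq]
  set c : ℂ := ((2 * √(Fintype.card J : ℝ) : ℝ) : ℂ)⁻¹ with hc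
  have he (j : J) (s : Fin 4) : (fun p : Q × Reg b => encoded b J ψ (p, (j, s))) =
      c • fun p : Q × Reg b => if p.2 = 0 then ψ p.1 else 0 := by
    ext p
    simp only [encoded, encodingVector, Pi.smul_apply, smul_eq_mul]
    split_ifs <;> simp [hc, mul_comm]
  have hcc : c * c = 4⁻¹ * (Fintype.card J : ℂ)⁻¹ := by
    have h0 : (0 : ℝ) < Fintype.card J := by exact_mod_cast Fintype.card_pos
    have h : (2 * √(Fintype.card J : ℝ)) * (2 * √(Fintype.card J : ℝ)) = 4 * Fintype.card J := by
      nlinarith [Real.mul_self_sqrt h0.le]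
    have h' : ((2 * √(Fintype.card J : ℝ) : ℝ) : ℂ) * ((2 * √(Fintype.card J : ℝ) : ℝ) : ℂ) =
        4 * Fintype.card J := by exact_mod_cast congrArg (fun x : ℝ => (x : ℂ)) h
    rw [hc, ← mul_inv, h', mul_inv]
  rw [encodingVector_dotProduct, Fintype.sum_prod_type]
  have hj (j : J) : ∑ s : Fin 4, (selfInverseEncoding H V t *ᵥ encoded b J ψ) ((σ, 0), (j, s)) =
      2 * c * ((evolution H (t j) * A * evolution H (-t j)) *ᵥ ψ) σ := by
    obtain ⟨h0, h1, h2, h3⟩ := selfInverseEncoding_mulVec H V t (encoded b J ψ) (σ, 0) j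
    rw [Fin.sum_univ_four, h0, h1, h2, h3, he, he, Matrix.mulVec_smul, Matrix.mulVec_smul,
      Pi.smul_apply, Pi.smul_apply, heisenberg_mulVec_zero hV, heisenberg_mulVec_zero hV']
    simp only [encoded, encodingVector, smul_eq_mul]
    ring
  rw [Finset.sum_congr rfl fun j _ => hj j, ← Finset.mul_sum, timeAverage, Matrix.smul_mulVec,
    Matrix.sum_mulVec, ← mul_assoc, ← hc, show c * (2 * c) = 2 * (c * c) by ring, hcc]
  simp only [Pi.smul_apply, Finset.sum_apply, smul_eq_mul]
  ring

end Walk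

section WalkOperator

variable {Q : Type} [Fintype Q] [DecidableEq Q] {b w : ℕ}
  {J K : Type} [Fintype J] [DecidableEq J] [Nonempty J] [Fintype K] [DecidableEq K]

/-- The qubitized walk operator: reflection about the encoding vector, followed by the self-inverse
block encoding. -/
noncomputable def walk {H : Matrix Q Q ℂ} (hH : H.IsHermitian)
    {V : Matrix (Q × Reg b) (Q × Reg b) ℂ} (hV : V ∈ Matrix.unitaryGroup (Q × Reg b) ℂ)
    (t : J → ℝ) : Matrix.unitaryGroup ((Q × Reg b) × (J × Fin 4)) ℂ :=
  ⟨selfInverseEncoding H V t * liftAncilla Q (reflection b J),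
    mul_mem (selfInverseEncoding_mem_unitaryGroup hH hV t)
      (liftAncilla_mem_unitaryGroup (reflection_mem_unitaryGroup b))⟩

lemma walk_inv {H : Matrix Q Q ℂ} (hH : H.IsHermitian)
    {V : Matrix (Q × Reg b) (Q × Reg b) ℂ} (hV : V ∈ Matrix.unitaryGroup (Q × Reg b) ℂ)
    (t : J → ℝ) :
    ((walk hH hV t)⁻¹).1 = liftAncilla Q (reflection b J) * selfInverseEncoding H V t := by
  have h : (⟨liftAncilla Q (reflection b J) * selfInverseEncoding H V t,
      mul_mem (liftAncilla_mem_unitaryGroup (reflection_mem_unitaryGroup b))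
        (selfInverseEncoding_mem_unitaryGroup hH hV t)⟩ :
        Matrix.unitaryGroup ((Q × Reg b) × (J × Fin 4)) ℂ) * walk hH hV t = 1 := by
    refine Subtype.ext ?_
    change liftAncilla Q (reflection b J) * selfInverseEncoding H V t *
      (selfInverseEncoding H V t * liftAncilla Q (reflection b J)) = 1
    rw [mul_assoc, ← mul_assoc (selfInverseEncoding H V t), selfInverseEncoding_mul_self hH hV,
      one_mul, ← liftAncilla_mul, reflection_mul_self, liftAncilla_one]
  rw [← eq_inv_of_mul_eq_one_left h]

/-- The component of the encoded state `ψ` along the walk eigenvector with eigenphase `z`, provided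
that `ψ` is an eigenvector of the time-averaged observable, with eigenvalue `2 Re z`. -/
noncomputable def walkVector (H : Matrix Q Q ℂ) (V : Matrix (Q × Reg b) (Q × Reg b) ℂ)
    (t : J → ℝ) (ψ : Q → ℂ) (z : ℂ) : (Q × Reg b) × (J × Fin 4) → ℂ :=
  (z - star z)⁻¹ • (selfInverseEncoding H V t *ᵥ encoded b J ψ - star z • encoded b J ψ)

lemma three_le_normSq_sub_star {z : ℂ} (hz : ‖z‖ = 1) (hre : |z.re| ≤ 1 / 2) :
    3 ≤ ‖z - star z‖ ^ 2 := by
  have h1 : z.re ^ 2 + z.im ^ 2 = 1 := by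
    have := Complex.sq_norm z
    rw [hz, Complex.normSq_apply] at this
    nlinarith
  have h2 : z.re ^ 2 ≤ 1 / 4 := by
    have := sq_le_sq' (by linarith [abs_le.mp hre]) (abs_le.mp hre).2
    nlinarith
  rw [Complex.sq_norm, Complex.normSq_apply]
  simp
  nlinarith

lemma norm_inv_sub_star_le {z : ℂ} (hz : ‖z‖ = 1) (hre : |z.re| ≤ 1 / 2) :
    ‖(z - star z)⁻¹‖ ≤ 3 / 5 := by
  have h := three_le_normSq_sub_star hz hre
  have h' : 5 / 3 ≤ ‖z - star z‖ := by
    by_contra hlt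
    push Not at hlt
    nlinarith [norm_nonneg (z - star z)]
  rw [norm_inv, inv_le_comm₀ (by linarith) (by norm_num)]
  linarith

lemma walkVector_add {H : Matrix Q Q ℂ} {V : Matrix (Q × Reg b) (Q × Reg b) ℂ}
    {t : J → ℝ} {ψ : Q → ℂ} {z : ℂ} (hz : ‖z‖ = 1) (hre : |z.re| ≤ 1 / 2) :
    walkVector H V t ψ z + walkVector H V t ψ (star z) = encoded b J ψ := by
  have h0 : z - star z ≠ 0 := by
    intro h
    have := three_le_normSq_sub_star hz hre
    rw [h] at this
    norm_num at this
  have h1 : star z - z = -(z - star z) := by ring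
  rw [walkVector, walkVector, star_star, h1, inv_neg, neg_smul, ← sub_eq_add_neg, ← smul_sub]
  rw [show ∀ a e : (Q × Reg b) × (J × Fin 4) → ℂ, a - star z • e - (a - z • e) =
    (z - star z) • e by intro a e; rw [sub_smul]; abel, smul_smul, inv_mul_cancel₀ h0, one_smul]

lemma vnorm_walkVector_le {H : Matrix Q Q ℂ} (hH : H.IsHermitian)
    {V : Matrix (Q × Reg b) (Q × Reg b) ℂ} (hV : V ∈ Matrix.unitaryGroup (Q × Reg b) ℂ)
    (t : J → ℝ) {ψ : Q → ℂ} (hψ : vnorm ψ = 1) {z : ℂ} (hz : ‖z‖ = 1) (hre : |z.re| ≤ 1 / 2) :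
    vnorm (walkVector H V t ψ z) ≤ 6 / 5 := by
  rw [walkVector, vnorm_smul]
  have h1 := norm_inv_sub_star_le hz hre
  have h2 : vnorm (selfInverseEncoding H V t *ᵥ encoded b J ψ - star z • encoded b J ψ) ≤ 2 := by
    refine (vnorm_sub_le _ _).trans ?_
    rw [vnorm_mulVec_of_unitary (selfInverseEncoding_mem_unitaryGroup hH hV t), vnorm_smul,
      vnorm_encoded, hψ, norm_star, hz]
    norm_num
  have := mul_le_mul h1 h2 (vnorm_nonneg _) (by norm_num)
  linarith

/-- If `ψ` is an approximate eigenvector of the time-averaged observable, then `walkVector` is an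
approximate eigenvector of the walk. -/
lemma vnorm_walk_mulVec_sub_le {H : Matrix Q Q ℂ} (hH : H.IsHermitian)
    {V : Matrix (Q × Reg b) (Q × Reg b) ℂ} (hV : V ∈ Matrix.unitaryGroup (Q × Reg b) ℂ)
    {A : Matrix Q Q ℂ} (hA : A.IsHermitian) (hVA : ∀ σ τ, V (σ, 0) (τ, 0) = A σ τ)
    (t : J → ℝ) {ψ : Q → ℂ} {z : ℂ} (hz : ‖z‖ = 1) (hre : |z.re| ≤ 1 / 2) {η : ℝ}
    (hη : vnorm (timeAverage H A t *ᵥ ψ - ((2 * z.re : ℝ) : ℂ) • ψ) ≤ η) :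
    vnorm ((walk hH hV t).1 *ᵥ walkVector H V t ψ z - z • walkVector H V t ψ z) ≤ 3 / 5 * η := by
  set W := selfInverseEncoding H V t
  set u₀ := encoded b J ψ
  set e : Q → ℂ := timeAverage H A t *ᵥ ψ - ((2 * z.re : ℝ) : ℂ) • ψ
  have hWW : W *ᵥ (W *ᵥ u₀) = u₀ := by
    rw [Matrix.mulVec_mulVec, selfInverseEncoding_mul_self hH hV, Matrix.one_mulVec]
  have hRu₀ : liftAncilla Q (reflection b J) *ᵥ u₀ = u₀ :=
    liftAncilla_reflection_mulVec_encoded ψ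
  have hRu₁ : liftAncilla Q (reflection b J) *ᵥ (W *ᵥ u₀) =
      encoded b J e + ((2 * z.re : ℝ) : ℂ) • u₀ - W *ᵥ u₀ := by
    rw [liftAncilla_reflection_mulVec]
    have h1 : (fun σ => encodingVector b J ⬝ᵥ fun a => (W *ᵥ u₀) ((σ, a.1), a.2)) =
        (2 : ℂ)⁻¹ • (timeAverage H A t *ᵥ ψ) :=
      funext fun σ => encodingVector_dotProduct_selfInverseEncoding hA hVA t ψ σ
    rw [h1, encoded_smul, smul_smul, mul_inv_cancel₀ two_ne_zero, one_smul, encoded_sub,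
      encoded_smul, sub_add_cancel]
  have hzz : z * star z = 1 := by
    rw [Complex.star_def, Complex.mul_conj, Complex.normSq_eq_norm_sq, hz]; simp
  have hz2 : ((2 * z.re : ℝ) : ℂ) = z + star z := by
    rw [Complex.star_def, Complex.add_conj]
  have hmain : (walk hH hV t).1 *ᵥ walkVector H V t ψ z - z • walkVector H V t ψ z =
      (z - star z)⁻¹ • (W *ᵥ encoded b J e) := by
    change (W * liftAncilla Q (reflection b J)) *ᵥ ((z - star z)⁻¹ • (W *ᵥ u₀ - star z • u₀)) -
      z • ((z - star z)⁻¹ • (W *ᵥ u₀ - star z • u₀)) = _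
    rw [Matrix.mulVec_smul, smul_comm z, ← smul_sub]
    congr 1
    rw [← Matrix.mulVec_mulVec, Matrix.mulVec_sub, Matrix.mulVec_smul, hRu₀, hRu₁,
      Matrix.mulVec_sub, Matrix.mulVec_sub, Matrix.mulVec_add, Matrix.mulVec_smul,
      Matrix.mulVec_smul, hWW, hz2]
    ext i
    simp only [Pi.sub_apply, Pi.add_apply, Pi.smul_apply, smul_eq_mul]
    linear_combination u₀ i * hzz
  rw [hmain, vnorm_smul, vnorm_mulVec_of_unitary (selfInverseEncoding_mem_unitaryGroup hH hV t),
    vnorm_encoded]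
  exact mul_le_mul (norm_inv_sub_star_le hz hre) hη (vnorm_nonneg _) (by norm_num)

lemma vnorm_pow_mulVec_sub_le {I : Type*} [Fintype I] [DecidableEq I]
    (g : Matrix.unitaryGroup I ℂ) {z : ℂ} (hz : ‖z‖ = 1) {w : I → ℂ} {η : ℝ}
    (h : vnorm (g.1 *ᵥ w - z • w) ≤ η) (n : ℕ) :
    vnorm ((g ^ n).1 *ᵥ w - z ^ n • w) ≤ n * η := by
  induction n with
  | zero => simp [vnorm_zero]
  | succ n ih =>
    have h1 : (g ^ (n + 1)).1 *ᵥ w - z ^ (n + 1) • w =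
        (g ^ n).1 *ᵥ (g.1 *ᵥ w - z • w) + z • ((g ^ n).1 *ᵥ w - z ^ n • w) := by
      rw [pow_succ g, Matrix.mulVec_sub, Matrix.mulVec_smul, smul_sub, smul_smul,
        Matrix.mulVec_mulVec, pow_succ' z]
      simp
    rw [h1]
    refine (vnorm_add_le _ _).trans ?_
    rw [vnorm_mulVec_of_unitary (g ^ n).2, vnorm_smul, hz, one_mul, Nat.cast_succ, add_one_mul,
      add_comm]
    exact add_le_add ih h

lemma vnorm_zpow_mulVec_sub_le {I : Type*} [Fintype I] [DecidableEq I]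
    (g : Matrix.unitaryGroup I ℂ) {z : ℂ} (hz : ‖z‖ = 1) {w : I → ℂ} {η : ℝ}
    (h : vnorm (g.1 *ᵥ w - z • w) ≤ η) (n : ℤ) :
    vnorm ((g ^ n).1 *ᵥ w - z ^ n • w) ≤ n.natAbs * η := by
  have hz0 : z ≠ 0 := by rintro rfl; simp at hz
  obtain ⟨m, rfl | rfl⟩ := n.eq_nat_or_neg
  · simpa using vnorm_pow_mulVec_sub_le g hz h m
  · have h' : vnorm ((g⁻¹).1 *ᵥ w - z⁻¹ • w) ≤ η := by
      have h1 : (g⁻¹).1 *ᵥ w - z⁻¹ • w = -z⁻¹ • ((g⁻¹).1 *ᵥ (g.1 *ᵥ w - z • w)) := by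
        rw [Matrix.mulVec_sub, Matrix.mulVec_mulVec, ← Submonoid.coe_mul, inv_mul_cancel,
          Matrix.mulVec_smul, smul_sub, smul_smul]
        simp [hz0]
        abel
      rw [h1, vnorm_smul, vnorm_mulVec_of_unitary (g⁻¹).2]
      simpa [hz] using h
    have := vnorm_pow_mulVec_sub_le g⁻¹ (z := z⁻¹) (by simp [hz]) h' m
    simpa using this

/-! ### Controlled powers of the walk -/

/-- The gates that apply the `c k`-th power of the walk, where `c k ∈ {-1, 0, 1}`, controlled by the
register state `k`. -/
noncomputable def stepGates (e : (J × Fin 4) × K ≃ Fin w) (t : J → ℝ) (c : K → ℤ) :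
    List (Gate b w) :=
  [controlledGate e fun k => if c k = 1 then reflectionUnitary b J else 1,
    callGate e false (fun k x => c k ≠ 0 ∧ x.2 = 0) (fun x => t x.1),
    callGate e true (fun k x => c k ≠ 0 ∧ x.2 = 1) (fun x => t x.1),
    controlledGate e fun k => (if c k = -1 then reflectionUnitary b J else 1) *
      if c k = 0 then 1 else branchUnitary b J]

lemma slice_stepGates {H : Matrix Q Q ℂ} (hH : H.IsHermitian)
    {V : Matrix (Q × Reg b) (Q × Reg b) ℂ} (hV : V ∈ Matrix.unitaryGroup (Q × Reg b) ℂ)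
    (e : (J × Fin 4) × K ≃ Fin w) (t : J → ℝ) (c : K → ℤ)
    (hc : ∀ k, c k = 1 ∨ c k = -1 ∨ c k = 0) (v : (Q × Reg b) × Fin w → ℂ) (k : K) :
    slice e (runGates H V (stepGates e t c) v) k =
      (walk hH hV t ^ c k).1 *ᵥ slice e v k := by
  have h0 (inv : Bool) : callMatrix H V inv (fun _ : J × Fin 4 => false) (fun x => t x.1) = 1 := by
    simp [callMatrix]
    exact Matrix.blockDiagonal_one
  simp only [stepGates, runGates, List.foldl_cons, List.foldl_nil]
  rw [slice_controlledGate, slice_callGate, slice_callGate, slice_controlledGate]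
  rcases hc k with h | h | h
  · simp [h, walk, selfInverseEncoding, reflectionUnitary, Matrix.mulVec_mulVec, mul_assoc]
  · rw [h, zpow_neg_one, walk_inv]
    simp [selfInverseEncoding, reflectionUnitary, Matrix.mulVec_mulVec, mul_assoc,
      liftAncilla_mul, liftAncilla_one]
  · simp [h, h0, liftAncilla_one]

/-- The gates that apply the `f k`-th power of the walk, controlled by the register state `k`, where
`|f k| ≤ N`. -/
noncomputable def phaseGates (b : ℕ) (e : (J × Fin 4) × K ≃ Fin w) (t : J → ℝ) (f : K → ℤ)
    (N : ℕ) : List (Gate b w) :=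
  (List.range N).flatMap fun l => stepGates e t fun k => if l < (f k).natAbs then (f k).sign else 0

lemma slice_phaseGates_aux {H : Matrix Q Q ℂ} (hH : H.IsHermitian)
    {V : Matrix (Q × Reg b) (Q × Reg b) ℂ} (hV : V ∈ Matrix.unitaryGroup (Q × Reg b) ℂ)
    (e : (J × Fin 4) × K ≃ Fin w) (t : J → ℝ) (f : K → ℤ) (N : ℕ)
    (v : (Q × Reg b) × Fin w → ℂ) (k : K) :
    slice e (runGates H V (phaseGates b e t f N) v) k =
      (walk hH hV t ^ ((f k).sign * min N (f k).natAbs)).1 *ᵥ slice e v k := by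
  induction N with
  | zero => simp [phaseGates, runGates]
  | succ N ih =>
    have h : phaseGates b e t f (N + 1) = phaseGates b e t f N ++
        stepGates e t fun k => if N < (f k).natAbs then (f k).sign else 0 := by
      simp [phaseGates, List.range_succ]
    rw [h, runGates_append, slice_stepGates hH hV, ih, Matrix.mulVec_mulVec, ← Submonoid.coe_mul,
      ← zpow_add]
    · congr 4
      split_ifs with hN
      · rw [min_eq_left (by exact_mod_cast hN.le), min_eq_left (by exact_mod_cast hN)]
        push_cast
        ring
      · push Not at hN
        rw [min_eq_right (by exact_mod_cast hN), min_eq_right (by omega), zero_add]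
    · intro k
      split_ifs
      · rcases lt_trichotomy (f k) 0 with h | h | h
        · simp [Int.sign_eq_neg_one_of_neg h]
        · simp [h]
        · simp [Int.sign_eq_one_of_pos h]
      · simp

lemma slice_phaseGates {H : Matrix Q Q ℂ} (hH : H.IsHermitian)
    {V : Matrix (Q × Reg b) (Q × Reg b) ℂ} (hV : V ∈ Matrix.unitaryGroup (Q × Reg b) ℂ)
    (e : (J × Fin 4) × K ≃ Fin w) (t : J → ℝ) {f : K → ℤ} {N : ℕ} (hf : ∀ k, (f k).natAbs ≤ N)
    (v : (Q × Reg b) × Fin w → ℂ) (k : K) :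
    slice e (runGates H V (phaseGates b e t f N) v) k =
      (walk hH hV t ^ f k).1 *ᵥ slice e v k := by
  rw [slice_phaseGates_aux hH hV, min_eq_right (by exact_mod_cast hf k), Int.sign_mul_natAbs]

lemma calls_phaseGates (e : (J × Fin 4) × K ≃ Fin w) (t : J → ℝ) (f : K → ℤ) (N : ℕ) :
    ((phaseGates b e t f N).map Gate.calls).sum = N * 2 := by
  induction N with
  | zero => simp [phaseGates]
  | succ N ih =>
    have h : phaseGates b e t f (N + 1) = phaseGates b e t f N ++
        stepGates e t fun k => if N < (f k).natAbs then (f k).sign else 0 := by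
      simp [phaseGates, List.range_succ]
    rw [h, List.map_append, List.sum_append, ih]
    simp [stepGates, controlledGate, callGate, Gate.calls]
    ring

lemma time_phaseGates_le (e : (J × Fin 4) × K ≃ Fin w) {t : J → ℝ} {T : ℝ} (hT : 0 ≤ T)
    (ht : ∀ j, |t j| ≤ T) (f : K → ℤ) (N : ℕ) :
    ((phaseGates b e t f N).map Gate.time).sum ≤ N * 2 * T := by
  induction N with
  | zero => simp [phaseGates]
  | succ N ih =>
    have h : phaseGates b e t f (N + 1) = phaseGates b e t f N ++
        stepGates e t fun k => if N < (f k).natAbs then (f k).sign else 0 := by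
      simp [phaseGates, List.range_succ]
    have h1 : ‖fun j : Fin w => t (e.symm j).1.1‖ ≤ T :=
      (pi_norm_le_iff_of_nonneg hT).mpr fun j => ht _
    rw [h, List.map_append, List.sum_append]
    simp only [stepGates, controlledGate, callGate, Gate.time, List.map_cons, List.map_nil,
      List.sum_cons, List.sum_nil]
    push_cast
    linarith

end WalkOperator

/-! ### Phase kickback -/

section Kickback

variable {I K : Type} [Fintype I] [DecidableEq I] [Fintype K] [DecidableEq K]

/-- The product vector `w ⊗ κ`. -/
def tensorVec (w : I → ℂ) (κ : K → ℂ) : I × K → ℂ := fun p => w p.1 * κ p.2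

lemma vnorm_tensorVec (w : I → ℂ) (κ : K → ℂ) : vnorm (tensorVec w κ) = vnorm w * vnorm κ :=
  vnorm_prod_mul w κ

lemma tensorVec_add (w w' : I → ℂ) (κ : K → ℂ) :
    tensorVec (w + w') κ = tensorVec w κ + tensorVec w' κ := by
  ext p; simp [tensorVec, add_mul]

lemma tensorVec_sub (w : I → ℂ) (κ κ' : K → ℂ) :
    tensorVec w (κ - κ') = tensorVec w κ - tensorVec w κ' := by
  ext p; simp [tensorVec, mul_sub]

/-- On vectors `w ⊗ κ` the operator `U` acts like `1 ⊗ u`, up to a relative error `c`. -/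
def ActsOnRegister (U : Matrix (I × K) (I × K) ℂ) (u : Matrix K K ℂ) (w : I → ℂ) (c : ℝ) : Prop :=
  ∀ κ, vnorm (U *ᵥ tensorVec w κ - tensorVec w (u *ᵥ κ)) ≤ c * vnorm κ

lemma ActsOnRegister.mul {U U' : Matrix (I × K) (I × K) ℂ} {u u' : Matrix K K ℂ} {w : I → ℂ}
    {c c' : ℝ} (h' : ActsOnRegister U' u' w c') (h : ActsOnRegister U u w c)
    (hU' : U' ∈ Matrix.unitaryGroup (I × K) ℂ) (hu : u ∈ Matrix.unitaryGroup K ℂ) :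
    ActsOnRegister (U' * U) (u' * u) w (c' + c) := by
  intro κ
  refine (vnorm_sub_le_add _ (U' *ᵥ tensorVec w (u *ᵥ κ)) _).trans ?_
  rw [← Matrix.mulVec_mulVec, ← Matrix.mulVec_sub, vnorm_mulVec_of_unitary hU',
    ← Matrix.mulVec_mulVec]
  have := h' (u *ᵥ κ)
  rw [vnorm_mulVec_of_unitary hu] at this
  linarith [h κ]

lemma actsOnRegister_one_kronecker (u : Matrix K K ℂ) (w : I → ℂ) :
    ActsOnRegister ((1 : Matrix I I ℂ) ⊗ₖ u) u w 0 := by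
  intro κ
  have : ((1 : Matrix I I ℂ) ⊗ₖ u) *ᵥ tensorVec w κ = tensorVec w (u *ᵥ κ) := by
    ext ⟨i, k⟩
    rw [one_kronecker_mulVec]
    change (u *ᵥ (w i • κ)) k = _
    rw [Matrix.mulVec_smul]
    rfl
  rw [this, sub_self, vnorm_zero, zero_mul]

/-- Powers of `g`, controlled by the register. -/
def controlledPower (g : Matrix.unitaryGroup I ℂ) (f : K → ℤ) : Matrix (I × K) (I × K) ℂ :=
  Matrix.blockDiagonal fun k => (g ^ f k).1

lemma controlledPower_mem_unitaryGroup (g : Matrix.unitaryGroup I ℂ) (f : K → ℤ) :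
    controlledPower g f ∈ Matrix.unitaryGroup (I × K) ℂ :=
  blockDiagonal_mem_unitaryGroup fun k => (g ^ f k).2

/-- The phases `z ^ f k` on the register. -/
noncomputable def phaseDiagonal (z : ℂ) (f : K → ℤ) : Matrix K K ℂ :=
  Matrix.diagonal fun k => z ^ f k

lemma phaseDiagonal_mem_unitaryGroup {z : ℂ} (hz : ‖z‖ = 1) (f : K → ℤ) :
    phaseDiagonal z f ∈ Matrix.unitaryGroup K ℂ := by
  rw [Matrix.mem_unitaryGroup_iff, phaseDiagonal, Matrix.star_eq_conjTranspose,
    Matrix.diagonal_conjTranspose, Matrix.diagonal_mul_diagonal, ← Matrix.diagonal_one]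
  congr 1
  funext k
  rw [Pi.star_apply, Complex.star_def, Complex.mul_conj, Complex.normSq_eq_norm_sq]
  simp [hz]

lemma actsOnRegister_controlledPower (g : Matrix.unitaryGroup I ℂ) {z : ℂ} (hz : ‖z‖ = 1)
    {w : I → ℂ} {η : ℝ} (h : vnorm (g.1 *ᵥ w - z • w) ≤ η) {f : K → ℤ} {N : ℕ}
    (hf : ∀ k, (f k).natAbs ≤ N) :
    ActsOnRegister (controlledPower g f) (phaseDiagonal z f) w (N * η) := by
  intro κ
  have hη : 0 ≤ η := (vnorm_nonneg _).trans h
  refine vnorm_le_of_sq_le (by have := vnorm_nonneg κ; positivity) ?_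
  rw [Fintype.sum_prod_type_right, mul_pow, vnorm_sq κ, Finset.mul_sum]
  refine Finset.sum_le_sum fun k _ => ?_
  have h1 (i : I) : (controlledPower g f *ᵥ tensorVec w κ - tensorVec w (phaseDiagonal z f *ᵥ κ))
      (i, k) = (κ k • ((g ^ f k).1 *ᵥ w - z ^ f k • w)) i := by
    rw [Pi.sub_apply, controlledPower, blockDiagonal_mulVec]
    have : (fun i' => tensorVec w κ (i', k)) = κ k • w := by
      ext i'; simp [tensorVec, mul_comm]
    rw [this, Matrix.mulVec_smul, phaseDiagonal]
    simp only [tensorVec, Matrix.mulVec_diagonal, Pi.smul_apply, Pi.sub_apply, smul_eq_mul]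
    ring
  simp only [h1]
  rw [← vnorm_sq, vnorm_smul, mul_pow, mul_comm]
  have h2 := vnorm_zpow_mulVec_sub_le g hz h (f k)
  have h3 : ((f k).natAbs : ℝ) * η ≤ N * η := by gcongr; exact hf k
  have h4 := h2.trans h3
  gcongr
  exact vnorm_nonneg _

/-- The estimation circuit: coarse phase estimation of the sign of the eigenphase (unitary `Us`,
powers `f₁`), powers `f₂` whose direction depends on that sign, the inverse of the coarse phase
estimation, and the final change of basis `Um`. -/
def estimationCircuit (g : Matrix.unitaryGroup I ℂ) (Us Um : Matrix.unitaryGroup K ℂ)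
    (f₁ f₂ : K → ℤ) : Matrix (I × K) (I × K) ℂ :=
  ((1 : Matrix I I ℂ) ⊗ₖ Um.1) * (controlledPower g (-f₁) *
    (((1 : Matrix I I ℂ) ⊗ₖ Us⁻¹.1) * (controlledPower g f₂ *
      (((1 : Matrix I I ℂ) ⊗ₖ Us.1) * controlledPower g f₁))))

/-- The action of `estimationCircuit` on the registers alone, for an eigenvector with
eigenphase `z`. -/
noncomputable def registerCircuit (z : ℂ) (Us Um : Matrix.unitaryGroup K ℂ) (f₁ f₂ : K → ℤ) :
    Matrix K K ℂ :=
  Um.1 * (phaseDiagonal z (-f₁) * (Us⁻¹.1 * (phaseDiagonal z f₂ * (Us.1 * phaseDiagonal z f₁))))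

lemma actsOnRegister_estimationCircuit (g : Matrix.unitaryGroup I ℂ)
    (Us Um : Matrix.unitaryGroup K ℂ) {z : ℂ} (hz : ‖z‖ = 1)
    {w : I → ℂ} {η : ℝ} (h : vnorm (g.1 *ᵥ w - z • w) ≤ η) {f₁ f₂ : K → ℤ} {N₁ N₂ : ℕ}
    (hf₁ : ∀ k, (f₁ k).natAbs ≤ N₁) (hf₂ : ∀ k, (f₂ k).natAbs ≤ N₂) :
    ActsOnRegister (estimationCircuit g Us Um f₁ f₂) (registerCircuit z Us Um f₁ f₂) w
      ((2 * N₁ + N₂ : ℕ) * η) := by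
  have hU (u : Matrix.unitaryGroup K ℂ) :
      (1 : Matrix I I ℂ) ⊗ₖ u.1 ∈ Matrix.unitaryGroup (I × K) ℂ :=
    one_kronecker_mem_unitaryGroup I u.2
  have h1 := actsOnRegister_controlledPower g hz h hf₁
  have h2 := actsOnRegister_controlledPower g hz h hf₂
  have h3 := actsOnRegister_controlledPower (f := -f₁) g hz h (N := N₁) (by simpa using hf₁)
  have m1 := phaseDiagonal_mem_unitaryGroup hz f₁
  have m2 := phaseDiagonal_mem_unitaryGroup hz f₂
  have m3 := phaseDiagonal_mem_unitaryGroup hz (-f₁)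
  have c1 := (actsOnRegister_one_kronecker Us.1 w).mul h1 (hU Us) m1
  have c2 := h2.mul c1 (controlledPower_mem_unitaryGroup g f₂) (mul_mem Us.2 m1)
  have c3 := (actsOnRegister_one_kronecker Us⁻¹.1 w).mul c2 (hU _) (mul_mem m2 (mul_mem Us.2 m1))
  have c4 := h3.mul c3 (controlledPower_mem_unitaryGroup g _)
    (mul_mem Us⁻¹.2 (mul_mem m2 (mul_mem Us.2 m1)))
  have c5 := (actsOnRegister_one_kronecker Um.1 w).mul c4 (hU _)
    (mul_mem m3 (mul_mem Us⁻¹.2 (mul_mem m2 (mul_mem Us.2 m1))))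
  intro κ
  refine (c5 κ).trans (le_of_eq ?_)
  push_cast
  ring

lemma estimationCircuit_mem_unitaryGroup (g : Matrix.unitaryGroup I ℂ)
    (Us Um : Matrix.unitaryGroup K ℂ) (f₁ f₂ : K → ℤ) :
    estimationCircuit g Us Um f₁ f₂ ∈ Matrix.unitaryGroup (I × K) ℂ := by
  have hU (u : Matrix.unitaryGroup K ℂ) :
      (1 : Matrix I I ℂ) ⊗ₖ u.1 ∈ Matrix.unitaryGroup (I × K) ℂ :=
    one_kronecker_mem_unitaryGroup I u.2
  have hC := controlledPower_mem_unitaryGroup (K := K) g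
  exact mul_mem (hU _) (mul_mem (hC _) (mul_mem (hU _) (mul_mem (hC _) (mul_mem (hU _) (hC _)))))

/-- Let the powers `f₂` agree with `f` except on register states that are unlikely after coarse
phase estimation. Then the circuit has the same effect as the powers `f` alone. -/
lemma vnorm_registerCircuit_sub_le {z : ℂ} (hz : ‖z‖ = 1) (Us Um : Matrix.unitaryGroup K ℂ)
    (f₁ f₂ : K → ℤ) (d : K → ℂ) (hd : ∀ k, ‖d k‖ = 1) (bad : Finset K)
    (hbad : ∀ k ∉ bad, z ^ f₂ k = d k) (κ : K → ℂ) {p : ℝ} (hp : 0 ≤ p)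
    (hprob : ∑ k ∈ bad, ‖((Us.1 * phaseDiagonal z f₁) *ᵥ κ) k‖ ^ 2 ≤ p ^ 2) :
    vnorm (registerCircuit z Us Um f₁ f₂ *ᵥ κ -
      (Um.1 * (phaseDiagonal z (-f₁) * (Us⁻¹.1 * (Matrix.diagonal d *
        (Us.1 * phaseDiagonal z f₁))))) *ᵥ κ) ≤ 2 * p := by
  have h1 : registerCircuit z Us Um f₁ f₂ *ᵥ κ -
      (Um.1 * (phaseDiagonal z (-f₁) * (Us⁻¹.1 * (Matrix.diagonal d *
        (Us.1 * phaseDiagonal z f₁))))) *ᵥ κ =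
      (Um.1 * (phaseDiagonal z (-f₁) * Us⁻¹.1)) *ᵥ ((phaseDiagonal z f₂ - Matrix.diagonal d) *ᵥ
        ((Us.1 * phaseDiagonal z f₁) *ᵥ κ)) := by
    rw [registerCircuit, ← Matrix.sub_mulVec, Matrix.mulVec_mulVec, Matrix.mulVec_mulVec]
    congr 1
    simp only [mul_sub, sub_mul, mul_assoc]
  rw [h1, vnorm_mulVec_of_unitary
    (mul_mem Um.2 (mul_mem (phaseDiagonal_mem_unitaryGroup hz _) Us⁻¹.2))]
  refine vnorm_le_of_sq_le (by positivity) ?_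
  set x := (Us.1 * phaseDiagonal z f₁) *ᵥ κ
  have h2 (k : K) : ((phaseDiagonal z f₂ - Matrix.diagonal d) *ᵥ x) k = (z ^ f₂ k - d k) * x k := by
    rw [phaseDiagonal, Matrix.sub_mulVec, Pi.sub_apply, Matrix.mulVec_diagonal,
      Matrix.mulVec_diagonal, sub_mul]
  have h3 : ∑ k ∈ bad, ‖((phaseDiagonal z f₂ - Matrix.diagonal d) *ᵥ x) k‖ ^ 2 =
      ∑ k, ‖((phaseDiagonal z f₂ - Matrix.diagonal d) *ᵥ x) k‖ ^ 2 := by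
    refine Finset.sum_subset (Finset.subset_univ _) fun k _ hk => ?_
    rw [h2, hbad k hk]
    simp
  rw [← h3]
  calc ∑ k ∈ bad, ‖((phaseDiagonal z f₂ - Matrix.diagonal d) *ᵥ x) k‖ ^ 2
      ≤ ∑ k ∈ bad, 4 * ‖x k‖ ^ 2 := by
        refine Finset.sum_le_sum fun k _ => ?_
        rw [h2, norm_mul, mul_pow]
        have : ‖z ^ f₂ k - d k‖ ≤ 2 := by
          refine (norm_sub_le _ _).trans ?_
          rw [norm_zpow, hz, one_zpow, hd]
          norm_num
        gcongr
        nlinarith [norm_nonneg (z ^ f₂ k - d k)]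
    _ ≤ _ := by
        rw [← Finset.mul_sum]
        nlinarith

end Kickback

/-! ### The estimation protocol -/

section EstimationProtocol

variable {b : ℕ} {J K : Type} [Fintype J] [DecidableEq J] [Nonempty J] [Fintype K] [DecidableEq K]
  [Nonempty K]

lemma exists_unitary_mulVec_single {ι : Type*} [Fintype ι] [DecidableEq ι] (i₀ : ι) {v : ι → ℂ}
    (hv : vnorm v = 1) :
    ∃ U : Matrix.unitaryGroup ι ℂ, ∀ i, U.1 i i₀ = v i := by
  obtain ⟨B, hB⟩ := Orthonormal.exists_orthonormalBasis_extension_of_card_eq (𝕜 := ℂ)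
    (E := EuclideanSpace ℂ ι) (by simp) (v := fun _ : ι => WithLp.toLp 2 v) (s := {i₀}) (by
      rw [orthonormal_iff_ite]
      intro i j
      have : i = j := Subsingleton.elim _ _
      simp only [this, if_true, Set.domRestrict_apply]
      rw [inner_self_eq_norm_sq_to_K]
      change ((vnorm v : ℝ) : ℂ) ^ 2 = 1
      simp [hv])
  refine ⟨⟨_, (EuclideanSpace.basisFun ι ℂ).toMatrix_orthonormalBasis_mem_unitary B⟩, fun i => ?_⟩
  change (EuclideanSpace.basisFun ι ℂ).toBasis.toMatrix B i i₀ = v i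
  rw [Module.Basis.toMatrix_apply, hB i₀ rfl]
  simp

/-- An enumeration of the workspace basis. -/
noncomputable def workspaceEquiv (J K : Type) [Fintype J] [Fintype K] :
    (J × Fin 4) × K ≃ Fin (Fintype.card ((J × Fin 4) × K)) := Fintype.equivFin _

/-- The initial state of the ancillas: encoding vector times register state. -/
noncomputable def ancillaVector (b : ℕ) (J : Type) [Fintype J] {K : Type} [Fintype K] (κ : K → ℂ) :
    Reg b × Fin (Fintype.card ((J × Fin 4) × K)) → ℂ :=
  fun a => encodingVector b J (a.1, ((workspaceEquiv J K).symm a.2).1) *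
    κ ((workspaceEquiv J K).symm a.2).2

lemma vnorm_ancillaVector (κ : K → ℂ) : vnorm (ancillaVector b J κ) = vnorm κ := by
  have h := vnorm_comp_equiv (ancillaEquiv b (workspaceEquiv J K))
    (fun p => encodingVector b J p.1 * κ p.2)
  rw [vnorm_prod_mul, vnorm_encodingVector, one_mul] at h
  exact h

/-- The protocol that prepares the register state `κ`, runs the estimation circuit, and returns the
estimate `est k` if the register is found in the basis state `k`. -/
noncomputable def estimationProtocol (b : ℕ) (t : J → ℝ) (κ : K → ℂ) (hκ : vnorm κ = 1)
    (Us Um : Matrix.unitaryGroup K ℂ) (f₁ f₂ : K → ℤ) (N₁ N₂ : ℕ) (est : K → ℝ) : Protocol b where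
  w := Fintype.card ((J × Fin 4) × K)
  start := workspaceEquiv J K (Classical.arbitrary _)
  gates := [Gate.ancilla (exists_unitary_mulVec_single
      (0, workspaceEquiv J K (Classical.arbitrary _))
      ((vnorm_ancillaVector (b := b) (J := J) κ).trans hκ)).choose] ++
    phaseGates b (workspaceEquiv J K) t f₁ N₁ ++ [registerGate (workspaceEquiv J K) Us] ++
    phaseGates b (workspaceEquiv J K) t f₂ N₂ ++ [registerGate (workspaceEquiv J K) Us⁻¹] ++
    phaseGates b (workspaceEquiv J K) t (-f₁) N₁ ++ [registerGate (workspaceEquiv J K) Um]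
  estimate a := est ((workspaceEquiv J K).symm a.2).2

variable (t : J → ℝ) (κ : K → ℂ) (hκ : vnorm κ = 1) (Us Um : Matrix.unitaryGroup K ℂ)
  (f₁ f₂ : K → ℤ) (N₁ N₂ : ℕ) (est : K → ℝ)

lemma calls_estimationProtocol :
    (estimationProtocol b t κ hκ Us Um f₁ f₂ N₁ N₂ est).calls = 2 * (2 * N₁ + N₂) := by
  simp only [Protocol.calls, estimationProtocol, List.map_append, List.sum_append, calls_phaseGates]
  simp [Gate.calls, registerGate]
  ring

lemma time_estimationProtocol_le {T : ℝ} (hT : 0 ≤ T) (ht : ∀ j, |t j| ≤ T) :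
    (estimationProtocol b t κ hκ Us Um f₁ f₂ N₁ N₂ est).time ≤ 2 * (2 * N₁ + N₂) * T := by
  simp only [Protocol.time, estimationProtocol, List.map_append, List.sum_append]
  have h1 := time_phaseGates_le (b := b) (workspaceEquiv J K) hT ht f₁ N₁
  have h2 := time_phaseGates_le (b := b) (workspaceEquiv J K) hT ht f₂ N₂
  have h3 := time_phaseGates_le (b := b) (workspaceEquiv J K) hT ht (-f₁) N₁
  simp only [registerGate, Gate.time, List.map_cons, List.map_nil, List.sum_cons, List.sum_nil]
  linarith

variable {Q : Type} [Fintype Q] [DecidableEq Q] {f₁ f₂ N₁ N₂}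

lemma finalState_estimationProtocol {H : Matrix Q Q ℂ} (hH : H.IsHermitian)
    {V : Matrix (Q × Reg b) (Q × Reg b) ℂ} (hV : V ∈ Matrix.unitaryGroup (Q × Reg b) ℂ)
    (hf₁ : ∀ k, (f₁ k).natAbs ≤ N₁) (hf₂ : ∀ k, (f₂ k).natAbs ≤ N₂) (ψ : Q → ℂ)
    (p : Q × Reg b) (x : J × Fin 4) (k : K) :
    (estimationProtocol b t κ hκ Us Um f₁ f₂ N₁ N₂ est).finalState H V ψ
        (p, workspaceEquiv J K (x, k)) =
      (estimationCircuit (walk hH hV t) Us Um f₁ f₂ *ᵥ tensorVec (encoded b J ψ) κ)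
        ((p, x), k) := by
  set e := workspaceEquiv J K
  set U₀ := (exists_unitary_mulVec_single (0, e (Classical.arbitrary _))
      ((vnorm_ancillaVector (b := b) (J := J) κ).trans hκ)).choose with hU₀
  have hU₀' := (exists_unitary_mulVec_single (0, e (Classical.arbitrary _))
      ((vnorm_ancillaVector (b := b) (J := J) κ).trans hκ)).choose_spec
  set v₀ : (Q × Reg b) × Fin (Fintype.card ((J × Fin 4) × K)) → ℂ :=
    fun p => if p.1.2 = 0 ∧ p.2 = e (Classical.arbitrary _) then ψ p.1.1 else 0 with hv₀
  set v₁ := (Gate.ancilla U₀).toMatrix H V *ᵥ v₀ with hv₁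
  -- the slices of the state after each group of gates
  have hphase (f : K → ℤ) (N : ℕ) (hf : ∀ k, (f k).natAbs ≤ N)
      (v : (Q × Reg b) × Fin (Fintype.card ((J × Fin 4) × K)) → ℂ)
      (y : ((Q × Reg b) × (J × Fin 4)) × K → ℂ) (hy : ∀ k, slice e v k = fun q => y (q, k))
      (k : K) :
      slice e (runGates H V (phaseGates b e t f N) v) k =
        fun q => (controlledPower (walk hH hV t) f *ᵥ y) (q, k) := by
    rw [slice_phaseGates hH hV e t hf, hy]
    ext q
    rw [controlledPower, blockDiagonal_mulVec]
  have hreg (u : Matrix.unitaryGroup K ℂ)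
      (v : (Q × Reg b) × Fin (Fintype.card ((J × Fin 4) × K)) → ℂ)
      (y : ((Q × Reg b) × (J × Fin 4)) × K → ℂ) (hy : ∀ k, slice e v k = fun q => y (q, k))
      (k : K) :
      slice e (runGates H V [registerGate e u] v) k =
        fun q => (((1 : Matrix ((Q × Reg b) × (J × Fin 4)) ((Q × Reg b) × (J × Fin 4)) ℂ) ⊗ₖ u.1) *ᵥ
          y) (q, k) := by
    have h : runGates H V [registerGate e u] v = (registerGate e u).toMatrix H V *ᵥ v := rfl
    rw [h, slice_registerGate]
    ext q
    rw [one_kronecker_mulVec]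
    simp [Matrix.mulVec, dotProduct, hy]
  have hinit (k : K) : slice e v₁ k = fun q => tensorVec (encoded b J ψ) κ (q, k) := by
    ext ⟨⟨σ, β⟩, x⟩
    rw [slice, hv₁, ancilla_mulVec]
    have h2 : (fun a : Reg b × Fin _ => v₀ ((σ, a.1), a.2)) =
        ψ σ • Pi.single (0, e (Classical.arbitrary _)) 1 := by
      ext a
      simp [hv₀, Pi.single_apply, Prod.ext_iff]
    rw [h2, Matrix.mulVec_smul, Pi.smul_apply, Matrix.mulVec_single_one]
    change ψ σ * U₀.1 (β, e (x, k)) (0, e (Classical.arbitrary _)) = _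
    rw [hU₀']
    simp [ancillaVector, tensorVec, encoded, e, mul_assoc]
  have hrun : (estimationProtocol b t κ hκ Us Um f₁ f₂ N₁ N₂ est).finalState H V ψ =
      runGates H V [registerGate e Um] (runGates H V (phaseGates b e t (-f₁) N₁)
        (runGates H V [registerGate e Us⁻¹] (runGates H V (phaseGates b e t f₂ N₂)
          (runGates H V [registerGate e Us] (runGates H V (phaseGates b e t f₁ N₁) v₁))))) := by
    simp only [← runGates_append]
    simp only [Protocol.finalState, estimationProtocol, runGates, List.foldl_append]
    rfl
  rw [hrun]
  have h1 := hphase f₁ N₁ hf₁ v₁ _ hinit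
  have h2 := hreg Us _ _ h1
  have h3 := hphase f₂ N₂ hf₂ _ _ h2
  have h4 := hreg Us⁻¹ _ _ h3
  have h5 := hphase (-f₁) N₁ (by simpa using hf₁) _ _ h4
  have h6 := congrFun (hreg Um _ _ h5 k) (p, x)
  simp only [Matrix.mulVec_mulVec] at h6
  exact h6.trans (by simp only [estimationCircuit])

end EstimationProtocol

/-! ### Phase estimation with a parabolic window -/

section Dft

/-- The primitive root of unity `exp (2πi/N)`. -/
noncomputable def rootOfUnity (N : ℕ) : ℂ := Complex.exp (2 * Real.pi * Complex.I / N)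

lemma norm_rootOfUnity (N : ℕ) : ‖rootOfUnity N‖ = 1 := by
  rw [rootOfUnity, show 2 * (Real.pi : ℂ) * Complex.I / N =
    ((2 * Real.pi / N : ℝ) : ℂ) * Complex.I by push_cast; ring, Complex.norm_exp_ofReal_mul_I]

lemma star_rootOfUnity (N : ℕ) : star (rootOfUnity N) = (rootOfUnity N)⁻¹ := by
  rw [Complex.star_def, Complex.inv_def, Complex.normSq_eq_norm_sq, norm_rootOfUnity]
  simp

lemma rootOfUnity_ne_zero (N : ℕ) : rootOfUnity N ≠ 0 := Complex.exp_ne_zero _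

/-- The discrete Fourier transform. -/
noncomputable def dft (N : ℕ) : Matrix (Fin N) (Fin N) ℂ :=
  Matrix.of fun k m => ((√(N : ℝ) : ℝ) : ℂ)⁻¹ * ((rootOfUnity N)⁻¹ ^ (k : ℕ)) ^ (m : ℕ)

lemma dft_mem_unitaryGroup (N : ℕ) : dft N ∈ Matrix.unitaryGroup (Fin N) ℂ := by
  rcases Nat.eq_zero_or_pos N with rfl | hN
  · rw [Matrix.mem_unitaryGroup_iff]; exact Subsingleton.elim _ _
  have hprim : IsPrimitiveRoot (rootOfUnity N) N := Complex.isPrimitiveRoot_exp N hN.ne'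
  have h0 := rootOfUnity_ne_zero N
  have hsq : ((√(N : ℝ) : ℝ) : ℂ)⁻¹ * ((√(N : ℝ) : ℝ) : ℂ)⁻¹ = (N : ℂ)⁻¹ := by
    rw [← mul_inv, ← Complex.ofReal_mul, Real.mul_self_sqrt (Nat.cast_nonneg N)]
    simp
  rw [Matrix.mem_unitaryGroup_iff]
  ext k l
  have h1 : (dft N * star (dft N)) k l =
      (N : ℂ)⁻¹ * ∑ m ∈ Finset.range N,
        ((rootOfUnity N)⁻¹ ^ (k : ℕ) * rootOfUnity N ^ (l : ℕ)) ^ m := by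
    rw [Matrix.mul_apply, Finset.sum_range, Finset.mul_sum]
    refine Finset.sum_congr rfl fun m _ => ?_
    rw [Matrix.star_apply, dft, Matrix.of_apply, Matrix.of_apply, star_mul', star_inv₀, star_pow,
      star_pow, star_inv₀, star_rootOfUnity, inv_inv, mul_pow, ← hsq]
    simp
    ring
  rw [h1]
  by_cases hkl : k = l
  · subst hkl
    rw [← mul_pow, inv_mul_cancel₀ h0]
    simp [hN.ne']
  · rw [Matrix.one_apply_ne hkl]
    set x := (rootOfUnity N)⁻¹ ^ (k : ℕ) * rootOfUnity N ^ (l : ℕ) with hx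
    have hx1 : x ≠ 1 := by
      intro h
      rw [hx, inv_pow, inv_mul_eq_one₀ (pow_ne_zero _ h0)] at h
      exact hkl (Fin.ext (hprim.pow_inj k.2 l.2 h))
    have hxN : x ^ N = 1 := by
      rw [hx, mul_pow, ← pow_mul, ← pow_mul, mul_comm (k : ℕ), mul_comm (l : ℕ), pow_mul, pow_mul,
        inv_pow, hprim.pow_eq_one]
      simp
    have := geom_sum_mul x N
    rw [hxN, sub_self] at this
    rw [(mul_eq_zero.mp this).resolve_right (sub_ne_zero.mpr hx1), mul_zero]

/-- The unnormalized parabolic window; it vanishes at `0` and at `N`. -/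
def parabola (N m : ℕ) : ℝ := m * (N - m)

lemma sum_parabola_sq (N : ℕ) :
    ∑ m ∈ Finset.range N, parabola N m ^ 2 = N * ((N : ℝ) ^ 4 - 1) / 30 := by
  have h (M : ℕ) : ∑ m ∈ Finset.range M, parabola N m ^ 2 =
      (N : ℝ) ^ 2 * ((M - 1) * M * (2 * M - 1) / 6) - 2 * N * ((M * (M - 1)) ^ 2 / 4) +
        (M - 1) * M * (2 * M - 1) * (3 * M ^ 2 - 3 * M - 1) / 30 := by
    induction M with
    | zero => simp
    | succ M ih =>
      rw [Finset.sum_range_succ, ih, parabola]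
      push_cast
      ring
  rw [h]
  ring

lemma sum_parabola_sub_sq (N : ℕ) :
    ∑ m ∈ Finset.range N, (parabola N m - parabola N (m + 1)) ^ 2 = N * ((N : ℝ) ^ 2 - 1) / 3 := by
  have h (M : ℕ) : ∑ m ∈ Finset.range M, (parabola N m - parabola N (m + 1)) ^ 2 =
      M * ((N : ℝ) - 1) ^ 2 - 2 * (N - 1) * (M * (M - 1)) +
        4 * ((M - 1) * M * (2 * M - 1) / 6) := by
    induction M with
    | zero => simp
    | succ M ih =>
      rw [Finset.sum_range_succ, ih, parabola, parabola]
      push_cast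
      ring
  rw [h]
  ring

/-- The parabolic window, normalized as a vector of amplitudes on `0, …, N - 1`. -/
noncomputable def window (N m : ℕ) : ℝ := (√(N * ((N : ℝ) ^ 4 - 1) / 30))⁻¹ * parabola N m

lemma window_zero (N : ℕ) : window N 0 = 0 := by simp [window, parabola]

lemma window_self (N : ℕ) : window N N = 0 := by simp [window, parabola]

lemma window_normalization_pos {N : ℕ} (hN : 2 ≤ N) : 0 < N * ((N : ℝ) ^ 4 - 1) / 30 := by
  have h : (2 : ℝ) ≤ N := by exact_mod_cast hN
  have : (1 : ℝ) < (N : ℝ) ^ 4 := one_lt_pow₀ (by linarith) (by norm_num)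
  have : 0 < (N : ℝ) * ((N : ℝ) ^ 4 - 1) := mul_pos (by linarith) (by linarith)
  linarith

lemma sum_window_sq {N : ℕ} (hN : 2 ≤ N) : ∑ m ∈ Finset.range N, window N m ^ 2 = 1 := by
  have h := window_normalization_pos hN
  simp only [window, mul_pow, inv_pow, Real.sq_sqrt h.le]
  rw [← Finset.mul_sum, sum_parabola_sq, inv_mul_cancel₀ h.ne']

lemma sum_window_sub_sq {N : ℕ} (hN : 2 ≤ N) :
    ∑ m ∈ Finset.range N, (window N m - window N (m + 1)) ^ 2 = 10 / ((N : ℝ) ^ 2 + 1) := by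
  have h := window_normalization_pos hN
  simp only [window, ← mul_sub, mul_pow, inv_pow, Real.sq_sqrt h.le]
  rw [← Finset.mul_sum, sum_parabola_sub_sq]
  have h2 : (2 : ℝ) ≤ N := by exact_mod_cast hN
  have h3 : (N : ℝ) ^ 4 - 1 ≠ 0 := by
    have : (1 : ℝ) < (N : ℝ) ^ 4 := one_lt_pow₀ (by linarith) (by norm_num)
    linarith
  field_simp
  ring

/-- The amplitude for outcome `k` in phase estimation of the eigenphase `z`. -/
noncomputable def amplitude (N : ℕ) (z : ℂ) (k : Fin N) : ℂ :=
  (dft N *ᵥ fun m => z ^ (m : ℕ) * (window N m : ℂ)) k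

lemma sum_norm_amplitude_sq {N : ℕ} (hN : 2 ≤ N) {z : ℂ} (hz : ‖z‖ = 1) :
    ∑ k, ‖amplitude N z k‖ ^ 2 = 1 := by
  unfold amplitude
  rw [← vnorm_sq, vnorm_mulVec_of_unitary (dft_mem_unitaryGroup N), vnorm_sq, ← sum_window_sq hN,
    Finset.sum_range]
  simp [hz]

lemma sub_mul_amplitude {N : ℕ} (z : ℂ) (k : Fin N) :
    (z - rootOfUnity N ^ (k : ℕ)) * amplitude N z k =
      (dft N *ᵥ fun m => z ^ ((m : ℕ) + 1) * ((window N m - window N (m + 1) : ℝ) : ℂ)) k := by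
  set x := (rootOfUnity N)⁻¹ ^ (k : ℕ) with hx
  have hxk : rootOfUnity N ^ (k : ℕ) * x = 1 := by
    rw [hx, ← mul_pow, mul_inv_cancel₀ (rootOfUnity_ne_zero N), one_pow]
  have h1 : amplitude N z k = ((√(N : ℝ) : ℝ) : ℂ)⁻¹ *
      ∑ m ∈ Finset.range N, (x * z) ^ m * (window N m : ℂ) := by
    rw [amplitude, Matrix.mulVec, dotProduct, Finset.sum_range, Finset.mul_sum]
    refine Finset.sum_congr rfl fun m _ => ?_
    rw [dft, Matrix.of_apply, mul_pow]
    ring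
  have h2 : (dft N *ᵥ fun m => z ^ ((m : ℕ) + 1) * ((window N m - window N (m + 1) : ℝ) : ℂ)) k =
      ((√(N : ℝ) : ℝ) : ℂ)⁻¹ * (z * (∑ m ∈ Finset.range N, (x * z) ^ m * (window N m : ℂ)) -
        rootOfUnity N ^ (k : ℕ) *
          ∑ m ∈ Finset.range N, (x * z) ^ (m + 1) * (window N (m + 1) : ℂ)) := by
    rw [Matrix.mulVec, dotProduct, Finset.sum_range, Finset.sum_range, Finset.mul_sum,
      Finset.mul_sum, ← Finset.sum_sub_distrib, Finset.mul_sum]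
    refine Finset.sum_congr rfl fun m _ => ?_
    rw [dft, Matrix.of_apply, ← hx, mul_pow, mul_pow]
    push_cast
    linear_combination (((√(N : ℝ) : ℝ) : ℂ)⁻¹ * x ^ (m : ℕ) * z ^ ((m : ℕ) + 1) *
      (window N (m + 1) : ℂ)) * hxk
  have h3 : ∑ m ∈ Finset.range N, (x * z) ^ (m + 1) * (window N (m + 1) : ℂ) =
      ∑ m ∈ Finset.range N, (x * z) ^ m * (window N m : ℂ) := by
    have ha := Finset.sum_range_succ (fun m => (x * z) ^ m * (window N m : ℂ)) N
    have hb := Finset.sum_range_succ' (fun m => (x * z) ^ m * (window N m : ℂ)) N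
    rw [ha, window_self, window_zero] at hb
    simpa using hb.symm
  rw [h2, h3, h1]
  ring

/-- The mean squared deviation of the outcome of phase estimation from the true phase. -/
lemma sum_norm_sub_sq_mul_amplitude {N : ℕ} (hN : 2 ≤ N) {z : ℂ} (hz : ‖z‖ = 1) :
    ∑ k : Fin N, ‖z - rootOfUnity N ^ (k : ℕ)‖ ^ 2 * ‖amplitude N z k‖ ^ 2 =
      10 / ((N : ℝ) ^ 2 + 1) := by
  have h (k : Fin N) : ‖z - rootOfUnity N ^ (k : ℕ)‖ ^ 2 * ‖amplitude N z k‖ ^ 2 =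
      ‖(dft N *ᵥ fun m => z ^ ((m : ℕ) + 1) *
        ((window N m - window N (m + 1) : ℝ) : ℂ)) k‖ ^ 2 := by
    rw [← sub_mul_amplitude, norm_mul, mul_pow]
  rw [Finset.sum_congr rfl fun k _ => h k, ← vnorm_sq,
    vnorm_mulVec_of_unitary (dft_mem_unitaryGroup N), vnorm_sq, ← sum_window_sub_sq hN,
    Finset.sum_range]
  refine Finset.sum_congr rfl fun m _ => ?_
  rw [norm_mul, norm_pow, hz, one_pow, one_mul, Complex.norm_real, Real.norm_eq_abs, sq_abs]

lemma sum_norm_amplitude_sq_le {N : ℕ} (hN : 2 ≤ N) {z : ℂ} (hz : ‖z‖ = 1) {τ : ℝ} (hτ : 0 < τ)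
    (bad : Finset (Fin N)) (hbad : ∀ k ∈ bad, τ ≤ ‖z - rootOfUnity N ^ (k : ℕ)‖)
    (hNτ : 150 ≤ (N : ℝ) ^ 2 * τ ^ 2) :
    ∑ k ∈ bad, ‖amplitude N z k‖ ^ 2 ≤ 1 / 15 := by
  have h1 : τ ^ 2 * ∑ k ∈ bad, ‖amplitude N z k‖ ^ 2 ≤ 10 / ((N : ℝ) ^ 2 + 1) := by
    rw [← sum_norm_sub_sq_mul_amplitude hN hz, Finset.mul_sum]
    refine (Finset.sum_le_sum fun k hk => ?_).trans
      (Finset.sum_le_sum_of_subset_of_nonneg (Finset.subset_univ _) fun k _ _ => by positivity)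
    gcongr
    exact hbad k hk
  rw [le_div_iff₀ (by positivity)] at h1
  by_contra hlt
  push Not at hlt
  have h2 : 0 < τ ^ 2 := by positivity
  nlinarith [sq_nonneg (N : ℝ)]

end Dft

/-! ### Independent repetitions -/

section Repetition

variable {n N : ℕ}

lemma sum_pi_prod {R : Type*} [CommSemiring R] (f : Fin n → Fin N → R) :
    ∑ k : Fin n → Fin N, ∏ i, f i (k i) = ∏ i, ∑ j, f i j := by
  rw [Finset.prod_univ_sum, Fintype.piFinset_univ]

/-- A majority of bad outcomes among independent repetitions is exponentially unlikely. -/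
lemma sum_majority_le {p : Fin N → ℝ} (hp : ∀ j, 0 ≤ p j) (hsum : ∑ j, p j = 1)
    (bad : Finset (Fin N)) (hbad : ∑ j ∈ bad, p j ≤ 1 / 15) :
    ∑ k : Fin n → Fin N with n ≤ 2 * (Finset.univ.filter fun i => k i ∈ bad).card,
      ∏ i, p (k i) ≤ (1 / 2) ^ n := by
  classical
  have h1 (k : Fin n → Fin N) : ∏ i, (if k i ∈ bad then (16 : ℝ) else 1) =
      16 ^ (Finset.univ.filter fun i => k i ∈ bad).card := by
    rw [Finset.prod_ite]; simp
  calc ∑ k : Fin n → Fin N with n ≤ 2 * (Finset.univ.filter fun i => k i ∈ bad).card, ∏ i, p (k i)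
      ≤ ∑ k : Fin n → Fin N with n ≤ 2 * (Finset.univ.filter fun i => k i ∈ bad).card,
          (1 / 4) ^ n * ∏ i, (p (k i) * if k i ∈ bad then 16 else 1) := by
        refine Finset.sum_le_sum fun k hk => ?_
        have hk' := (Finset.mem_filter.mp hk).2
        rw [Finset.prod_mul_distrib, h1]
        have h2 : (4 : ℝ) ^ n ≤ 16 ^ (Finset.univ.filter fun i => k i ∈ bad).card := by
          rw [show (16 : ℝ) = 4 ^ 2 by norm_num, ← pow_mul]
          exact pow_le_pow_right₀ (by norm_num) hk'
        have h3 : 0 ≤ ∏ i, p (k i) := Finset.prod_nonneg fun i _ => hp _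
        have h4 : (1 / 4 : ℝ) ^ n * 4 ^ n = 1 := by rw [← mul_pow]; norm_num
        have h5 : (0 : ℝ) < (1 / 4) ^ n := by positivity
        calc ∏ i, p (k i) = (1 / 4) ^ n * ((∏ i, p (k i)) * 4 ^ n) := by
              linear_combination -(∏ i, p (k i)) * h4
          _ ≤ _ := by gcongr
    _ ≤ ∑ k : Fin n → Fin N, (1 / 4) ^ n * ∏ i, (p (k i) * if k i ∈ bad then 16 else 1) := by
        refine Finset.sum_le_sum_of_subset_of_nonneg (Finset.subset_univ _) fun k _ _ => ?_
        refine mul_nonneg (by positivity) (Finset.prod_nonneg fun i _ => mul_nonneg (hp _) ?_)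
        split_ifs <;> norm_num
    _ = (1 / 4) ^ n * (∑ j, p j * if j ∈ bad then 16 else 1) ^ n := by
        rw [← Finset.mul_sum, sum_pi_prod fun _ j => p j * if j ∈ bad then 16 else 1]
        simp
    _ ≤ (1 / 4) ^ n * 2 ^ n := by
        have h2 : ∑ j, p j * (if j ∈ bad then 16 else 1) = 1 + 15 * ∑ j ∈ bad, p j := by
          have h (j : Fin N) : p j * (if j ∈ bad then 16 else 1) =
              p j + 15 * if j ∈ bad then p j else 0 := by split_ifs <;> ring
          simp only [h, Finset.sum_add_distrib, ← Finset.mul_sum, hsum, Finset.sum_ite_mem,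
            Finset.univ_inter]
        have h3 : 0 ≤ ∑ j ∈ bad, p j := Finset.sum_nonneg fun j _ => hp j
        rw [h2]
        gcongr
        linarith
    _ = _ := by rw [← mul_pow]; norm_num

/-- The discrete Fourier transform on each of `n` registers. -/
noncomputable def dftPow (n N : ℕ) : Matrix (Fin n → Fin N) (Fin n → Fin N) ℂ :=
  Matrix.of fun k m => ∏ i, dft N (k i) (m i)

lemma dftPow_mem_unitaryGroup (n N : ℕ) :
    dftPow n N ∈ Matrix.unitaryGroup (Fin n → Fin N) ℂ := by
  rw [Matrix.mem_unitaryGroup_iff]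
  ext k l
  rw [Matrix.mul_apply]
  simp only [Matrix.star_apply, dftPow, Matrix.of_apply, star_prod, ← Finset.prod_mul_distrib]
  rw [sum_pi_prod fun i j => dft N (k i) j * star (dft N (l i) j)]
  have h (i : Fin n) : ∑ j, dft N (k i) j * star (dft N (l i) j) = if k i = l i then 1 else 0 := by
    have := congrFun (congrFun (Matrix.mem_unitaryGroup_iff.mp (dft_mem_unitaryGroup N)) (k i))
      (l i)
    rw [Matrix.mul_apply] at this
    simpa [Matrix.one_apply] using this
  simp only [h, Matrix.one_apply, Finset.prod_ite_zero, Finset.prod_const_one, funext_iff,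
    Finset.mem_univ, true_imp_iff]

/-- The window on each of `n` registers. -/
noncomputable def windowPow (n N : ℕ) (m : Fin n → Fin N) : ℂ := ∏ i, (window N (m i) : ℂ)

lemma dftPow_mulVec (z : ℂ) (k : Fin n → Fin N) :
    (dftPow n N *ᵥ fun m => z ^ (∑ i, (m i : ℕ)) * windowPow n N m) k =
      ∏ i, amplitude N z (k i) := by
  unfold amplitude
  simp only [Matrix.mulVec, dotProduct, dftPow, Matrix.of_apply, windowPow]
  rw [← sum_pi_prod fun i j => dft N (k i) j * (z ^ (j : ℕ) * (window N j : ℂ))]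
  refine Finset.sum_congr rfl fun m _ => ?_
  rw [Finset.prod_mul_distrib, Finset.prod_mul_distrib, Finset.prod_pow_eq_pow_sum]

lemma vnorm_windowPow (n : ℕ) {N : ℕ} (hN : 2 ≤ N) : vnorm (windowPow n N) = 1 := by
  have h : vnorm (windowPow n N) ^ 2 = 1 := by
    rw [vnorm_sq]
    simp only [windowPow, norm_prod, ← Finset.prod_pow]
    rw [sum_pi_prod fun (_ : Fin n) (j : Fin N) => ‖(window N j : ℂ)‖ ^ 2]
    have := sum_window_sq hN
    rw [Finset.sum_range] at this
    simp [this]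
  nlinarith [vnorm_nonneg (windowPow n N)]

lemma sum_majority_amplitude_le {N : ℕ} (n : ℕ) (hN : 2 ≤ N) {z : ℂ} (hz : ‖z‖ = 1) {τ : ℝ}
    (hτ : 0 < τ) (bad : Finset (Fin N))
    (hbad : ∀ k ∈ bad, τ ≤ ‖z - rootOfUnity N ^ (k : ℕ)‖) (hNτ : 150 ≤ (N : ℝ) ^ 2 * τ ^ 2) :
    ∑ k : Fin n → Fin N with n ≤ 2 * (Finset.univ.filter fun i => k i ∈ bad).card,
      ‖∏ i, amplitude N z (k i)‖ ^ 2 ≤ (1 / 2) ^ n := by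
  simp only [norm_prod, ← Finset.prod_pow]
  exact sum_majority_le (fun j => by positivity) (sum_norm_amplitude_sq hN hz) bad
    (sum_norm_amplitude_sq_le hN hz hτ bad hbad hNτ)

end Repetition

/-! ### The tomography protocol -/

section Tomography

/-- A number that is within `ρ` of more than half of the samples `y`, if there is one. -/
noncomputable def majorityValue {l : ℕ} (ρ : ℝ) (y : Fin l → ℝ) : ℝ :=
  open Classical in
  if h : ∃ c, l < 2 * (Finset.univ.filter fun i => |y i - c| ≤ ρ).card then h.choose else 0

/-- Two majorities intersect, so the majority value is close to any number that is close to most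
samples. -/
lemma abs_majorityValue_sub_le {l : ℕ} {ρ x : ℝ} {y : Fin l → ℝ}
    (h : l < 2 * (Finset.univ.filter fun i => |y i - x| ≤ ρ).card) :
    |majorityValue ρ y - x| ≤ 2 * ρ := by
  classical
  have hex : ∃ c, l < 2 * (Finset.univ.filter fun i => |y i - c| ≤ ρ).card := ⟨x, h⟩
  have hm : majorityValue ρ y = hex.choose := by rw [majorityValue, dif_pos hex]
  have hc := hex.choose_spec
  rw [← hm] at hc
  set c := majorityValue ρ y
  obtain ⟨i, hi⟩ : ((Finset.univ.filter fun i => |y i - x| ≤ ρ) ∩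
      (Finset.univ.filter fun i => |y i - c| ≤ ρ)).Nonempty := by
    rw [Finset.nonempty_iff_ne_empty]
    intro h0
    have h1 := Finset.card_union_of_disjoint (Finset.disjoint_iff_inter_eq_empty.mpr h0)
    have h2 := Finset.card_le_univ ((Finset.univ.filter fun i => |y i - x| ≤ ρ) ∪
      (Finset.univ.filter fun i => |y i - c| ≤ ρ))
    rw [Fintype.card_fin] at h2
    omega
  simp only [Finset.mem_inter, Finset.mem_filter, Finset.mem_univ, true_and] at hi
  have := abs_sub_le c (y i) x
  rw [abs_sub_comm c (y i)] at this
  linarith [hi.1, hi.2]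

variable (l N : ℕ)

/-- The basis states of the registers: `2l` small registers for the sign of the eigenphase, and `l`
registers of size `N` for its value. -/
abbrev Registers : Type := (Fin (2 * l) → Fin 15) × (Fin l → Fin N)

/-- The initial state of the registers. -/
noncomputable def registerVector : Registers l N → ℂ :=
  fun k => windowPow (2 * l) 15 k.1 * windowPow l N k.2

/-- Fourier transform of the sign registers. -/
noncomputable def signDft : Matrix.unitaryGroup (Registers l N) ℂ :=
  ⟨dftPow (2 * l) 15 ⊗ₖ (1 : Matrix (Fin l → Fin N) (Fin l → Fin N) ℂ),
    Matrix.kronecker_mem_unitary (dftPow_mem_unitaryGroup _ _) (one_mem _)⟩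

/-- Fourier transform of the value registers. -/
noncomputable def valueDft : Matrix.unitaryGroup (Registers l N) ℂ :=
  ⟨(1 : Matrix (Fin (2 * l) → Fin 15) (Fin (2 * l) → Fin 15) ℂ) ⊗ₖ dftPow l N,
    Matrix.kronecker_mem_unitary (one_mem _) (dftPow_mem_unitaryGroup _ _)⟩

/-- The powers of the walk for the estimation of the sign. -/
def signPower (k : Registers l N) : ℤ := (∑ i, (k.1 i : ℕ) : ℕ)

/-- The majority vote of the sign registers for the sign of the imaginary part of the
eigenphase. -/
noncomputable def signVote (k : Fin (2 * l) → Fin 15) : ℤ :=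
  if 2 * l ≤ 2 * (Finset.univ.filter fun i =>
    k i ∈ Finset.univ.filter fun j : Fin 15 => (rootOfUnity 15 ^ (j : ℕ)).im < 0).card then -1
  else 1

/-- The powers of the walk for the estimation of the value, with the sign that makes the effective
eigenphase lie in the upper half plane. -/
noncomputable def valuePower (k : Registers l N) : ℤ := signVote l k.1 * (∑ i, (k.2 i : ℕ) : ℕ)

lemma natAbs_signPower_le (k : Registers l N) : (signPower l N k).natAbs ≤ 2 * l * 14 := by
  rw [signPower, Int.natAbs_natCast]
  refine (Finset.sum_le_card_nsmul _ _ 14 fun i _ => by omega).trans (by simp)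

lemma natAbs_valuePower_le (k : Registers l N) : (valuePower l N k).natAbs ≤ l * (N - 1) := by
  have h : (signVote l k.1).natAbs = 1 := by unfold signVote; split_ifs <;> rfl
  rw [valuePower, Int.natAbs_mul, h, one_mul, Int.natAbs_natCast]
  refine (Finset.sum_le_card_nsmul _ _ (N - 1) fun i _ => by omega).trans (by simp)

lemma vnorm_registerVector {N : ℕ} (hN : 2 ≤ N) : vnorm (registerVector l N) = 1 := by
  have := vnorm_prod_mul (windowPow (2 * l) 15) (windowPow l N)
  rwa [vnorm_windowPow _ (by norm_num), vnorm_windowPow _ hN, one_mul] at this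

/-- The phases on the value registers for the eigenphase `z`. -/
noncomputable def valuePhase (z : ℂ) (k : Registers l N) : ℂ := z ^ (∑ i, (k.2 i : ℕ))

/-- The state of the registers after an ideal run. -/
noncomputable def idealVector (z : ℂ) : Registers l N → ℂ :=
  ((valueDft l N).1 * Matrix.diagonal (valuePhase l N z)) *ᵥ registerVector l N

lemma idealVector_apply (z : ℂ) (k : Registers l N) :
    idealVector l N z k = windowPow (2 * l) 15 k.1 * ∏ i, amplitude N z (k.2 i) := by
  rw [idealVector, ← Matrix.mulVec_mulVec, valueDft, one_kronecker_mulVec, ← dftPow_mulVec]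
  have h : (fun j' => (Matrix.diagonal (valuePhase l N z) *ᵥ registerVector l N) (k.1, j')) =
      windowPow (2 * l) 15 k.1 • fun m => z ^ (∑ i, (m i : ℕ)) * windowPow l N m := by
    ext m
    simp only [Matrix.mulVec_diagonal, valuePhase, registerVector, Pi.smul_apply, smul_eq_mul]
    ring
  rw [h, Matrix.mulVec_smul]
  rfl

lemma vnorm_idealVector {N : ℕ} (hN : 2 ≤ N) {z : ℂ} (hz : ‖z‖ = 1) :
    vnorm (idealVector l N z) = 1 := by
  have h : idealVector l N z = fun k : Registers l N =>
      windowPow (2 * l) 15 k.1 * ∏ i, amplitude N z (k.2 i) := by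
    ext k; rw [idealVector_apply]
  have h1 : vnorm (fun k : Fin l → Fin N => ∏ i, amplitude N z (k i)) = 1 := by
    have : (fun k : Fin l → Fin N => ∏ i, amplitude N z (k i)) =
        dftPow l N *ᵥ fun m => z ^ (∑ i, (m i : ℕ)) * windowPow l N m := by
      ext k; rw [dftPow_mulVec]
    rw [this, vnorm_mulVec_of_unitary (dftPow_mem_unitaryGroup _ _), ← vnorm_windowPow l hN]
    refine (sq_eq_sq₀ (vnorm_nonneg _) (vnorm_nonneg _)).mp ?_
    simp [vnorm_sq, hz]
  have h2 := vnorm_prod_mul (windowPow (2 * l) 15) fun k : Fin l → Fin N => ∏ i, amplitude N z (k i)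
  rw [vnorm_windowPow _ (by norm_num), h1, one_mul] at h2
  rwa [h]

lemma signDft_phase_mulVec (z : ℂ) (k : Registers l N) :
    (((signDft l N).1 * phaseDiagonal z (signPower l N)) *ᵥ registerVector l N) k =
      (∏ i, amplitude 15 z (k.1 i)) * windowPow l N k.2 := by
  rw [← Matrix.mulVec_mulVec, signDft, kronecker_one_mulVec, ← dftPow_mulVec]
  have h : (fun i' => (phaseDiagonal z (signPower l N) *ᵥ registerVector l N) (i', k.2)) =
      windowPow l N k.2 • fun m => z ^ (∑ i, (m i : ℕ)) * windowPow (2 * l) 15 m := by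
    ext m
    simp only [phaseDiagonal, Matrix.mulVec_diagonal, signPower, registerVector, Pi.smul_apply,
      smul_eq_mul, zpow_natCast]
    ring
  rw [h, Matrix.mulVec_smul, Pi.smul_apply, smul_eq_mul, mul_comm]

/-- Coarse phase estimation leaves only a small amplitude on wrong votes. -/
lemma sum_wrong_vote_le {N : ℕ} (hN : 2 ≤ N) {z : ℂ} (hz : ‖z‖ = 1) (him : 5 / 6 ≤ |z.im|) :
    ∑ k : Registers l N with signVote l k.1 ≠ if 0 < z.im then 1 else -1,
      ‖(((signDft l N).1 * phaseDiagonal z (signPower l N)) *ᵥ registerVector l N) k‖ ^ 2 ≤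
      ((1 / 2) ^ l) ^ 2 := by
  classical
  obtain ⟨bad, hbad, hvote⟩ : ∃ bad : Finset (Fin 15),
      (∀ k ∈ bad, 5 / 6 ≤ ‖z - rootOfUnity 15 ^ (k : ℕ)‖) ∧
      ∀ k : Fin (2 * l) → Fin 15, (signVote l k ≠ if 0 < z.im then 1 else -1) →
        2 * l ≤ 2 * (Finset.univ.filter fun i => k i ∈ bad).card := by
    have him' (j : ℕ) : |z.im - (rootOfUnity 15 ^ j).im| ≤ ‖z - rootOfUnity 15 ^ j‖ :=
      Complex.abs_im_le_norm (z - rootOfUnity 15 ^ j)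
    by_cases hpos : 0 < z.im
    · rw [abs_of_pos hpos] at him
      refine ⟨Finset.univ.filter fun j : Fin 15 => (rootOfUnity 15 ^ (j : ℕ)).im < 0,
        fun k hk => ?_, fun k hk => ?_⟩
      · have := (Finset.mem_filter.mp hk).2
        have h2 := le_abs_self (z.im - (rootOfUnity 15 ^ (k : ℕ)).im)
        linarith [him' k]
      · by_contra h
        rw [if_pos hpos, signVote, if_neg h] at hk
        exact hk rfl
    · rw [abs_of_nonpos (not_lt.mp hpos)] at him
      refine ⟨Finset.univ.filter fun j : Fin 15 => ¬ (rootOfUnity 15 ^ (j : ℕ)).im < 0,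
        fun k hk => ?_, fun k hk => ?_⟩
      · have := (Finset.mem_filter.mp hk).2
        have h2 := neg_abs_le (z.im - (rootOfUnity 15 ^ (k : ℕ)).im)
        linarith [him' k]
      · rw [if_neg hpos, signVote] at hk
        split_ifs at hk with h
        · exact absurd rfl hk
        · have h3 := Finset.card_filter_add_card_filter_not (s := Finset.univ)
            fun i : Fin (2 * l) =>
            (rootOfUnity 15 ^ (k i : ℕ)).im < 0
          simp only [Finset.mem_filter, Finset.mem_univ, true_and] at h ⊢
          simp only [Finset.card_univ, Fintype.card_fin] at h3
          omega
  have hfac : ∑ k : Registers l N with signVote l k.1 ≠ if 0 < z.im then 1 else -1,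
      ‖(((signDft l N).1 * phaseDiagonal z (signPower l N)) *ᵥ registerVector l N) k‖ ^ 2 =
      ∑ k : Fin (2 * l) → Fin 15 with signVote l k ≠ if 0 < z.im then 1 else -1,
        ‖∏ i, amplitude 15 z (k i)‖ ^ 2 := by
    have h1 : (Finset.univ.filter fun k : Registers l N =>
        signVote l k.1 ≠ if 0 < z.im then 1 else -1) =
        (Finset.univ.filter fun k => signVote l k ≠ if 0 < z.im then 1 else -1) ×ˢ Finset.univ := by
      ext k; simp
    rw [h1, Finset.sum_product]
    refine Finset.sum_congr rfl fun k _ => ?_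
    simp only [signDft_phase_mulVec, norm_mul, mul_pow]
    rw [← Finset.mul_sum, ← vnorm_sq, vnorm_windowPow l hN, one_pow, mul_one]
  rw [hfac, ← pow_mul, mul_comm l 2]
  refine le_trans (Finset.sum_le_sum_of_subset_of_nonneg (fun k hk => ?_)
      fun _ _ _ => by positivity)
    (sum_majority_amplitude_le (2 * l) (N := 15) (by norm_num) hz (τ := 5 / 6) (by norm_num) bad
      hbad (by norm_num))
  simp only [Finset.mem_filter, Finset.mem_univ, true_and] at hk ⊢
  exact hvote k hk

/-- For both eigenphases `z` and `star z` the registers end up close to the same state. -/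
lemma vnorm_registerCircuit_sub_idealVector_le {N : ℕ} (hN : 2 ≤ N) {z z' : ℂ} (hz : ‖z‖ = 1)
    (him : 5 / 6 ≤ z.im) (hz' : z' = z ∨ z' = star z) :
    vnorm (registerCircuit z' (signDft l N) (valueDft l N) (signPower l N) (valuePower l N) *ᵥ
      registerVector l N - idealVector l N z) ≤ 2 * (1 / 2) ^ l := by
  have hn' : ‖z'‖ = 1 := by rcases hz' with rfl | rfl <;> simp [hz]
  have him' : 5 / 6 ≤ |z'.im| := by
    rcases hz' with rfl | rfl
    · exact him.trans (le_abs_self _)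
    · simp only [Complex.star_def, Complex.conj_im, abs_neg]
      exact him.trans (le_abs_self _)
  have hz0 : z ≠ 0 := by rintro rfl; simp at hz
  have hstar : star z = z⁻¹ := by
    rw [Complex.star_def, Complex.inv_def, Complex.normSq_eq_norm_sq, hz]; simp
  have h := vnorm_registerCircuit_sub_le hn' (signDft l N) (valueDft l N) (signPower l N)
    (valuePower l N) (valuePhase l N z) (fun k => by rw [valuePhase, norm_pow, hz, one_pow])
    (Finset.univ.filter fun k => signVote l k.1 ≠ if 0 < z'.im then 1 else -1) (fun k hk => ?_)
    (registerVector l N) (p := (1 / 2) ^ l) (by positivity) (sum_wrong_vote_le l hN hn' him')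
  · refine le_trans (le_of_eq ?_) h
    congr 2
    rw [idealVector]
    congr 2
    -- the sign estimation commutes with the phases on the value registers
    set D : Matrix (Registers l N) (Registers l N) ℂ := Matrix.diagonal (valuePhase l N z) with hD
    have hcomm : D * (signDft l N).1 = (signDft l N).1 * D := by
      have hs : (signDft l N).1 =
        dftPow (2 * l) 15 ⊗ₖ (1 : Matrix (Fin l → Fin N) (Fin l → Fin N) ℂ) := rfl
      rw [hs]
      ext k m
      rw [hD, Matrix.diagonal_mul, Matrix.mul_diagonal, Matrix.kroneckerMap_apply,
        Matrix.one_apply]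
      split_ifs with hkm
      · rw [valuePhase, valuePhase, hkm]; ring
      · ring
    have hinv : (signDft l N)⁻¹.1 * (signDft l N).1 = 1 := by
      rw [← Submonoid.coe_mul, inv_mul_cancel]; rfl
    have hph : phaseDiagonal z' (-signPower l N) * phaseDiagonal z' (signPower l N) = 1 := by
      have h0 : z' ≠ 0 := by rintro rfl; simp at hn'
      rw [phaseDiagonal, phaseDiagonal, Matrix.diagonal_mul_diagonal, ← Matrix.diagonal_one]
      congr 1
      funext k
      rw [← zpow_add₀ h0]
      simp
    have hcomm2 : D * phaseDiagonal z' (signPower l N) = phaseDiagonal z' (signPower l N) * D := by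
      rw [hD, phaseDiagonal, Matrix.diagonal_mul_diagonal, Matrix.diagonal_mul_diagonal]
      congr 1
      funext k
      ring
    calc D = phaseDiagonal z' (-signPower l N) * phaseDiagonal z' (signPower l N) * D := by
          rw [hph, one_mul]
      _ = phaseDiagonal z' (-signPower l N) * (((signDft l N)⁻¹.1 * (signDft l N).1) * D *
            phaseDiagonal z' (signPower l N)) := by
          rw [hinv, one_mul, hcomm2, mul_assoc]
      _ = _ := by
          rw [mul_assoc ((signDft l N)⁻¹.1), ← hcomm]
          simp only [mul_assoc]
  · simp only [Finset.mem_filter, Finset.mem_univ, true_and, not_not] at hk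
    rw [valuePower, hk, valuePhase]
    rcases hz' with rfl | rfl
    · rw [if_pos (by linarith), one_mul, zpow_natCast]
    · rw [if_neg (by simp only [Complex.star_def, Complex.conj_im]; linarith), hstar, neg_one_mul,
        zpow_neg, inv_zpow, inv_inv, zpow_natCast]

/-- The estimate of `⟨A⟩` from an outcome of the value registers: the walk has eigenphases with
real part `⟨A⟩ / 2`. -/
noncomputable def registerEstimate (ε : ℝ) (k : Registers l N) : ℝ :=
  majorityValue (ε / 2) fun i => 2 * (rootOfUnity N ^ (k.2 i : ℕ)).re

lemma abs_registerEstimate_sub_le {ε : ℝ} {z : ℂ} {bad : Finset (Fin N)}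
    (hbad : ∀ j ∉ bad, ‖z - rootOfUnity N ^ (j : ℕ)‖ ≤ ε / 4) {k : Registers l N}
    (hk : ¬ l ≤ 2 * (Finset.univ.filter fun i => k.2 i ∈ bad).card) :
    |registerEstimate l N ε k - 2 * z.re| ≤ ε := by
  refine (abs_majorityValue_sub_le ?_).trans (by linarith)
  have h1 : (Finset.univ.filter fun i => k.2 i ∉ bad) ⊆
      Finset.univ.filter fun i => |2 * (rootOfUnity N ^ (k.2 i : ℕ)).re - 2 * z.re| ≤ ε / 2 := by
    intro i hi
    simp only [Finset.mem_filter, Finset.mem_univ, true_and] at hi ⊢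
    have h2 := Complex.abs_re_le_norm (z - rootOfUnity N ^ (k.2 i : ℕ))
    rw [Complex.sub_re] at h2
    rw [← mul_sub, abs_mul, abs_sub_comm, abs_two]
    linarith [hbad _ hi]
  have h3 := Finset.card_le_card h1
  have h4 := Finset.card_filter_add_card_filter_not (s := Finset.univ) fun i : Fin l => k.2 i ∈ bad
  rw [Finset.card_univ, Fintype.card_fin] at h4
  omega

variable {J : Type} [Fintype J] [DecidableEq J] [Nonempty J] {b : ℕ}

/-- The tomography protocol with call times `t`, `l` repetitions, and phase estimation with
registers of size `N`. -/
noncomputable def tomography (b : ℕ) (t : J → ℝ) (ε : ℝ) (l : ℕ) {N : ℕ} (hN : 2 ≤ N) :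
    Protocol b :=
  haveI : Nonempty (Fin N) := ⟨⟨0, by omega⟩⟩
  estimationProtocol b t (registerVector l N) (vnorm_registerVector l hN) (signDft l N)
    (valueDft l N) (signPower l N) (valuePower l N) (2 * l * 14) (l * (N - 1))
    (registerEstimate l N ε)

lemma tomography_calls (t : J → ℝ) (ε : ℝ) {N : ℕ} (hN : 2 ≤ N) :
    (tomography b t ε l hN).calls = 2 * (2 * (2 * l * 14) + l * (N - 1)) :=
  have : Nonempty (Fin N) := ⟨⟨0, by omega⟩⟩
  calls_estimationProtocol ..

lemma tomography_time_le {t : J → ℝ} {T : ℝ} (hT : 0 ≤ T) (ht : ∀ j, |t j| ≤ T) (ε : ℝ) {N : ℕ}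
    (hN : 2 ≤ N) : (tomography b t ε l hN).time ≤ (tomography b t ε l hN).calls * T := by
  have : Nonempty (Fin N) := ⟨⟨0, by omega⟩⟩
  rw [tomography_calls]
  refine (time_estimationProtocol_le (hT := hT) (ht := ht) ..).trans (le_of_eq ?_)
  push_cast
  ring

variable {Q : Type} [Fintype Q] [DecidableEq Q]

/-- The protocol succeeds on `ψ` if `ψ` is an approximate eigenvector of the time-averaged
observable, with eigenvalue `⟨A⟩`. -/
lemma tomography_succeeds {H : Matrix Q Q ℂ} (hH : H.IsHermitian)
    {V : Matrix (Q × Reg b) (Q × Reg b) ℂ} {A : Matrix Q Q ℂ} (hA : A.IsHermitian)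
    (hVA : IsBlockEncoding V A) {ψ : Q → ℂ} (hψ : vnorm ψ = 1) (hx : |expectation A ψ| ≤ 1)
    (t : J → ℝ) {η : ℝ} (hη : vnorm (timeAverage H A t *ᵥ ψ - (expectation A ψ : ℂ) • ψ) ≤ η)
    {ε δ : ℝ} (hε : 0 < ε) {N : ℕ} (hN : 2 ≤ N) (hNε : 49 ≤ N * ε)
    (hδ : (1 / 2) ^ l ≤ δ / 40)
    (hcalls : (tomography b t ε l hN).calls * η ≤ δ / 6) :
    (tomography b t ε l hN).Succeeds H V A ψ ε δ := by
  have : Nonempty (Fin N) := ⟨⟨0, by omega⟩⟩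
  obtain ⟨hV, hVA'⟩ := hVA
  set x := expectation A ψ
  obtain ⟨hx1, hx2⟩ := abs_le.mp hx
  have hxx : 0 ≤ 1 - (x / 2) ^ 2 := by nlinarith
  set z : ℂ := ⟨x / 2, √(1 - (x / 2) ^ 2)⟩ with hzdef
  have hre : 2 * z.re = x := by simp [hzdef]; ring
  have hre' : |z.re| ≤ 1 / 2 := by rw [abs_le]; constructor <;> linarith
  have hz : ‖z‖ = 1 := by
    have : ‖z‖ ^ 2 = 1 := by
      rw [Complex.sq_norm, Complex.normSq_apply]
      simp only [hzdef]
      rw [Real.mul_self_sqrt hxx]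
      ring
    nlinarith [norm_nonneg z]
  have him : 5 / 6 ≤ z.im := by
    refine Real.le_sqrt_of_sq_le ?_
    nlinarith
  set e := workspaceEquiv J (Registers l N)
  set g := walk hH hV t
  set C := estimationCircuit g (signDft l N) (valueDft l N) (signPower l N) (valuePower l N)
  set χ := idealVector l N z
  have hχ : vnorm χ = 1 := vnorm_idealVector l hN hz
  set M := 2 * (2 * l * 14) + l * (N - 1) with hM
  have hη0 : 0 ≤ η := (vnorm_nonneg _).trans hη
  -- each of the two walk eigenvectors only kicks phases back to the registers
  have hhalf (z' : ℂ) (hz' : z' = z ∨ z' = star z) :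
      vnorm (C *ᵥ tensorVec (walkVector H V t ψ z') (registerVector l N) -
        tensorVec (walkVector H V t ψ z') χ) ≤
        M * (3 / 5 * η) + 6 / 5 * (2 * (1 / 2) ^ l) := by
    have hn' : ‖z'‖ = 1 := by rcases hz' with rfl | rfl <;> simp [hz]
    have hr' : z'.re = z.re := by rcases hz' with rfl | rfl <;> simp
    have h1 := vnorm_walk_mulVec_sub_le hH hV hA hVA' t (ψ := ψ) hn' (hr' ▸ hre') (η := η)
      (by rw [hr', hre]; exact hη)
    have h2 := actsOnRegister_estimationCircuit g (signDft l N) (valueDft l N) hn' h1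
      (natAbs_signPower_le l N) (natAbs_valuePower_le l N) (registerVector l N)
    rw [vnorm_registerVector l hN, mul_one] at h2
    refine (vnorm_sub_le_add _ (tensorVec (walkVector H V t ψ z') (registerCircuit z' (signDft l N)
      (valueDft l N) (signPower l N) (valuePower l N) *ᵥ registerVector l N)) _).trans ?_
    refine add_le_add h2 ?_
    rw [← tensorVec_sub, vnorm_tensorVec]
    exact mul_le_mul (vnorm_walkVector_le hH hV t hψ hn' (hr' ▸ hre'))
      (vnorm_registerCircuit_sub_idealVector_le l hN hz him hz') (vnorm_nonneg _) (by norm_num)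
  have hfull : vnorm (C *ᵥ tensorVec (encoded b J ψ) (registerVector l N) -
      tensorVec (encoded b J ψ) χ) ≤ δ / 4 := by
    have h1 := hhalf z (Or.inl rfl)
    have h2 := hhalf (star z) (Or.inr rfl)
    rw [← walkVector_add (H := H) (V := V) (t := t) (ψ := ψ) hz hre', tensorVec_add, tensorVec_add,
      Matrix.mulVec_add, add_sub_add_comm]
    refine (vnorm_add_le _ _).trans ?_
    rw [tomography_calls, ← hM, Nat.cast_mul, Nat.cast_two] at hcalls
    have hpow : (0 : ℝ) < (1 / 2) ^ l := by positivity
    linarith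
  let n := Fintype.card ((J × Fin 4) × Registers l N)
  let E : ((Q × Reg b) × (J × Fin 4)) × Registers l N ≃ (Q × Reg b) × Fin n :=
    (Equiv.prodAssoc _ _ _).trans ((Equiv.refl _).prodCongr e)
  let Φ : (Q × Reg b) × Fin n → ℂ := (tomography b t ε l hN).finalState H V ψ
  have hfinal : (fun q => Φ (E q)) = C *ᵥ tensorVec (encoded b J ψ) (registerVector l N) :=
    funext fun q => finalState_estimationProtocol t _ _ _ _ _ hH hV (natAbs_signPower_le l N)
      (natAbs_valuePower_le l N) ψ q.1.1 q.1.2 q.2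
  have hprod (q : ((Q × Reg b) × (J × Fin 4)) × Registers l N) :
      ψ (E q).1.1 * ancillaVector b J χ ((E q).1.2, (E q).2) =
        tensorVec (encoded b J ψ) χ q := by
    have h1 : (E q).1 = q.1.1 := rfl
    have h2 : (E q).2 = e (q.1.2, q.2) := rfl
    rw [h1, h2, ancillaVector, Equiv.symm_apply_apply, ← mul_assoc]
    rfl
  set bad : Finset (Fin N) :=
    Finset.univ.filter fun j : Fin N => ¬ ‖z - rootOfUnity N ^ (j : ℕ)‖ ≤ ε / 4 with hbad
  set good : Finset (Reg b × Fin n) := Finset.univ.filter fun a =>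
    ¬ l ≤ 2 * (Finset.univ.filter fun i => (e.symm a.2).2.2 i ∈ bad).card with hgood
  refine Protocol.succeeds_of_near_product _ H V A ψ (ancillaVector b J χ) (κ := δ / 4) hψ
    ((vnorm_ancillaVector χ).trans hχ) ?_ ?_ (by linarith) good (fun a ha => ?_) ?_
  · change vnorm Φ = 1
    rw [← vnorm_comp_equiv E, hfinal,
      vnorm_mulVec_of_unitary (estimationCircuit_mem_unitaryGroup ..), vnorm_tensorVec,
      vnorm_encoded, hψ, vnorm_registerVector l hN, one_mul]
  · change vnorm (fun p : (Q × Reg b) × Fin n =>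
      Φ p - ψ p.1.1 * ancillaVector b J χ (p.1.2, p.2)) ≤ _
    rw [← vnorm_comp_equiv E]
    simp only [hprod]
    have h1 : (fun q => Φ (E q) - tensorVec (encoded b J ψ) χ q) =
        C *ᵥ tensorVec (encoded b J ψ) (registerVector l N) - tensorVec (encoded b J ψ) χ := by
      rw [← hfinal]; rfl
    rw [h1]
    exact hfull
  · have := abs_registerEstimate_sub_le l N (ε := ε) (z := z) (bad := bad)
      (k := (e.symm a.2).2) (by simp [hbad]) (Finset.mem_filter.mp ha).2
    rw [hre] at this
    exact this
  · have htot : ∑ a, ‖ancillaVector b J χ a‖ ^ 2 = 1 := by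
      rw [← vnorm_sq, vnorm_ancillaVector, hχ, one_pow]
    have hbadsum : ∑ a ∈ goodᶜ, ‖ancillaVector b J χ a‖ ^ 2 ≤ (1 / 2) ^ l := by
      have h1 : ∑ a ∈ goodᶜ, ‖ancillaVector b J χ a‖ ^ 2 =
          ∑ k : Registers l N with l ≤ 2 * (Finset.univ.filter fun i => k.2 i ∈ bad).card,
            ‖χ k‖ ^ 2 := by
        have h2 : goodᶜ = Finset.univ.filter fun a : Reg b × Fin n =>
            l ≤ 2 * (Finset.univ.filter fun i => (e.symm a.2).2.2 i ∈ bad).card := by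
          ext a; simp [hgood]
        rw [h2, Finset.sum_filter, ← (ancillaEquiv b e).symm.sum_comp fun a =>
          if l ≤ 2 * (Finset.univ.filter fun i => (e.symm a.2).2.2 i ∈ bad).card then
            ‖ancillaVector b J χ a‖ ^ 2 else 0, Fintype.sum_prod_type_right, Finset.sum_filter]
        refine Finset.sum_congr rfl fun k _ => ?_
        have h3 (y : Reg b × (J × Fin 4)) :
            ((ancillaEquiv b e).symm (y, k)).1 = y.1 ∧
              e.symm ((ancillaEquiv b e).symm (y, k)).2 = (y.2, k) := by
          simp [ancillaEquiv]
        have h4 (y : Reg b × (J × Fin 4)) :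
            ‖ancillaVector b J χ ((ancillaEquiv b e).symm (y, k))‖ ^ 2 =
              ‖encodingVector b J y‖ ^ 2 * ‖χ k‖ ^ 2 := by
          rw [ancillaVector, (h3 y).2, (h3 y).1, norm_mul, mul_pow]
        simp only [(h3 _).2, h4]
        split_ifs
        · rw [← Finset.sum_mul, ← vnorm_sq, vnorm_encodingVector, one_pow, one_mul]
        · simp
      have h5 : (Finset.univ.filter fun k : Registers l N =>
          l ≤ 2 * (Finset.univ.filter fun i => k.2 i ∈ bad).card) =
          Finset.univ ×ˢ (Finset.univ.filter fun k : Fin l → Fin N =>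
            l ≤ 2 * (Finset.univ.filter fun i => k i ∈ bad).card) := by
        ext k; simp
      rw [h1, h5, Finset.sum_product_right]
      have h6 (k : Fin l → Fin N) : ∑ k', ‖χ (k', k)‖ ^ 2 = ‖∏ i, amplitude N z (k i)‖ ^ 2 := by
        simp only [χ, idealVector_apply, norm_mul, mul_pow]
        rw [← Finset.sum_mul, ← vnorm_sq, vnorm_windowPow _ (by norm_num), one_pow, one_mul]
      simp only [h6]
      refine sum_majority_amplitude_le l hN hz (τ := ε / 4) (by linarith) bad (fun k hk => ?_) ?_
      · exact (not_le.mp (Finset.mem_filter.mp hk).2).le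
      · nlinarith
    have hsplit := Finset.sum_add_sum_compl good fun a => ‖ancillaVector b J χ a‖ ^ 2
    have hpow : (0 : ℝ) < (1 / 2) ^ l := by positivity
    change 1 - δ / 2 ≤ ∑ a ∈ good, ‖ancillaVector b J χ a‖ ^ 2
    linarith

end Tomography

/-! ### Commutation of operators with disjoint supports -/

section LocalAlgebra

variable {D L : ℕ}

lemma onQubit_mul_apply (x : Site D L) (m : Matrix (Fin 2) (Fin 2) ℂ) (M : Op D L)
    (σ τ : Config D L) :
    (onQubit x m * M) σ τ = ∑ s, m (σ x) s * M (Function.update σ x s) τ := by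
  rw [Matrix.mul_apply]
  have hinj : Function.Injective fun s : Fin 2 => Function.update σ x s :=
    Function.update_injective σ x
  have h : ∑ s, m (σ x) s * M (Function.update σ x s) τ =
      ∑ ρ ∈ Finset.univ.map ⟨_, hinj⟩, onQubit x m σ ρ * M ρ τ := by
    rw [Finset.sum_map]
    refine Finset.sum_congr rfl fun s _ => ?_
    have : ∀ y, y ≠ x → σ y = Function.update σ x s y := fun y hy => by
      rw [Function.update_of_ne hy]
    simp only [Function.Embedding.coeFn_mk, onQubit, Matrix.of_apply, if_pos this,
      Function.update_self]
  rw [h]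
  refine (Finset.sum_subset (Finset.subset_univ _) fun ρ _ hρ => ?_).symm
  rw [onQubit, Matrix.of_apply, if_neg, zero_mul]
  intro hall
  refine hρ (Finset.mem_map.mpr ⟨ρ x, Finset.mem_univ _, ?_⟩)
  ext y : 1
  by_cases hy : y = x
  · subst hy; simp
  · simp [hy, hall y hy]

lemma onQubit_commute {x y : Site D L} (hxy : x ≠ y) (m m' : Matrix (Fin 2) (Fin 2) ℂ) :
    Commute (onQubit x m) (onQubit y m') := by
  rw [commute_iff_eq, ← mul_one (onQubit x m * onQubit y m'), mul_assoc,
    ← mul_one (onQubit y m' * onQubit x m), mul_assoc]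
  ext σ τ
  simp only [onQubit_mul_apply, Finset.mul_sum, Function.update_of_ne hxy,
    Function.update_of_ne hxy.symm]
  rw [Finset.sum_comm]
  refine Finset.sum_congr rfl fun s _ => Finset.sum_congr rfl fun s' _ => ?_
  rw [Function.update_comm hxy]
  ring

/-- The Jordan–Wigner sign of the mode at `x`. -/
def jwSign (x : Site D L) (σ : Config D L) : ℂ :=
  (-1) ^ ({y | finFunctionFinEquiv y < finFunctionFinEquiv x ∧ σ y = 1} : Finset (Site D L)).card

lemma jwSign_eq_prod (x : Site D L) (σ : Config D L) :
    jwSign x σ =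
      ∏ y, if finFunctionFinEquiv y < finFunctionFinEquiv x ∧ σ y = 1 then (-1 : ℂ) else 1 := by
  rw [Finset.prod_ite]; simp [jwSign]

lemma jwSign_mul_self (x : Site D L) (σ : Config D L) : jwSign x σ * jwSign x σ = 1 := by
  rw [jwSign, ← mul_pow]; simp

/-- Flipping the occupation at `y` changes the Jordan–Wigner sign of the modes behind `y`. -/
lemma jwSign_update (x y : Site D L) (σ : Config D L) {i : Fin 2} (hi : σ y = i) :
    jwSign x (Function.update σ y (1 - i)) =
      (if finFunctionFinEquiv y < finFunctionFinEquiv x then -1 else 1) * jwSign x σ := by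
  rw [jwSign_eq_prod, jwSign_eq_prod, ← Finset.mul_prod_erase _ _ (Finset.mem_univ y),
    ← Finset.mul_prod_erase Finset.univ _ (Finset.mem_univ y)]
  have h : ∏ z ∈ Finset.univ.erase y, (if finFunctionFinEquiv z < finFunctionFinEquiv x ∧
      Function.update σ y (1 - i) z = 1 then (-1 : ℂ) else 1) =
      ∏ z ∈ Finset.univ.erase y,
        if finFunctionFinEquiv z < finFunctionFinEquiv x ∧ σ z = 1 then (-1 : ℂ) else 1 := by
    refine Finset.prod_congr rfl fun z hz => ?_
    rw [Function.update_of_ne (Finset.ne_of_mem_erase hz)]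
  rw [h, ← mul_assoc, Function.update_self, hi]
  congr 1
  fin_cases i <;> by_cases h : finFunctionFinEquiv y < finFunctionFinEquiv x <;> simp [h]

/-- The annihilation (`i = 0`) and creation (`i = 1`) operators: they turn occupation `1 - i` into
occupation `i`. -/
def ladder (x : Site D L) (i : Fin 2) : Op D L := if i = 0 then annihilate x else (annihilate x)ᴴ

lemma ladder_apply (x : Site D L) (i : Fin 2) (σ τ : Config D L) :
    ladder x i σ τ =
      if σ x = i ∧ τ = Function.update σ x (1 - i) then jwSign x σ else 0 := by
  fin_cases i
  · simp only [ladder, annihilate, Matrix.of_apply, Fin.zero_eta, if_true, sub_zero]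
    have hiff : (τ x = 1 ∧ σ = Function.update τ x 0) ↔
        (σ x = 0 ∧ τ = Function.update σ x 1) := by
      constructor
      · rintro ⟨h1, rfl⟩
        simp [← h1]
      · rintro ⟨h1, rfl⟩
        simp [← h1]
    by_cases h : σ x = 0 ∧ τ = Function.update σ x 1
    · rw [if_pos h, if_pos (hiff.mpr h)]
      have := jwSign_update x x σ h.1
      rw [sub_zero, if_neg (lt_irrefl _), one_mul, ← h.2] at this
      exact this
    · rw [if_neg h, if_neg (mt hiff.mp h)]
  · simp only [ladder, annihilate, Matrix.conjTranspose_apply, Matrix.of_apply, Fin.mk_one,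
      one_ne_zero, if_false, sub_self]
    split_ifs
    · simp [jwSign]
    · simp

lemma ladder_mul_apply (x : Site D L) (i : Fin 2) (M : Op D L) (σ τ : Config D L) :
    (ladder x i * M) σ τ =
      if σ x = i then jwSign x σ * M (Function.update σ x (1 - i)) τ else 0 := by
  rw [Matrix.mul_apply, Finset.sum_eq_single (Function.update σ x (1 - i))]
  · rw [ladder_apply]
    by_cases h : σ x = i <;> simp [h]
  · intro ρ _ hρ
    rw [ladder_apply, if_neg (fun h => hρ h.2), zero_mul]
  · simp

lemma ladder_anticommute {x y : Site D L} (hxy : x ≠ y) (i j : Fin 2) :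
    ladder x i * ladder y j = -(ladder y j * ladder x i) := by
  rw [← mul_one (ladder x i * ladder y j), mul_assoc, ← mul_one (ladder y j * ladder x i),
    mul_assoc]
  ext σ τ
  rw [Matrix.neg_apply]
  simp only [ladder_mul_apply, Function.update_of_ne hxy, Function.update_of_ne hxy.symm]
  by_cases hx : σ x = i
  · by_cases hy : σ y = j
    · simp only [hx, hy, if_true]
      rw [jwSign_update y x σ hx, jwSign_update x y σ hy, Function.update_comm hxy]
      generalize (1 : Op D L) (Function.update (Function.update σ y (1 - j)) x (1 - i)) τ = c
      have hne : finFunctionFinEquiv x ≠ finFunctionFinEquiv y :=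
        fun h => hxy (finFunctionFinEquiv.injective h)
      rcases lt_or_gt_of_ne hne with h | h
      · rw [if_pos h, if_neg h.le.not_gt]; ring
      · rw [if_neg h.le.not_gt, if_pos h]; ring
    · simp [hy]
  · simp [hx]

lemma ladder_mul_self (x : Site D L) (i : Fin 2) : ladder x i * ladder x i = 0 := by
  ext σ τ
  rw [← mul_one (ladder x i), mul_assoc, ladder_mul_apply, one_mul, ladder_mul_apply]
  fin_cases i <;> simp

lemma ladder_mul_add (x : Site D L) :
    ladder x 0 * ladder x 1 + ladder x 1 * ladder x 0 = (1 : Op D L) := by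
  ext σ τ
  have h (i : Fin 2) (hi : σ x = i) :
      jwSign x (Function.update σ x (1 - i)) = jwSign x σ := by
    rw [jwSign_update x x σ hi, if_neg (lt_irrefl _), one_mul]
  have hcase : ∀ s : Fin 2, s = 0 ∨ s = 1 := by decide
  have h1 : (ladder x 0 * ladder x 1 + ladder x 1 * ladder x 0 : Op D L) =
      ladder x 0 * (ladder x 1 * 1) + ladder x 1 * (ladder x 0 * 1) := by rw [mul_one, mul_one]
  rw [h1, Matrix.add_apply]
  simp only [ladder_mul_apply, sub_zero, sub_self, Function.update_self]
  rcases hcase (σ x) with hx | hx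
  · have h2 : Function.update (Function.update σ x 1) x (1 - 1) = σ := by
      rw [sub_self, ← hx]; simp
    have h3 := h 0 hx
    rw [sub_zero] at h3
    simp only [hx, if_true, zero_ne_one, if_false, add_zero, h3]
    rw [← mul_assoc, jwSign_mul_self, one_mul]
    exact congrArg (fun ρ => (1 : Op D L) ρ τ) h2
  · have h2 : Function.update (Function.update σ x 0) x (1 - 0) = σ := by
      rw [sub_zero, ← hx]; simp
    have h3 := h 1 hx
    rw [sub_self] at h3
    simp only [hx, if_true, one_ne_zero, if_false, zero_add, h3]
    rw [← mul_assoc, jwSign_mul_self, one_mul]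
    exact congrArg (fun ρ => (1 : Op D L) ρ τ) h2

lemma mem_modes_iff {S : Finset (Site D L)} {c : Op D L} :
    c ∈ modes S ↔ ∃ x ∈ S, ∃ i, c = ladder x i := by
  constructor
  · rintro ⟨x, hx, rfl | rfl⟩
    · exact ⟨x, hx, 0, by simp [ladder]⟩
    · exact ⟨x, hx, 1, by simp [ladder]⟩
  · rintro ⟨x, hx, i, rfl⟩
    refine ⟨x, hx, ?_⟩
    fin_cases i <;> simp [ladder]

lemma commute_of_mem_adjoin {A : Type*} [Ring A] [Algebra ℂ A] {s t : Set A} {a b : A}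
    (h : ∀ x ∈ s, ∀ y ∈ t, Commute x y) (ha : a ∈ Algebra.adjoin ℂ s)
    (hb : b ∈ Algebra.adjoin ℂ t) : Commute a b :=
  Algebra.commute_of_mem_adjoin_of_forall_mem_commute hb fun _ hy =>
    (Algebra.commute_of_mem_adjoin_of_forall_mem_commute ha fun _ hx => (h _ hx _ hy).symm).symm

/-- A Hamiltonian term commutes with the operators that are supported elsewhere; for fermions this
uses that the term is even. -/
lemma commute_of_disjoint {k : Kind} {S X : Finset (Site D L)} (hSX : Disjoint S X) {M N : Op D L}
    (hM : M ∈ termAlgebra k S) (hN : N ∈ localAlgebra k X) : Commute M N := by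
  have hne {x y : Site D L} (hx : x ∈ S) (hy : y ∈ X) : x ≠ y := by
    rintro rfl; exact Finset.disjoint_left.mp hSX hx hy
  cases k with
  | spin =>
    refine commute_of_mem_adjoin ?_ hM hN
    rintro _ ⟨x, hx, m, rfl⟩ _ ⟨y, hy, m', rfl⟩
    exact onQubit_commute (hne hx hy) m m'
  | fermion =>
    refine commute_of_mem_adjoin ?_ hM hN
    rintro _ ⟨c, hc, d, hd, rfl⟩ e he
    obtain ⟨x, hx, i, rfl⟩ := mem_modes_iff.mp hc
    obtain ⟨y, hy, j, rfl⟩ := mem_modes_iff.mp hd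
    obtain ⟨z, hz, l, rfl⟩ := mem_modes_iff.mp he
    rw [commute_iff_eq, mul_assoc, ladder_anticommute (hne hy hz), mul_neg, ← mul_assoc,
      ladder_anticommute (hne hx hz), neg_mul, neg_neg, mul_assoc]

lemma termAlgebra_le_localAlgebra (k : Kind) (S : Finset (Site D L)) :
    termAlgebra k S ≤ localAlgebra k S := by
  cases k with
  | spin => exact le_rfl
  | fermion =>
    refine Algebra.adjoin_le ?_
    rintro _ ⟨c, hc, d, hd, rfl⟩
    exact mul_mem (Algebra.subset_adjoin hc) (Algebra.subset_adjoin hd)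

/-- Every site carries an operator `c` with `c² = 0` and `c c† + c† c = 1`. -/
lemma exists_lowering_operator (k : Kind) (x : Site D L) :
    ∃ c d : Op D L, c ∈ localAlgebra k {x} ∧ d ∈ localAlgebra k {x} ∧ d = cᴴ ∧ c * c = 0 ∧
      d * d = 0 ∧ c * d + d * c = 1 := by
  cases k with
  | spin =>
    have hmul (m m' : Matrix (Fin 2) (Fin 2) ℂ) :
        onQubit x m * onQubit x m' = onQubit x (m * m') := by
      ext σ τ
      rw [onQubit_mul_apply]
      simp only [onQubit, Matrix.of_apply, Function.update_self, Matrix.mul_apply]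
      have : ∀ s, (∀ y, y ≠ x → Function.update σ x s y = τ y) ↔ ∀ y, y ≠ x → σ y = τ y := by
        intro s
        refine forall_congr' fun y => ?_
        refine forall_congr' fun hy => ?_
        rw [Function.update_of_ne hy]
      simp only [this]
      split_ifs <;> simp
    have hone : onQubit x 1 = (1 : Op D L) := by
      ext σ τ
      simp only [onQubit, Matrix.of_apply, Matrix.one_apply]
      by_cases h : σ = τ
      · subst h; simp
      · rw [if_neg h]
        split_ifs with h1 h2
        · refine absurd (funext fun y => ?_) h
          by_cases hy : y = x
          · rw [hy, h2]
          · exact h1 y hy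
        · rfl
        · rfl
    have hadd (m m' : Matrix (Fin 2) (Fin 2) ℂ) :
        onQubit x m + onQubit x m' = onQubit x (m + m') := by
      ext σ τ
      simp only [onQubit, Matrix.of_apply, Matrix.add_apply]
      split_ifs <;> simp
    have hzero : onQubit x 0 = (0 : Op D L) := by
      ext σ τ
      simp [onQubit]
    refine ⟨onQubit x !![0, 1; 0, 0], onQubit x !![0, 0; 1, 0],
      Algebra.subset_adjoin ⟨x, by simp, _, rfl⟩, Algebra.subset_adjoin ⟨x, by simp, _, rfl⟩,
      ?_, ?_, ?_, ?_⟩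
    · ext σ τ
      simp only [onQubit, Matrix.conjTranspose_apply, Matrix.of_apply]
      have : (∀ y, y ≠ x → τ y = σ y) ↔ ∀ y, y ≠ x → σ y = τ y :=
        forall_congr' fun y => forall_congr' fun _ => eq_comm
      simp only [this]
      split_ifs
      · generalize σ x = a
        generalize τ x = c
        fin_cases a <;> fin_cases c <;> simp
      · simp
    · rw [hmul, ← hzero]; congr 1; ext i j; fin_cases i <;> fin_cases j <;> simp [Matrix.mul_apply]
    · rw [hmul, ← hzero]; congr 1; ext i j; fin_cases i <;> fin_cases j <;> simp [Matrix.mul_apply]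
    · rw [hmul, hmul, hadd, ← hone]; congr 1
      ext i j; fin_cases i <;> fin_cases j <;> simp
  | fermion =>
    have hmem (i : Fin 2) : ladder x i ∈ localAlgebra .fermion {x} :=
      Algebra.subset_adjoin (mem_modes_iff.mpr ⟨x, by simp, i, rfl⟩)
    exact ⟨ladder x 0, ladder x 1, hmem 0, hmem 1, by simp [ladder], ladder_mul_self x 0,
      ladder_mul_self x 1, ladder_mul_add x⟩

end LocalAlgebra

/-! ### Counting interaction terms -/

section Counting

variable {D L : ℕ}

lemma manhattan_self (x : Site D L) : manhattan x x = 0 := by simp [manhattan]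

lemma manhattan_triangle (x y z : Site D L) : manhattan x z ≤ manhattan x y + manhattan y z := by
  unfold manhattan
  rw [← Finset.sum_add_distrib]
  refine Finset.sum_le_sum fun i _ => ?_
  omega

lemma manhattan_le_diam {S : Finset (Site D L)} {x y : Site D L} (hx : x ∈ S) (hy : y ∈ S) :
    manhattan x y ≤ diam S :=
  Finset.le_sup (f := fun p : Site D L × Site D L => manhattan p.1 p.2) (b := (x, y))
    (Finset.mk_mem_product hx hy)

lemma card_ball_le (x : Site D L) (R : ℕ) :
    (Finset.univ.filter fun y : Site D L => manhattan y x ≤ R).card ≤ (2 * R + 1) ^ D := by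
  have hsub : (Finset.univ.filter fun y : Site D L => manhattan y x ≤ R) ⊆
      Fintype.piFinset fun i =>
        Finset.univ.filter fun v : Fin L => ((v : ℤ) - (x i : ℤ)).natAbs ≤ R := by
    intro y hy
    rw [Fintype.mem_piFinset]
    intro i
    have h := (Finset.mem_filter.mp hy).2
    have h1 : ((y i : ℤ) - (x i : ℤ)).natAbs ≤ manhattan y x :=
      Finset.single_le_sum (f := fun i => ((y i : ℤ) - (x i : ℤ)).natAbs)
        (fun _ _ => Nat.zero_le _) (Finset.mem_univ i)
    simp only [Finset.mem_filter, Finset.mem_univ, true_and]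
    exact h1.trans h
  refine (Finset.card_le_card hsub).trans ?_
  rw [Fintype.card_piFinset]
  refine (Finset.prod_le_prod' fun i _ => ?_).trans (by simp : ∏ _i : Fin D, (2 * R + 1) ≤ _)
  have hcard : (Finset.Icc ((x i : ℤ) - R) ((x i : ℤ) + R)).card = 2 * R + 1 := by
    rw [Int.card_Icc]; omega
  rw [← hcard]
  refine Finset.card_le_card_of_injOn (fun v : Fin L => (v : ℤ)) (fun v hv => ?_)
    fun v _ w _ h => ?_
  · have h := (Finset.mem_filter.mp hv).2
    simp only [Finset.coe_Icc, Set.mem_Icc]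
    omega
  · exact Fin.ext (Int.ofNat_inj.mp h)

/-- A bound on the number of interaction terms that act on a given site. -/
def termsPerSite (D R : ℕ) : ℕ := 2 ^ ((2 * R + 1) ^ D)

/-- The regions with non-zero interaction term that meet `X`. -/
noncomputable def touching (h : Finset (Site D L) → Op D L) (X : Finset (Site D L)) :
    Finset (Finset (Site D L)) :=
  open Classical in Finset.univ.filter fun S => h S ≠ 0 ∧ ¬ Disjoint S X

lemma mem_touching {h : Finset (Site D L) → Op D L} {X S : Finset (Site D L)} :
    S ∈ touching h X ↔ h S ≠ 0 ∧ ¬ Disjoint S X := by simp [touching]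

lemma card_touching_le {k : Kind} {q R : ℕ} {h : Finset (Site D L) → Op D L}
    (hh : IsLocalInteraction k q R h) (X : Finset (Site D L)) :
    (touching h X).card ≤ X.card * termsPerSite D R := by
  classical
  have hsub : touching h X ⊆ X.biUnion fun x =>
      (Finset.univ.filter fun y : Site D L => manhattan y x ≤ R).powerset := by
    intro S hS
    obtain ⟨h0, hSX⟩ := mem_touching.mp hS
    obtain ⟨x, hxS, hxX⟩ := Finset.not_disjoint_iff.mp hSX
    rw [Finset.mem_biUnion]
    refine ⟨x, hxX, Finset.mem_powerset.mpr fun y hy => ?_⟩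
    simp only [Finset.mem_filter, Finset.mem_univ, true_and]
    have h1 : diam S < R := by
      by_contra hR
      exact h0 (hh.eq_zero_of_diam S (not_lt.mp hR))
    exact (manhattan_le_diam hy hxS).trans h1.le
  refine (Finset.card_le_card hsub).trans (Finset.card_biUnion_le.trans ?_)
  refine (Finset.sum_le_card_nsmul _ _ (termsPerSite D R) fun x _ => ?_).trans (by simp)
  rw [Finset.card_powerset, termsPerSite]
  exact Nat.pow_le_pow_right (by norm_num) (card_ball_le x R)

lemma commute_of_notMem_touching {k : Kind} {q R : ℕ} {h : Finset (Site D L) → Op D L}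
    (hh : IsLocalInteraction k q R h) {X S : Finset (Site D L)} {B : Op D L}
    (hB : B ∈ localAlgebra k X) (hS : S ∉ touching h X) : Commute (h S) B := by
  rw [mem_touching, not_and_or, not_not, not_not] at hS
  rcases hS with h0 | hd
  · rw [h0]; exact Commute.zero_left B
  · exact commute_of_disjoint hd (hh.mem_termAlgebra S) hB

lemma hamiltonian_isHermitian {k : Kind} {q R : ℕ} {h : Finset (Site D L) → Op D L}
    (hh : IsLocalInteraction k q R h) : (hamiltonian h).IsHermitian := by
  rw [Matrix.IsHermitian, hamiltonian, Matrix.conjTranspose_sum]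
  exact Finset.sum_congr rfl fun S _ => hh.isHermitian S

lemma patchHamiltonian_isHermitian {k : Kind} {q R : ℕ} {h : Finset (Site D L) → Op D L}
    (hh : IsLocalInteraction k q R h) (X : Finset (Site D L)) (r : ℕ) :
    (patchHamiltonian h X r).IsHermitian := by
  rw [Matrix.IsHermitian, patchHamiltonian, Matrix.conjTranspose_sum]
  exact Finset.sum_congr rfl fun S _ => hh.isHermitian S

open scoped Matrix.Norms.L2Operator in
/-- The commutator of the Hamiltonian with a local observable is bounded independently of the size
of the lattice. -/
lemma opNorm_commutator_le {k : Kind} {q R : ℕ} {h : Finset (Site D L) → Op D L}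
    (hh : IsLocalInteraction k q R h) {X : Finset (Site D L)} {B : Op D L}
    (hB : B ∈ localAlgebra k X) (hB1 : opNorm B ≤ 1) :
    opNorm (hamiltonian h * B - B * hamiltonian h) ≤ 2 * (X.card * termsPerSite D R : ℕ) := by
  have h1 : hamiltonian h * B - B * hamiltonian h =
      ∑ S ∈ touching h X, (h S * B - B * h S) := by
    rw [hamiltonian, Finset.sum_mul, Finset.mul_sum, ← Finset.sum_sub_distrib]
    refine (Finset.sum_subset (Finset.subset_univ _) fun S _ hS => ?_).symm
    rw [(commute_of_notMem_touching hh hB hS).eq, sub_self]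
  have h2 (S : Finset (Site D L)) : ‖h S * B - B * h S‖ ≤ 2 := by
    have h3 : ‖h S‖ ≤ 1 := hh.opNorm_le S
    have h4 : ‖B‖ ≤ 1 := hB1
    calc ‖h S * B - B * h S‖ ≤ ‖h S * B‖ + ‖B * h S‖ := norm_sub_le _ _
      _ ≤ ‖h S‖ * ‖B‖ + ‖B‖ * ‖h S‖ := add_le_add (norm_mul_le _ _) (norm_mul_le _ _)
      _ ≤ 1 * 1 + 1 * 1 := by gcongr
      _ = 2 := by norm_num
  change ‖hamiltonian h * B - B * hamiltonian h‖ ≤ _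
  rw [h1]
  refine (norm_sum_le_of_le _ fun S _ => h2 S).trans ?_
  rw [Finset.sum_const, nsmul_eq_mul, mul_comm]
  have := card_touching_le hh X
  gcongr

end Counting

/-! ### Gapped ground states and time averages -/

section Gapped

variable {Q : Type} [Fintype Q] [DecidableEq Q]

lemma exp_mulVec_of_mulVec_eq {X : Matrix Q Q ℂ} {φ : Q → ℂ} {a : ℂ} (h : X *ᵥ φ = a • φ) :
    NormedSpace.exp X *ᵥ φ = Complex.exp a • φ := by
  have hpow (n : ℕ) : X ^ n *ᵥ φ = a ^ n • φ := by
    induction n with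
    | zero => simp
    | succ n ih => rw [pow_succ, ← Matrix.mulVec_mulVec, h, Matrix.mulVec_smul, ih, smul_smul,
        pow_succ, mul_comm]
  let f : Matrix Q Q ℂ →+ (Q → ℂ) := ⟨⟨fun M => M *ᵥ φ, Matrix.zero_mulVec φ⟩,
    fun M N => Matrix.add_mulVec M N φ⟩
  have hf : Continuous f := Continuous.matrix_mulVec continuous_id continuous_const
  have hX : HasSum (fun n : ℕ => ((n.factorial : ℂ)⁻¹) • X ^ n) (NormedSpace.exp X) := by
    open scoped Matrix.Norms.L2Operator in
    exact NormedSpace.exp_series_hasSum_exp' (𝕂 := ℂ) X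
  have h1 := hX.map f hf
  have h2 : HasSum (fun n : ℕ => (((n.factorial : ℂ)⁻¹) • a ^ n) • φ) (Complex.exp a • φ) := by
    have := (NormedSpace.exp_series_hasSum_exp' (𝕂 := ℂ) a).smul_const φ
    rwa [← Complex.exp_eq_exp_ℂ] at this
  refine h1.unique (h2.congr_fun ?_)
  intro n
  change (((n.factorial : ℂ)⁻¹) • X ^ n) *ᵥ φ = _
  rw [Matrix.smul_mulVec, hpow, smul_smul, smul_eq_mul]

lemma evolution_mulVec_of_mulVec_eq {H : Matrix Q Q ℂ} {φ : Q → ℂ} {E : ℝ}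
    (h : H *ᵥ φ = (E : ℂ) • φ) (t : ℝ) :
    evolution H t *ᵥ φ = Complex.exp (((E * t : ℝ) : ℂ) * Complex.I) • φ := by
  refine exp_mulVec_of_mulVec_eq ?_
  rw [Matrix.smul_mulVec, h, smul_smul]
  congr 1
  push_cast
  ring

/-- The coordinates of `v` in the eigenbasis of `H`. -/
noncomputable def energyCoord {H : Matrix Q Q ℂ} (hH : H.IsHermitian) (v : Q → ℂ) (i : Q) : ℂ :=
  star (hH.eigenvectorBasis i).ofLp ⬝ᵥ v

variable {H : Matrix Q Q ℂ} (hH : H.IsHermitian)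

lemma vnorm_energyCoord (v : Q → ℂ) : vnorm (energyCoord hH v) = vnorm v := by
  refine (sq_eq_sq₀ (vnorm_nonneg _) (vnorm_nonneg _)).mp ?_
  have h := hH.eigenvectorBasis.sum_sq_norm_inner_right (WithLp.toLp 2 v)
  rw [vnorm_sq]
  refine Eq.trans (Finset.sum_congr rfl fun i _ => ?_) h
  rw [EuclideanSpace.inner_eq_star_dotProduct, dotProduct_comm]
  rfl

lemma vnorm_le_of_energyCoord_le {u v w : Q → ℂ} {a c : ℝ} (ha : 0 ≤ a) (hc : 0 ≤ c)
    (h : ∀ i, ‖energyCoord hH u i‖ ≤ a * ‖energyCoord hH v i‖ + c * ‖energyCoord hH w i‖) :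
    vnorm u ≤ a * vnorm v + c * vnorm w := by
  have habs (x : Q → ℂ) : vnorm (fun i => ((‖x i‖ : ℝ) : ℂ)) = vnorm x := by
    refine (sq_eq_sq₀ (vnorm_nonneg _) (vnorm_nonneg _)).mp ?_
    simp [vnorm_sq]
  have h1 := vnorm_add_le ((a : ℂ) • fun i => ((‖energyCoord hH v i‖ : ℝ) : ℂ))
    ((c : ℂ) • fun i => ((‖energyCoord hH w i‖ : ℝ) : ℂ))
  rw [vnorm_smul, vnorm_smul, habs, habs, vnorm_energyCoord, vnorm_energyCoord, Complex.norm_real,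
    Complex.norm_real, Real.norm_of_nonneg ha, Real.norm_of_nonneg hc] at h1
  refine le_trans ?_ h1
  rw [← vnorm_energyCoord hH u]
  refine vnorm_mono fun i => (h i).trans (le_of_eq ?_)
  have : ((a : ℂ) • (fun i => ((‖energyCoord hH v i‖ : ℝ) : ℂ)) +
      (c : ℂ) • fun i => ((‖energyCoord hH w i‖ : ℝ) : ℂ)) i =
      ((a * ‖energyCoord hH v i‖ + c * ‖energyCoord hH w i‖ : ℝ) : ℂ) := by
    simp
  rw [this, Complex.norm_real, Real.norm_of_nonneg (by positivity)]

lemma energyCoord_mulVec (v : Q → ℂ) (i : Q) :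
    energyCoord hH (H *ᵥ v) i = hH.eigenvalues i * energyCoord hH v i := by
  have h := hH.mulVec_eigenvectorBasis i
  rw [energyCoord, Matrix.dotProduct_mulVec]
  have h1 : star (hH.eigenvectorBasis i).ofLp ᵥ* H =
      star (H *ᵥ (hH.eigenvectorBasis i).ofLp) := by
    rw [Matrix.star_mulVec, hH.eq]
  rw [h1, h, star_smul, smul_dotProduct]
  simp [energyCoord]

lemma energyCoord_evolution_mulVec (t : ℝ) (v : Q → ℂ) (i : Q) :
    energyCoord hH (evolution H t *ᵥ v) i =
      Complex.exp (((hH.eigenvalues i * t : ℝ) : ℂ) * Complex.I) * energyCoord hH v i := by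
  have h := evolution_mulVec_of_mulVec_eq (E := hH.eigenvalues i)
    (hH.mulVec_eigenvectorBasis i) (-t)
  have h1 : star (hH.eigenvectorBasis i).ofLp ᵥ* evolution H t =
      star (evolution H (-t) *ᵥ (hH.eigenvectorBasis i).ofLp) := by
    rw [Matrix.star_mulVec, evolution_neg hH, Matrix.conjTranspose_conjTranspose]
  rw [energyCoord, Matrix.dotProduct_mulVec, h1, h, star_smul, smul_dotProduct, smul_eq_mul,
    energyCoord, Complex.star_def, ← Complex.exp_conj]
  congr 2
  simp

lemma energyCoord_smul (c : ℂ) (v : Q → ℂ) (i : Q) :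
    energyCoord hH (c • v) i = c * energyCoord hH v i := by
  simp [energyCoord, dotProduct_smul]

lemma energyCoord_sub (v w : Q → ℂ) (i : Q) :
    energyCoord hH (v - w) i = energyCoord hH v i - energyCoord hH w i := by
  simp [energyCoord, dotProduct_sub]

/-- Every vector of the eigenbasis is either a multiple of the ground state or orthogonal to it and
above the gap. -/
lemma eigenvector_dichotomy {Δ E₀ : ℝ} (hΔ : 0 < Δ) {ψ : Q → ℂ} (hψ : star ψ ⬝ᵥ ψ = 1)
    (hE : H *ᵥ ψ = (E₀ : ℂ) • ψ)
    (hgap : ∀ (E : ℝ) (φ : Q → ℂ), φ ≠ 0 → H *ᵥ φ = (E : ℂ) • φ → star ψ ⬝ᵥ φ = 0 → E₀ + Δ ≤ E)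
    (i : Q) :
    (hH.eigenvalues i = E₀ ∧ ∃ c : ℂ, (hH.eigenvectorBasis i).ofLp = c • ψ) ∨
      (E₀ + Δ ≤ hH.eigenvalues i ∧ energyCoord hH ψ i = 0) := by
  set φ := (hH.eigenvectorBasis i).ofLp with hφ
  have hb : H *ᵥ φ = (hH.eigenvalues i : ℂ) • φ := hH.mulVec_eigenvectorBasis i
  by_cases hi : hH.eigenvalues i = E₀
  · refine Or.inl ⟨hi, star ψ ⬝ᵥ φ, ?_⟩
    by_contra hne
    have h1 := hgap E₀ (φ - (star ψ ⬝ᵥ φ) • ψ) (sub_ne_zero.mpr hne) (by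
      rw [Matrix.mulVec_sub, Matrix.mulVec_smul, hb, hE, hi, smul_sub, smul_comm]) (by
      rw [dotProduct_sub, dotProduct_smul, hψ, smul_eq_mul, mul_one, sub_self])
    linarith
  · have h0 : energyCoord hH ψ i = 0 := by
      have h1 := energyCoord_mulVec hH ψ i
      rw [hE, energyCoord_smul] at h1
      have h2 : ((E₀ - hH.eigenvalues i : ℝ) : ℂ) * energyCoord hH ψ i = 0 := by
        push_cast
        rw [sub_mul, h1, sub_self]
      refine (mul_eq_zero.mp h2).resolve_left ?_
      exact Complex.ofReal_ne_zero.mpr (sub_ne_zero.mpr (Ne.symm hi))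
    refine Or.inr ⟨hgap _ φ ?_ hb ?_, h0⟩
    · intro hzero
      have h1 := hH.eigenvectorBasis.orthonormal.1 i
      have h2 : hH.eigenvectorBasis i = 0 := by
        rw [← WithLp.ofLp_eq_zero 2]
        exact hzero
      rw [h2, norm_zero] at h1
      exact zero_ne_one h1
    · have : star (energyCoord hH ψ i) = star ψ ⬝ᵥ φ := by
        rw [energyCoord, ← Matrix.star_dotProduct]
      rw [← this, h0, star_zero]

/-- In the energy basis, `B ψ` minus its ground state component lives above the gap, where the
commutator `[H, B]` multiplies it by the excitation energy. -/
lemma energyCoord_dichotomy {Δ E₀ : ℝ} (hΔ : 0 < Δ) {ψ : Q → ℂ} (hψ : star ψ ⬝ᵥ ψ = 1)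
    (hE : H *ᵥ ψ = (E₀ : ℂ) • ψ)
    (hgap : ∀ (E : ℝ) (φ : Q → ℂ), φ ≠ 0 → H *ᵥ φ = (E : ℂ) • φ → star ψ ⬝ᵥ φ = 0 → E₀ + Δ ≤ E)
    (B : Matrix Q Q ℂ) (i : Q) :
    (hH.eigenvalues i = E₀ ∧
        energyCoord hH (B *ᵥ ψ) i = (star ψ ⬝ᵥ (B *ᵥ ψ)) * energyCoord hH ψ i) ∨
      (Δ ≤ hH.eigenvalues i - E₀ ∧ energyCoord hH ψ i = 0 ∧
        energyCoord hH ((H * B - B * H) *ᵥ ψ) i =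
          ((hH.eigenvalues i - E₀ : ℝ) : ℂ) * energyCoord hH (B *ᵥ ψ) i) := by
  rcases eigenvector_dichotomy hH hΔ hψ hE hgap i with ⟨h1, c, hc⟩ | ⟨h1, h2⟩
  · refine Or.inl ⟨h1, ?_⟩
    rw [energyCoord, energyCoord, hc, star_smul, smul_dotProduct, smul_dotProduct, hψ]
    simp [mul_comm]
  · refine Or.inr ⟨by linarith, h2, ?_⟩
    rw [Matrix.sub_mulVec, ← Matrix.mulVec_mulVec, ← Matrix.mulVec_mulVec, hE, Matrix.mulVec_smul,
      energyCoord_sub, energyCoord_mulVec, energyCoord_smul]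
    push_cast
    ring

/-- An observable with small commutator with `H` almost preserves the gapped ground state. -/
lemma gap_mul_vnorm_le (hH : H.IsHermitian) {Δ : ℝ} (hΔ : 0 < Δ) {ψ : Q → ℂ}
    (h : IsGappedGroundState H Δ ψ) (B : Matrix Q Q ℂ) :
    Δ * vnorm (B *ᵥ ψ - (star ψ ⬝ᵥ (B *ᵥ ψ)) • ψ) ≤ vnorm ((H * B - B * H) *ᵥ ψ) := by
  obtain ⟨hψ, E₀, hE, hgap⟩ := h
  have h1 := vnorm_le_of_energyCoord_le hH (u := (Δ : ℂ) • (B *ᵥ ψ - (star ψ ⬝ᵥ (B *ᵥ ψ)) • ψ))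
    (v := 0) (w := (H * B - B * H) *ᵥ ψ) (a := 0) (c := 1) le_rfl zero_le_one fun i => by
      rw [energyCoord_smul, energyCoord_sub, energyCoord_smul]
      rcases energyCoord_dichotomy hH hΔ hψ hE hgap B i with ⟨-, h2⟩ | ⟨h1, h2, h3⟩
      · rw [h2, sub_self, mul_zero, norm_zero]; positivity
      · rw [h2, h3, mul_zero, sub_zero, norm_mul, norm_mul, Complex.norm_real, Complex.norm_real,
          Real.norm_of_nonneg hΔ.le, Real.norm_of_nonneg (hΔ.le.trans h1)]
        nlinarith [norm_nonneg (energyCoord hH (B *ᵥ ψ) i)]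
  rw [vnorm_smul, Complex.norm_real, Real.norm_of_nonneg hΔ.le] at h1
  linarith

variable {J : Type} [Fintype J] [Nonempty J]

/-- The frequency response of the time average over the times `t j`. -/
noncomputable def response (t : J → ℝ) (ω : ℝ) : ℂ :=
  (Fintype.card J : ℂ)⁻¹ * ∑ j, Complex.exp (((ω * t j : ℝ) : ℂ) * Complex.I)

lemma energyCoord_timeAverage_mulVec {E₀ : ℝ} {ψ : Q → ℂ} (hE : H *ᵥ ψ = (E₀ : ℂ) • ψ)
    (A : Matrix Q Q ℂ) (t : J → ℝ) (i : Q) :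
    energyCoord hH (timeAverage H A t *ᵥ ψ) i =
      response t (hH.eigenvalues i - E₀) * energyCoord hH (A *ᵥ ψ) i := by
  have hj (j : J) : energyCoord hH ((evolution H (t j) * A * evolution H (-t j)) *ᵥ ψ) i =
      Complex.exp ((((hH.eigenvalues i - E₀) * t j : ℝ) : ℂ) * Complex.I) *
        energyCoord hH (A *ᵥ ψ) i := by
    rw [← Matrix.mulVec_mulVec, ← Matrix.mulVec_mulVec, evolution_mulVec_of_mulVec_eq hE,
      Matrix.mulVec_smul, Matrix.mulVec_smul, energyCoord_smul, energyCoord_evolution_mulVec,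
      ← mul_assoc, ← Complex.exp_add]
    congr 2
    push_cast
    ring
  rw [timeAverage, Matrix.smul_mulVec, energyCoord_smul, Matrix.sum_mulVec, response, mul_assoc,
    Finset.sum_mul]
  congr 1
  rw [← Finset.sum_congr rfl fun j _ => hj j]
  simp only [energyCoord, dotProduct_sum]

lemma response_zero (t : J → ℝ) : response t 0 = 1 := by
  simp [response]

/-- The gapped ground state is an approximate eigenvector of the time-averaged observable, if the
time average suppresses the frequencies from the gap up to the energy scale of `[H, A]`. -/
lemma vnorm_timeAverage_mulVec_sub_le (hH : H.IsHermitian) {Δ : ℝ} (hΔ : 0 < Δ) {ψ : Q → ℂ}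
    (h : IsGappedGroundState H Δ ψ) {A : Matrix Q Q ℂ} (hA : A.IsHermitian) (hA1 : opNorm A ≤ 1)
    (t : J → ℝ) {η₁ Ω : ℝ} (hη₁ : 0 ≤ η₁) (hΩ : 0 < Ω)
    (hF : ∀ ω, Δ ≤ ω → ‖response t ω‖ ≤ η₁ + ω / Ω) :
    vnorm (timeAverage H A t *ᵥ ψ - (expectation A ψ : ℂ) • ψ) ≤
      η₁ + opNorm (H * A - A * H) / Ω := by
  obtain ⟨hψ, E₀, hE, hgap⟩ := h
  have hψ1 := vnorm_eq_one hψ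
  have hexp : star ψ ⬝ᵥ (A *ᵥ ψ) = (expectation A ψ : ℂ) := by
    have : star (star ψ ⬝ᵥ (A *ᵥ ψ)) = star ψ ⬝ᵥ (A *ᵥ ψ) := by
      rw [← Matrix.star_dotProduct, Matrix.star_mulVec, hA.eq, Matrix.dotProduct_mulVec]
    exact (Complex.conj_eq_iff_re.mp this).symm
  have h1 := vnorm_le_of_energyCoord_le hH (v := A *ᵥ ψ) (w := (H * A - A * H) *ᵥ ψ)
    (u := timeAverage H A t *ᵥ ψ - (expectation A ψ : ℂ) • ψ) hη₁ (inv_nonneg.mpr hΩ.le)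
    fun i => by
      rw [energyCoord_sub, energyCoord_smul, energyCoord_timeAverage_mulVec hH hE]
      rcases energyCoord_dichotomy hH hΔ hψ hE hgap A i with ⟨h1, h2⟩ | ⟨h1, h2, h3⟩
      · rw [h1, sub_self, response_zero, one_mul, h2, hexp, sub_self, norm_zero]; positivity
      · have h4 := hF _ h1
        rw [h2, h3, mul_zero, sub_zero, norm_mul, norm_mul, Complex.norm_real,
          Real.norm_of_nonneg (hΔ.le.trans h1)]
        have h5 := mul_le_mul_of_nonneg_right h4 (norm_nonneg (energyCoord hH (A *ᵥ ψ) i))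
        refine h5.trans (le_of_eq ?_)
        rw [div_eq_inv_mul]
        ring
  have h2 := vnorm_mulVec_le A ψ
  have h3 := vnorm_mulVec_le (H * A - A * H) ψ
  rw [hψ1, mul_one] at h2 h3
  refine h1.trans (add_le_add ?_ ?_)
  · nlinarith
  · rw [div_eq_inv_mul]
    exact mul_le_mul_of_nonneg_left h3 (inv_nonneg.mpr hΩ.le)

end Gapped

section Filter

/-- The call times: sums of `n` multiples `0, τ, …, (M - 1) τ` of the time step. -/
def callTime (n M : ℕ) (τ : ℝ) (j : Fin n → Fin M) : ℝ := τ * (∑ i, (j i : ℕ) : ℕ)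

lemma response_callTime (n M : ℕ) (τ ω : ℝ) :
    response (callTime n M τ) ω =
      ((M : ℂ)⁻¹ * ∑ m ∈ Finset.range M, Complex.exp (((ω * τ : ℝ) : ℂ) * Complex.I) ^ m) ^ n := by
  rw [response, mul_pow, Finset.sum_range]
  have h := sum_pi_prod fun (_ : Fin n) (m : Fin M) =>
    Complex.exp (((ω * τ : ℝ) : ℂ) * Complex.I) ^ (m : ℕ)
  rw [Finset.prod_const, Finset.card_univ, Fintype.card_fin] at h
  rw [← h]
  congr 1
  · simp
  · refine Finset.sum_congr rfl fun j _ => ?_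
    rw [Finset.prod_pow_eq_pow_sum, ← Complex.exp_nat_mul, callTime]
    congr 1
    push_cast
    ring

lemma norm_response_le_one {J : Type} [Fintype J] [Nonempty J] (t : J → ℝ) (ω : ℝ) :
    ‖response t ω‖ ≤ 1 := by
  have h0 : (0 : ℝ) < Fintype.card J := by exact_mod_cast Fintype.card_pos
  rw [response, norm_mul, norm_inv, Complex.norm_natCast, inv_mul_le_iff₀ h0, mul_one]
  refine (norm_sum_le _ _).trans (le_of_eq ?_)
  simp only [Complex.norm_exp_ofReal_mul_I, Finset.sum_const, Finset.card_univ, nsmul_eq_mul,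
    mul_one]

/-- The geometric mean over `M` equidistant times suppresses all frequencies between `Δ` and
`π / τ`, if the times extend to `2π / Δ`. -/
lemma norm_response_callTime_le {n M : ℕ} {τ Δ ω : ℝ} (hτ : 0 < τ) (hΔ : 0 < Δ)
    (hM : 2 * Real.pi ≤ M * (Δ * τ)) (hω : Δ ≤ ω) (hωτ : ω * τ ≤ Real.pi) :
    ‖response (callTime n M τ) ω‖ ≤ (1 / 2) ^ n := by
  rw [response_callTime, norm_pow]
  refine pow_le_pow_left₀ (norm_nonneg _) ?_ n
  set θ := ω * τ
  have hpi := Real.pi_pos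
  have hθ : Δ * τ ≤ θ := by simp only [θ]; gcongr
  have hθ0 : 0 < θ := lt_of_lt_of_le (by positivity) hθ
  set z := Complex.exp ((θ : ℂ) * Complex.I)
  have hz : ‖z‖ = 1 := Complex.norm_exp_ofReal_mul_I θ
  have h1 : 2 * θ / Real.pi ≤ ‖z - 1‖ := by
    have h2 : ‖z - 1‖ = ‖2 * Real.sin (θ / 2)‖ := by
      simp only [z]
      rw [mul_comm]
      exact Complex.norm_exp_I_mul_ofReal_sub_one θ
    have h3 := Real.mul_le_sin (x := θ / 2) (by positivity) (by linarith)
    rw [h2, Real.norm_eq_abs]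
    refine le_trans ?_ (le_abs_self _)
    calc 2 * θ / Real.pi = 2 * (2 / Real.pi * (θ / 2)) := by ring
      _ ≤ _ := by linarith
  have h4 : ‖∑ m ∈ Finset.range M, z ^ m‖ * ‖z - 1‖ ≤ 2 := by
    rw [← norm_mul, geom_sum_mul]
    refine (norm_sub_le _ _).trans ?_
    rw [norm_pow, hz]
    norm_num
  have hM0 : (0 : ℝ) < M := by
    by_contra hM0
    have h5 : (M : ℝ) * (Δ * τ) ≤ 0 :=
      mul_nonpos_of_nonpos_of_nonneg (not_lt.mp hM0) (by positivity)
    linarith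
  rw [norm_mul, norm_inv, Complex.norm_natCast, inv_mul_le_iff₀ hM0]
  have h5 : ‖∑ m ∈ Finset.range M, z ^ m‖ * (2 * θ / Real.pi) ≤ 2 :=
    (mul_le_mul_of_nonneg_left h1 (norm_nonneg _)).trans h4
  have h6 : ‖∑ m ∈ Finset.range M, z ^ m‖ * θ ≤ Real.pi := by
    rw [mul_div_assoc', div_le_iff₀ hpi] at h5
    linarith
  have h7 : 2 * Real.pi ≤ M * θ := hM.trans (by gcongr)
  by_contra hlt
  push Not at hlt
  nlinarith

end Filter

section GapBound

variable {D L : ℕ}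

/-- The gap of a local Hamiltonian is bounded, because a local operator that moves the ground state
has a bounded energy cost. -/
lemma gap_le {k : Kind} {q R : ℕ} {h : Finset (Site D L) → Op D L}
    (hh : IsLocalInteraction k q R h) {Δ : ℝ} (hΔ : 0 < Δ) {ψ : Config D L → ℂ}
    (hψ : IsGappedGroundState (hamiltonian h) Δ ψ) (x : Site D L) :
    Δ ≤ 18 * termsPerSite D R := by
  obtain ⟨c, d, hc, hd, hcd, hcc, hdd, hsum⟩ := exists_lowering_operator k x
  have hψ1 := vnorm_eq_one hψ.1
  have hdc : c = dᴴ := by rw [hcd, Matrix.conjTranspose_conjTranspose]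
  have hsq (a b : Op D L) (hab : a = bᴴ) (v : Config D L → ℂ) :
      ((vnorm (a *ᵥ v) ^ 2 : ℝ) : ℂ) = star v ⬝ᵥ ((b * a) *ᵥ v) := by
    rw [← star_dotProduct_self, Matrix.star_mulVec, hab, Matrix.conjTranspose_conjTranspose,
      Matrix.dotProduct_mulVec, Matrix.vecMul_vecMul, Matrix.dotProduct_mulVec]
  have hnorm (v : Config D L → ℂ) : vnorm (c *ᵥ v) ^ 2 + vnorm (d *ᵥ v) ^ 2 = vnorm v ^ 2 := by
    have h1 : ((vnorm (c *ᵥ v) ^ 2 + vnorm (d *ᵥ v) ^ 2 : ℝ) : ℂ) = ((vnorm v ^ 2 : ℝ) : ℂ) := by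
      rw [Complex.ofReal_add, hsq c d hdc, hsq d c hcd, ← dotProduct_add, ← Matrix.add_mulVec,
        add_comm, hsum, Matrix.one_mulVec, star_dotProduct_self]
    exact_mod_cast h1
  have hle (a : Op D L) (ha : ∀ v, vnorm (a *ᵥ v) ^ 2 ≤ vnorm v ^ 2) : opNorm a ≤ 1 :=
    opNorm_le_of_vnorm_le zero_le_one fun v => by
      rw [one_mul]
      exact (abs_le_of_sq_le_sq' (ha v) (vnorm_nonneg v)).2
  have hc1 : opNorm c ≤ 1 := hle c fun v => by nlinarith [hnorm v, sq_nonneg (vnorm (d *ᵥ v))]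
  have hd1 : opNorm d ≤ 1 := hle d fun v => by nlinarith [hnorm v, sq_nonneg (vnorm (c *ᵥ v))]
  -- if the gap were too large, `a ψ` would be almost proportional to `ψ`, hence almost zero
  have hsmall (a : Op D L) (ha : a ∈ localAlgebra k {x}) (ha1 : opNorm a ≤ 1) (haa : a * a = 0)
      (hbig : 18 * termsPerSite D R < Δ) : vnorm (a *ᵥ ψ) ^ 2 ≤ 38 / 81 := by
    have h1 := gap_mul_vnorm_le (hamiltonian_isHermitian hh) hΔ hψ a
    have h2 := opNorm_commutator_le hh ha ha1
    have h3 := vnorm_mulVec_le (hamiltonian h * a - a * hamiltonian h) ψ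
    rw [hψ1, mul_one] at h3
    simp only [Finset.card_singleton, one_mul] at h2
    set μ := star ψ ⬝ᵥ (a *ᵥ ψ)
    set e := a *ᵥ ψ - μ • ψ with he
    have hs : vnorm e ≤ 1 / 9 := by
      by_contra hlt
      push Not at hlt
      nlinarith
    have hμ1 : ‖μ‖ ≤ 1 := by
      refine (norm_dotProduct_le _ _).trans ?_
      have := vnorm_mulVec_le a ψ
      rw [hψ1, mul_one] at this
      rw [hψ1, one_mul]
      exact this.trans ha1
    have hμψ : (μ * μ) • ψ = -(μ • e + a *ᵥ e) := by
      have h4 : a *ᵥ (a *ᵥ ψ) = 0 := by rw [Matrix.mulVec_mulVec, haa, Matrix.zero_mulVec]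
      have h5 : a *ᵥ ψ = μ • ψ + e := by rw [he]; abel
      have h6 : a *ᵥ e = -(μ • (a *ᵥ ψ)) := by
        rw [he, Matrix.mulVec_sub, h4, Matrix.mulVec_smul, zero_sub]
      rw [h6, h5, smul_add, smul_smul]
      abel
    have hμ2 : ‖μ‖ ^ 2 ≤ 2 / 9 := by
      have h4 : vnorm ((μ * μ) • ψ) = ‖μ‖ ^ 2 := by
        rw [vnorm_smul, hψ1, norm_mul]; ring
      have h5 : vnorm (-(μ • e + a *ᵥ e)) ≤ ‖μ‖ * vnorm e + opNorm a * vnorm e := by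
        rw [← neg_one_smul ℂ, vnorm_smul, norm_neg, norm_one, one_mul]
        refine (vnorm_add_le _ _).trans (add_le_add (le_of_eq (vnorm_smul _ _)) ?_)
        exact vnorm_mulVec_le _ _
      rw [← h4, hμψ]
      nlinarith [vnorm_nonneg e]
    have h7 : vnorm (a *ᵥ ψ) ≤ ‖μ‖ + vnorm e := by
      have h8 : a *ᵥ ψ = μ • ψ + e := by rw [he]; abel
      rw [h8]
      refine (vnorm_add_le _ _).trans ?_
      rw [vnorm_smul, hψ1, mul_one]
    have h9 : vnorm (a *ᵥ ψ) ^ 2 ≤ (‖μ‖ + vnorm e) ^ 2 :=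
      pow_le_pow_left₀ (vnorm_nonneg _) h7 2
    nlinarith [vnorm_nonneg e, sq_nonneg (‖μ‖ - vnorm e)]
  by_contra hlt
  push Not at hlt
  have h1 := hsmall c hc hc1 hcc hlt
  have h2 := hsmall d hd hd1 hdd hlt
  have h3 := hnorm ψ
  rw [hψ1] at h3
  linarith

end GapBound

/-! ### Locality of Heisenberg evolution -/

section Heisenberg

variable {Q : Type} [Fintype Q] [DecidableEq Q]

/-- The Heisenberg-evolved observable `e^{iHt} B e^{-iHt}`. -/
noncomputable def heisenbergOp (H : Matrix Q Q ℂ) (t : ℝ) (B : Matrix Q Q ℂ) : Matrix Q Q ℂ :=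
  evolution H t * B * evolution H (-t)

open scoped Matrix.Norms.L2Operator

lemma opNorm_le_one_of_mem_unitaryGroup {U : Matrix Q Q ℂ}
    (hU : U ∈ Matrix.unitaryGroup Q ℂ) : ‖U‖ ≤ 1 :=
  opNorm_le_of_vnorm_le zero_le_one fun v => by
    rw [vnorm_mulVec_of_unitary hU, one_mul]

lemma evolution_neg_mul_self {H : Matrix Q Q ℂ} (hH : H.IsHermitian) (t : ℝ) :
    evolution H (-t) * evolution H t = 1 := by
  rw [evolution_neg hH]
  exact Matrix.mem_unitaryGroup_iff'.mp (evolution_mem_unitaryGroup hH t)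

lemma norm_evolution_le {H : Matrix Q Q ℂ} (hH : H.IsHermitian) (t : ℝ) : ‖evolution H t‖ ≤ 1 :=
  opNorm_le_one_of_mem_unitaryGroup (evolution_mem_unitaryGroup hH t)

lemma norm_heisenbergOp_le {H : Matrix Q Q ℂ} (hH : H.IsHermitian) (t : ℝ) (B : Matrix Q Q ℂ) :
    ‖heisenbergOp H t B‖ ≤ ‖B‖ := by
  refine (norm_mul_le _ _).trans ?_
  have h1 := (norm_mul_le (evolution H t) B).trans
    (mul_le_mul_of_nonneg_right (norm_evolution_le hH t) (norm_nonneg B))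
  rw [one_mul] at h1
  calc _ ≤ ‖B‖ * 1 := mul_le_mul h1 (norm_evolution_le hH (-t)) (norm_nonneg _) (norm_nonneg _)
    _ = ‖B‖ := mul_one _

lemma evolution_eq_exp_smul (H : Matrix Q Q ℂ) (t : ℝ) :
    evolution H t = NormedSpace.exp (t • (Complex.I • H)) := by
  rw [evolution, mul_comm, ← smul_smul]
  rfl

lemma hasDerivAt_evolution (H : Matrix Q Q ℂ) (t : ℝ) :
    HasDerivAt (fun s => evolution H s) (evolution H t * (Complex.I • H)) t := by
  simp only [evolution_eq_exp_smul]
  exact hasDerivAt_exp_smul_const (𝕂 := ℝ) (Complex.I • H) t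

lemma hasDerivAt_evolution_neg (H : Matrix Q Q ℂ) (t : ℝ) :
    HasDerivAt (fun s => evolution H (-s)) (-((Complex.I • H) * evolution H (-t))) t := by
  have h : HasDerivAt (fun s => evolution H s) ((Complex.I • H) * evolution H (-t)) (-t) := by
    simp only [evolution_eq_exp_smul]
    exact hasDerivAt_exp_smul_const' (𝕂 := ℝ) (Complex.I • H) (-t)
  have h1 := h.scomp t (hasDerivAt_neg t)
  rwa [neg_one_smul] at h1

lemma commute_evolution {K O : Matrix Q Q ℂ} (h : Commute K O) (t : ℝ) :
    Commute (evolution K t) O :=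
  ((h.symm.smul_right _).exp_right).symm

/-- If two Hamiltonians act on `O` through the same terms `G`, their Heisenberg evolutions of `O`
differ only as far as the evolutions of `G` do. -/
lemma norm_heisenbergOp_sub_le {H₁ H₂ G O : Matrix Q Q ℂ} (h₁ : H₁.IsHermitian)
    (h₂ : H₂.IsHermitian) (hG : G.IsHermitian) (hO₁ : Commute (H₁ - G) O)
    (hO₂ : Commute (H₂ - G) O) {t K : ℝ} {k : ℕ} (ht : 0 ≤ t)
    (hK : ∀ s, 0 ≤ s → ‖heisenbergOp H₁ s G - heisenbergOp H₂ s G‖ ≤ K * (s ^ k / k.factorial)) :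
    ‖heisenbergOp H₁ t O - heisenbergOp H₂ t O‖ ≤
      2 * ‖O‖ * (K * (t ^ (k + 1) / (k + 1).factorial)) := by
  -- the evolutions in the interaction picture with respect to `H₁ - G` and `H₂ - G`
  set U₁ : ℝ → Matrix Q Q ℂ := fun s => evolution H₁ s * evolution (H₁ - G) (-s) with hU₁
  set U₂ : ℝ → Matrix Q Q ℂ := fun s => evolution H₂ s * evolution (H₂ - G) (-s) with hU₂
  set P : ℝ → Matrix Q Q ℂ := fun s => evolution (H₂ - G) s * evolution H₂ (-s) with hP
  have hinv {H : Matrix Q Q ℂ} (hH : H.IsHermitian) (s : ℝ) :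
      evolution H s * evolution H (-s) = 1 := by
    have := evolution_neg_mul_self hH (-s)
    rwa [neg_neg] at this
  have hd₁ (s : ℝ) : HasDerivAt U₁
      (evolution H₁ s * (Complex.I • G) * evolution (H₁ - G) (-s)) s := by
    refine ((hasDerivAt_evolution H₁ s).mul (hasDerivAt_evolution_neg (H₁ - G) s)).congr_deriv ?_
    rw [mul_neg, ← sub_eq_add_neg, ← mul_assoc, ← sub_mul, ← mul_sub, ← smul_sub, sub_sub_cancel]
  have hdP (s : ℝ) : HasDerivAt P
      (-(evolution (H₂ - G) s * (Complex.I • G) * evolution H₂ (-s))) s := by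
    refine ((hasDerivAt_evolution (H₂ - G) s).mul (hasDerivAt_evolution_neg H₂ s)).congr_deriv ?_
    rw [mul_neg, ← sub_eq_add_neg, ← mul_assoc, ← sub_mul, ← mul_sub, ← smul_sub,
      sub_sub_cancel_left, smul_neg, mul_neg, neg_mul]
  have hPU (s : ℝ) : P s * U₂ s = 1 := by
    simp only [hP, hU₂]
    rw [mul_assoc, ← mul_assoc (evolution H₂ (-s)), evolution_neg_mul_self h₂, one_mul,
      hinv (h₂.sub hG)]
  have hUP (s : ℝ) : U₂ s * P s = 1 := by
    simp only [hP, hU₂]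
    rw [mul_assoc, ← mul_assoc (evolution (H₂ - G) (-s)), evolution_neg_mul_self (h₂.sub hG),
      one_mul, hinv h₂]
  have hle (X Y : Matrix Q Q ℂ) (hX : X.IsHermitian) (hY : Y.IsHermitian) (s u : ℝ) :
      ‖evolution X s * evolution Y u‖ ≤ 1 := by
    refine (norm_mul_le _ _).trans ?_
    exact mul_le_one₀ (norm_evolution_le hX s) (norm_nonneg _) (norm_evolution_le hY u)
  have hdW (s : ℝ) : HasDerivAt (fun u => P u * U₁ u - 1)
      (P s * (Complex.I • (heisenbergOp H₁ s G - heisenbergOp H₂ s G)) * U₁ s) s := by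
    refine (((hdP s).mul (hd₁ s)).sub_const 1).congr_deriv ?_
    have e1 : evolution H₁ s * (Complex.I • G) * evolution (H₁ - G) (-s) =
        (Complex.I • heisenbergOp H₁ s G) * U₁ s := by
      simp only [hU₁, heisenbergOp, smul_mul_assoc, mul_smul_comm]
      rw [mul_assoc _ (evolution H₁ (-s)), ← mul_assoc (evolution H₁ (-s)),
        evolution_neg_mul_self h₁, one_mul]
    have e2 : evolution (H₂ - G) s * (Complex.I • G) * evolution H₂ (-s) =
        P s * (Complex.I • heisenbergOp H₂ s G) := by
      simp only [hP, heisenbergOp, smul_mul_assoc, mul_smul_comm]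
      rw [mul_assoc (evolution H₂ s), mul_assoc (evolution (H₂ - G) s) (evolution H₂ (-s)),
        ← mul_assoc (evolution H₂ (-s)),
        evolution_neg_mul_self h₂, one_mul, mul_assoc]
    rw [e1, e2, smul_sub, mul_sub, sub_mul]
    simp only [neg_mul, mul_assoc]
    abel
  have hW : ‖P t * U₁ t - 1‖ ≤ K * (t ^ (k + 1) / (k + 1).factorial) := by
    refine image_norm_le_of_norm_deriv_right_le_deriv_boundary (a := 0) (b := t)
      (f := fun u => P u * U₁ u - 1) (B := fun s => K * (s ^ (k + 1) / (k + 1).factorial))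
      (B' := fun s => K * (s ^ k / k.factorial))
      (fun s _ => (hdW s).continuousAt.continuousWithinAt)
      (fun s _ => (hdW s).hasDerivWithinAt) ?_ (fun s => ?_) (fun s hs => ?_) ⟨ht, le_rfl⟩
    · simp [hP, hU₁, evolution]
    · refine (((hasDerivAt_pow (k + 1) s).div_const _).const_mul K).congr_deriv ?_
      have : (k.factorial : ℝ) ≠ 0 := by positivity
      rw [Nat.factorial_succ]
      push_cast
      field_simp
    · refine le_trans ?_ (hK s hs.1)
      refine (norm_mul_le _ _).trans ?_
      have h3 : ‖P s * Complex.I • (heisenbergOp H₁ s G - heisenbergOp H₂ s G)‖ ≤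
          ‖heisenbergOp H₁ s G - heisenbergOp H₂ s G‖ := by
        refine (norm_mul_le _ _).trans ?_
        rw [norm_smul, Complex.norm_I, one_mul]
        exact mul_le_of_le_one_left (norm_nonneg _) (hle _ _ (h₂.sub hG) h₂ _ _)
      exact (mul_le_mul h3 (hle _ _ h₁ (h₁.sub hG) _ _) (norm_nonneg _) (norm_nonneg _)).trans
        (mul_one _).le
  have hP1 : ‖P t‖ ≤ 1 := hle _ _ (h₂.sub hG) h₂ _ _
  have hU1 : ‖U₁ t‖ ≤ 1 := hle _ _ h₁ (h₁.sub hG) _ _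
  have hU2 : ‖U₂ t‖ ≤ 1 := hle _ _ h₂ (h₂.sub hG) _ _
  have hdiff : ‖U₁ t - U₂ t‖ ≤ K * (t ^ (k + 1) / (k + 1).factorial) := by
    have : U₁ t - U₂ t = U₂ t * (P t * U₁ t - 1) := by
      rw [mul_sub, ← mul_assoc, hUP, one_mul, mul_one]
    rw [this]
    refine (norm_mul_le _ _).trans ((mul_le_mul_of_nonneg_right hU2 (norm_nonneg _)).trans ?_)
    rw [one_mul]
    exact hW
  have hstar {H : Matrix Q Q ℂ} (hH : H.IsHermitian) (hO : Commute (H - G) O) :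
      heisenbergOp H t O = (evolution H t * evolution (H - G) (-t)) * O *
        (evolution H t * evolution (H - G) (-t))ᴴ := by
    have h3 : (evolution H t * evolution (H - G) (-t))ᴴ =
        evolution (H - G) t * evolution H (-t) := by
      rw [Matrix.conjTranspose_mul, ← evolution_neg hH, ← evolution_neg (hH.sub hG), neg_neg]
    rw [h3, mul_assoc (evolution H t), (commute_evolution hO (-t)).eq, heisenbergOp,
      mul_assoc, mul_assoc, mul_assoc, ← mul_assoc (evolution (H - G) (-t)),
      evolution_neg_mul_self (hH.sub hG), one_mul]
  have heq : heisenbergOp H₁ t O - heisenbergOp H₂ t O =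
      (U₁ t - U₂ t) * O * (U₁ t)ᴴ + U₂ t * O * (U₁ t - U₂ t)ᴴ := by
    rw [hstar h₁ hO₁, hstar h₂ hO₂, Matrix.conjTranspose_sub]
    change U₁ t * O * (U₁ t)ᴴ - U₂ t * O * (U₂ t)ᴴ = _
    rw [sub_mul, sub_mul, mul_sub]
    abel
  have hct (M : Matrix Q Q ℂ) : ‖Mᴴ‖ = ‖M‖ := Matrix.l2_opNorm_conjTranspose M
  rw [heq]
  set E := K * (t ^ (k + 1) / (k + 1).factorial)
  calc _ ≤ ‖(U₁ t - U₂ t) * O * (U₁ t)ᴴ‖ + ‖U₂ t * O * (U₁ t - U₂ t)ᴴ‖ := norm_add_le _ _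
    _ ≤ ‖U₁ t - U₂ t‖ * ‖O‖ * ‖(U₁ t)ᴴ‖ + ‖U₂ t‖ * ‖O‖ * ‖(U₁ t - U₂ t)ᴴ‖ := by
        refine add_le_add ?_ ?_ <;>
        · refine (norm_mul_le _ _).trans ?_
          exact mul_le_mul_of_nonneg_right (norm_mul_le _ _) (norm_nonneg _)
    _ ≤ E * ‖O‖ * 1 + 1 * ‖O‖ * E := by
        rw [hct, hct]
        have := (norm_nonneg _).trans hdiff
        gcongr
    _ = _ := by ring

end Heisenberg

section Truncation

variable {D L : ℕ}

open scoped Matrix.Norms.L2Operator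

lemma subset_patch_of_mem_touching {k : Kind} {q R : ℕ} {h : Finset (Site D L) → Op D L}
    (hh : IsLocalInteraction k q R h) {X Z S : Finset (Site D L)} {ρ : ℕ} (hZ : Z ⊆ patch X ρ)
    (hS : S ∈ touching h Z) : S ⊆ patch X (ρ + R) := by
  intro y hy
  obtain ⟨h0, hSZ⟩ := mem_touching.mp hS
  obtain ⟨z, hzS, hzZ⟩ := Finset.not_disjoint_iff.mp hSZ
  have h1 : diam S < R := by
    by_contra hR
    exact h0 (hh.eq_zero_of_diam S (not_lt.mp hR))
  obtain ⟨a, ha, hza⟩ := (Finset.mem_filter.mp (hZ hzZ)).2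
  refine Finset.mem_filter.mpr ⟨Finset.mem_univ _, a, ha, ?_⟩
  have h2 := manhattan_triangle y z a
  have h3 := manhattan_le_diam hy hzS
  omega

lemma patch_mono (X : Finset (Site D L)) {r r' : ℕ} (hr : r ≤ r') : patch X r ⊆ patch X r' := by
  intro y hy
  obtain ⟨a, ha, hya⟩ := (Finset.mem_filter.mp hy).2
  exact Finset.mem_filter.mpr ⟨Finset.mem_univ _, a, ha, hya.trans hr⟩

lemma subset_patch (X : Finset (Site D L)) (r : ℕ) : X ⊆ patch X r := fun x hx =>
  Finset.mem_filter.mpr ⟨Finset.mem_univ _, x, hx, by rw [manhattan_self]; exact Nat.zero_le _⟩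

/-- One step of the locality estimate: the effect of the truncation on an observable is bounded by
its effect on the terms that touch the observable. -/
lemma norm_heisenbergOp_sub_patch_step {k : Kind} {q R : ℕ} {h : Finset (Site D L) → Op D L}
    (hh : IsLocalInteraction k q R h) {X Z : Finset (Site D L)} {r : ℕ} {O : Op D L}
    (hO : O ∈ localAlgebra k Z) (hZ : ∀ S ∈ touching h Z, S ⊆ patch X r) {K : ℝ} {n : ℕ}
    (hK0 : 0 ≤ K)
    (hK : ∀ S ∈ touching h Z, ∀ s, 0 ≤ s →
      ‖heisenbergOp (hamiltonian h) s (h S) - heisenbergOp (patchHamiltonian h X r) s (h S)‖ ≤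
        K * (s ^ n / n.factorial)) {m : ℕ} (hm : Z.card ≤ m) {t : ℝ} (ht : 0 ≤ t) :
    ‖heisenbergOp (hamiltonian h) t O - heisenbergOp (patchHamiltonian h X r) t O‖ ≤
      2 * ‖O‖ * (m * termsPerSite D R * K * (t ^ (n + 1) / (n + 1).factorial)) := by
  set G := ∑ S ∈ touching h Z, h S with hG
  have hGh : G.IsHermitian := by
    rw [Matrix.IsHermitian, hG, Matrix.conjTranspose_sum]
    exact Finset.sum_congr rfl fun S _ => hh.isHermitian S
  have hcomm (T : Finset (Finset (Site D L))) (hT : touching h Z ⊆ T) :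
      Commute (∑ S ∈ T, h S - G) O := by
    classical
    rw [hG, ← Finset.sum_sdiff_eq_sub hT]
    refine Commute.sum_left _ _ _ fun S hS => ?_
    exact commute_of_notMem_touching hh hO (Finset.mem_sdiff.mp hS).2
  refine norm_heisenbergOp_sub_le (hamiltonian_isHermitian hh) (patchHamiltonian_isHermitian hh X r)
    hGh (hcomm _ (Finset.subset_univ _))
    (hcomm _ fun S hS => Finset.mem_filter.mpr ⟨Finset.mem_univ _, hZ S hS⟩) ht fun s hs => ?_
  have hsum : heisenbergOp (hamiltonian h) s G - heisenbergOp (patchHamiltonian h X r) s G =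
      ∑ S ∈ touching h Z,
        (heisenbergOp (hamiltonian h) s (h S) - heisenbergOp (patchHamiltonian h X r) s (h S)) := by
    rw [Finset.sum_sub_distrib]
    simp only [heisenbergOp, hG, Finset.mul_sum, Finset.sum_mul]
  rw [hsum]
  refine (norm_sum_le_of_le _ fun S hS => hK S hS s hs).trans ?_
  rw [Finset.sum_const, nsmul_eq_mul, ← mul_assoc]
  have h1 : ((touching h Z).card : ℝ) ≤ m * termsPerSite D R := by
    exact_mod_cast (card_touching_le hh Z).trans (Nat.mul_le_mul_right _ hm)
  gcongr

/-- The effect of the truncation on an interaction term that is `n` steps of length `R` away from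
the boundary of the patch. -/
lemma norm_heisenbergOp_term_sub_le {k : Kind} {q R : ℕ} {h : Finset (Site D L) → Op D L}
    (hh : IsLocalInteraction k q R h) (X : Finset (Site D L)) (r n : ℕ) :
    ∀ (ρ : ℕ) (Z : Finset (Site D L)), h Z ≠ 0 → Z ⊆ patch X ρ → ρ + n * R ≤ r → ∀ t, 0 ≤ t →
      ‖heisenbergOp (hamiltonian h) t (h Z) - heisenbergOp (patchHamiltonian h X r) t (h Z)‖ ≤
        2 * (2 * q * termsPerSite D R : ℝ) ^ n * (t ^ n / n.factorial) := by
  induction n with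
  | zero =>
    intro ρ Z _ _ _ t _
    have h1 : ‖h Z‖ ≤ 1 := hh.opNorm_le Z
    have h2 := norm_heisenbergOp_le (hamiltonian_isHermitian hh) t (h Z)
    have h3 := norm_heisenbergOp_le (patchHamiltonian_isHermitian hh X r) t (h Z)
    refine (norm_sub_le _ _).trans ?_
    simp only [pow_zero, Nat.factorial_zero, Nat.cast_one, div_one, mul_one]
    linarith
  | succ n ih =>
    intro ρ Z hZ0 hZ hρ t ht
    have hmem := termAlgebra_le_localAlgebra k Z (hh.mem_termAlgebra Z)
    have hsub (S) (hS : S ∈ touching h Z) := subset_patch_of_mem_touching hh hZ hS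
    have hcard : Z.card ≤ q := by
      by_contra hq
      exact hZ0 (hh.eq_zero_of_card Z (not_le.mp hq))
    rw [add_mul, one_mul] at hρ
    have h1 := norm_heisenbergOp_sub_patch_step hh (r := r) (n := n)
      (K := 2 * (2 * q * termsPerSite D R : ℝ) ^ n) hmem
      (fun S hS => (hsub S hS).trans (patch_mono X (by omega))) (by positivity)
      (fun S hS s hs => ih (ρ + R) S (mem_touching.mp hS).1 (hsub S hS) (by omega) s hs) hcard ht
    refine h1.trans ?_
    have h2 : ‖h Z‖ ≤ 1 := hh.opNorm_le Z
    calc _ ≤ 2 * 1 * ((q : ℝ) * termsPerSite D R * (2 * (2 * q * termsPerSite D R : ℝ) ^ n) *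
          (t ^ (n + 1) / (n + 1).factorial)) := by gcongr
      _ = _ := by rw [pow_succ (2 * q * termsPerSite D R : ℝ)]; ring

/-- **Lieb–Robinson bound** for the truncation of the evolution of a local observable. -/
lemma norm_heisenbergOp_sub_patch_le {k : Kind} {q R : ℕ} {h : Finset (Site D L) → Op D L}
    (hh : IsLocalInteraction k q R h) {X : Finset (Site D L)} {A : Op D L}
    (hA : A ∈ localAlgebra k X) (hA1 : opNorm A ≤ 1) {r n : ℕ} (hr : (n + 1) * R ≤ r) {t : ℝ}
    (ht : 0 ≤ t) :
    opNorm (heisenbergOp (hamiltonian h) t A - heisenbergOp (patchHamiltonian h X r) t A) ≤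
      4 * X.card * termsPerSite D R * t * ((2 * q * termsPerSite D R * t) ^ n / n.factorial) := by
  have hsub (S) (hS : S ∈ touching h X) :=
    subset_patch_of_mem_touching hh (subset_patch X 0) hS
  rw [add_mul, one_mul] at hr
  have h1 := norm_heisenbergOp_sub_patch_step hh (r := r) (n := n)
    (K := 2 * (2 * q * termsPerSite D R : ℝ) ^ n) hA
    (fun S hS => (hsub S hS).trans (patch_mono X (by omega))) (by positivity)
    (fun S hS s hs => norm_heisenbergOp_term_sub_le hh X r n (0 + R) S (mem_touching.mp hS).1
      (hsub S hS) (by omega) s hs) le_rfl ht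
  refine h1.trans ?_
  have h2 : ‖A‖ ≤ 1 := hA1
  have h3 : t ^ (n + 1) / ((n + 1).factorial : ℝ) ≤ t * (t ^ n / n.factorial) := by
    rw [pow_succ, mul_comm (t ^ n), mul_div_assoc]
    have : (n.factorial : ℝ) ≤ (n + 1).factorial := by
      exact_mod_cast Nat.factorial_le (Nat.le_succ n)
    gcongr
  calc _ ≤ 2 * 1 * ((X.card : ℝ) * termsPerSite D R * (2 * (2 * q * termsPerSite D R : ℝ) ^ n) *
        (t * (t ^ n / n.factorial))) := by gcongr
    _ = _ := by rw [mul_pow _ t]; ring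

lemma vnorm_timeAverage_patch_sub_le {k : Kind} {q R : ℕ} {h : Finset (Site D L) → Op D L}
    (hh : IsLocalInteraction k q R h) {X : Finset (Site D L)} {A : Op D L}
    (hA : A ∈ localAlgebra k X) (hA1 : opNorm A ≤ 1) {r n : ℕ} (hr : (n + 1) * R ≤ r)
    {J : Type} [Fintype J] [Nonempty J] {t : J → ℝ} {T : ℝ} (ht : ∀ j, 0 ≤ t j)
    (hT : ∀ j, t j ≤ T) {ψ : Config D L → ℂ} (hψ : vnorm ψ = 1) (x : ℂ) :
    vnorm (timeAverage (patchHamiltonian h X r) A t *ᵥ ψ - x • ψ) ≤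
      vnorm (timeAverage (hamiltonian h) A t *ᵥ ψ - x • ψ) +
        4 * X.card * termsPerSite D R * T * ((2 * q * termsPerSite D R * T) ^ n / n.factorial) := by
  set B := 4 * X.card * termsPerSite D R * T * ((2 * q * termsPerSite D R * T) ^ n / n.factorial)
    with hB
  have hj (j : J) : ‖heisenbergOp (hamiltonian h) (t j) A -
      heisenbergOp (patchHamiltonian h X r) (t j) A‖ ≤ B := by
    refine (norm_heisenbergOp_sub_patch_le hh hA hA1 hr (ht j)).trans ?_
    have h1 := hT j
    have h2 := ht j
    have h3 : 0 ≤ T := h2.trans h1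
    rw [hB]
    gcongr
  have hdiff :
      ‖timeAverage (hamiltonian h) A t - timeAverage (patchHamiltonian h X r) A t‖ ≤ B := by
    have h0 : (0 : ℝ) < Fintype.card J := by exact_mod_cast Fintype.card_pos
    rw [timeAverage, timeAverage, ← smul_sub, ← Finset.sum_sub_distrib, norm_smul, norm_inv,
      Complex.norm_natCast, inv_mul_le_iff₀ h0]
    refine (norm_sum_le_of_le _ fun j _ => hj j).trans ?_
    simp
  have heq : timeAverage (patchHamiltonian h X r) A t *ᵥ ψ - x • ψ =
      (timeAverage (hamiltonian h) A t *ᵥ ψ - x • ψ) -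
        (timeAverage (hamiltonian h) A t - timeAverage (patchHamiltonian h X r) A t) *ᵥ ψ := by
    rw [Matrix.sub_mulVec]
    abel
  rw [heq]
  refine (vnorm_sub_le _ _).trans (add_le_add le_rfl ?_)
  have := vnorm_mulVec_le (timeAverage (hamiltonian h) A t -
    timeAverage (patchHamiltonian h X r) A t) ψ
  rw [hψ, mul_one] at this
  exact this.trans hdiff

end Truncation

/-! ### The choice of the parameters -/

section Parameters

/-- The constant `69 / 100` is a lower bound for `log 2`. -/
lemma half_pow_le_exp {n : ℕ} {x : ℝ} (hx : x ≤ 69 / 100 * n) :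
    (1 / 2 : ℝ) ^ n ≤ Real.exp (-x) := by
  have h2 := Real.log_two_gt_d9
  have h1 : (1 / 2 : ℝ) ^ n = Real.exp (-(n * Real.log 2)) := by
    rw [Real.exp_neg, Real.exp_nat_mul, Real.exp_log two_pos, one_div, inv_pow]
  rw [h1, Real.exp_le_exp]
  nlinarith [Nat.cast_nonneg (α := ℝ) n]

lemma pow_div_factorial_le_exp {x : ℝ} (hx : 0 ≤ x) (n : ℕ) :
    x ^ n / n.factorial ≤ Real.exp (3 * x - n) := by
  have h1 := Real.pow_div_factorial_le_exp (Real.exp 1 * x) (by positivity) n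
  have h2 : Real.exp 1 * x ≤ 3 * x := by
    have := Real.exp_one_lt_d9
    gcongr
    linarith
  have h3 : (Real.exp 1 * x) ^ n / n.factorial = Real.exp n * (x ^ n / n.factorial) := by
    rw [mul_pow, ← Real.exp_nat_mul, mul_one, mul_div_assoc]
  rw [h3] at h1
  rw [Real.exp_sub, le_div_iff₀ (Real.exp_pos _), mul_comm]
  exact h1.trans (Real.exp_le_exp.mpr h2)

variable {ε δ : ℝ}

lemma log_inv_ge (hδ : 0 < δ) (hδ2 : δ ≤ 1 / 2) : 69 / 100 ≤ Real.log (1 / δ) := by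
  have h2 := Real.log_two_gt_d9
  have h1 : Real.log 2 ≤ Real.log (1 / δ) :=
    Real.log_le_log two_pos (by rw [le_div_iff₀ hδ]; linarith)
  linarith

lemma exp_neg_log_inv (hδ : 0 < δ) : Real.exp (-Real.log (1 / δ)) = δ := by
  rw [one_div, Real.log_inv, neg_neg, Real.exp_log hδ]

/-- The number of repetitions. -/
lemma exists_repetitions (hδ : 0 < δ) (hδ2 : δ ≤ 1 / 2) :
    ∃ l : ℕ, (1 / 2 : ℝ) ^ l ≤ δ / 40 ∧ (l : ℝ) ≤ 13 * Real.log (1 / δ) := by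
  have hx := log_inv_ge hδ hδ2
  set x := Real.log (1 / δ) with hxdef
  refine ⟨⌈11 * x⌉₊, ?_, ?_⟩
  · have h1 : (1 / 2 : ℝ) ^ ⌈11 * x⌉₊ ≤ Real.exp (-(7 * x)) :=
      half_pow_le_exp (by have := Nat.le_ceil (11 * x); linarith)
    have h2 : Real.exp (-(7 * x)) = δ * δ ^ 6 := by
      rw [← pow_succ']
      have : -(7 * x) = (7 : ℕ) * -x := by push_cast; ring
      rw [this, Real.exp_nat_mul, exp_neg_log_inv hδ]
    have h3 : δ ^ 6 ≤ (1 / 2) ^ 6 := pow_le_pow_left₀ hδ.le hδ2 6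
    rw [h2] at h1
    nlinarith
  · have := Nat.ceil_lt_add_one (a := 11 * x) (by linarith)
    linarith

/-- The size of the phase estimation registers. -/
lemma exists_registerSize (hε : 0 < ε) (hε1 : ε ≤ 1) :
    ∃ N : ℕ, 2 ≤ N ∧ 49 ≤ N * ε ∧ ((N - 1 : ℕ) : ℝ) ≤ 49 / ε := by
  have h1 : 49 / ε ≤ ⌈49 / ε⌉₊ := Nat.le_ceil _
  have h2 : 49 ≤ 49 / ε := by rw [le_div_iff₀ hε]; linarith
  have h3 : 2 ≤ ⌈49 / ε⌉₊ := by
    have : (2 : ℝ) ≤ (⌈49 / ε⌉₊ : ℝ) := by linarith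
    exact_mod_cast this
  refine ⟨⌈49 / ε⌉₊, h3, ?_, ?_⟩
  · rwa [div_le_iff₀ hε] at h1
  · rw [Nat.cast_sub (by omega), Nat.cast_one]
    have := Nat.ceil_lt_add_one (a := 49 / ε) (by positivity)
    linarith

/-- The accuracy to which the ground state has to be an eigenvector of the time average. -/
lemma mul_exp_neg_le (hε : 0 < ε) (hδ : 0 < δ) (hδ2 : δ ≤ 1 / 2) {n : ℝ}
    (hn : n ≤ 2730 * Real.log (1 / δ) / ε) (hε1 : ε ≤ 1) :
    n * Real.exp (-(16 * (Real.log (1 / δ) + Real.log (1 / ε)))) ≤ δ / 6 := by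
  have h1 : Real.exp (-(16 * (Real.log (1 / δ) + Real.log (1 / ε)))) =
      δ ^ 16 * ε ^ 16 := by
    have : -(16 * (Real.log (1 / δ) + Real.log (1 / ε))) =
      (16 : ℕ) * -Real.log (1 / δ) + (16 : ℕ) * -Real.log (1 / ε) := by push_cast; ring
    rw [this, Real.exp_add, Real.exp_nat_mul, Real.exp_nat_mul, exp_neg_log_inv hδ,
      exp_neg_log_inv hε]
  have h2 : Real.log (1 / δ) ≤ 1 / δ := by
    have := Real.log_le_sub_one_of_pos (x := 1 / δ) (by positivity)
    linarith
  have h3 : δ ^ 14 ≤ (1 / 2) ^ 14 := pow_le_pow_left₀ hδ.le hδ2 14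
  have h4 : ε ^ 15 ≤ 1 := pow_le_one₀ hε.le hε1
  rw [h1]
  calc n * (δ ^ 16 * ε ^ 16) ≤ 2730 * (1 / δ) / ε * (δ ^ 16 * ε ^ 16) := by
        refine mul_le_mul_of_nonneg_right (hn.trans ?_) (by positivity)
        gcongr
    _ = 2730 * δ * (δ ^ 14 * ε ^ 15) := by field_simp
    _ ≤ 2730 * δ * ((1 / 2) ^ 14 * 1) := by gcongr
    _ ≤ δ / 6 := by linarith

/-- Call times up to `O(s / Δ)` suffice to suppress all frequencies between `Δ` and `Ω` by the
factor `e^{-18 s}`. -/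
lemma exists_callTime {Δ Ω s : ℝ} (hΔ : 0 < Δ) (hΩ : 0 < Ω) (hs : 1 / 2 ≤ s) :
    ∃ (n M : ℕ) (τ : ℝ), 0 < M ∧ (∀ j, 0 ≤ callTime n M τ j) ∧
      (∀ j, callTime n M τ j ≤ 183 * s / Δ) ∧
      ∀ ω, Δ ≤ ω → ‖response (callTime n M τ) ω‖ ≤ Real.exp (-(18 * s)) + ω / Ω := by
  have hpi := Real.pi_pos
  have hτ : 0 < Real.pi / Ω := by positivity
  set τ := Real.pi / Ω with hτdef
  have hM0 : 0 < 2 * Real.pi / (Δ * τ) := by positivity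
  set M := ⌈2 * Real.pi / (Δ * τ)⌉₊ with hMdef
  have hM : 0 < M := Nat.ceil_pos.mpr hM0
  set n := ⌈27 * s⌉₊ with hn
  have hn1 : 27 * s ≤ n := Nat.le_ceil _
  have hn2 : (n : ℝ) ≤ 29 * s := by
    have := Nat.ceil_lt_add_one (a := 27 * s) (by linarith)
    linarith
  refine ⟨n, M, τ, hM, fun j => ?_, fun j => ?_, fun ω hω => ?_⟩
  · exact mul_nonneg hτ.le (Nat.cast_nonneg _)
  · have h1 (i : Fin n) : τ * (j i : ℕ) ≤ 2 * Real.pi / Δ := by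
      have h2 : ((j i : ℕ) : ℝ) ≤ 2 * Real.pi / (Δ * τ) :=
        (Nat.lt_ceil.mp (j i).isLt).le
      calc τ * (j i : ℕ) ≤ τ * (2 * Real.pi / (Δ * τ)) := by gcongr
        _ = 2 * Real.pi / Δ := by field_simp
    rw [callTime, Nat.cast_sum, Finset.mul_sum]
    refine (Finset.sum_le_card_nsmul _ _ _ fun i _ => h1 i).trans ?_
    rw [Finset.card_univ, Fintype.card_fin, nsmul_eq_mul, ← mul_div_assoc]
    rw [div_le_div_iff_of_pos_right hΔ]
    have h3 := Real.pi_lt_d2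
    calc (n : ℝ) * (2 * Real.pi) ≤ 29 * s * (2 * 3.15) := by gcongr
      _ ≤ 183 * s := by linarith
  · rcases le_or_gt ω Ω with h | h
    · have h1 : ω * τ ≤ Real.pi := by
        rw [hτdef, mul_div_assoc', div_le_iff₀ hΩ, mul_comm]
        gcongr
      have h2 : 2 * Real.pi ≤ M * (Δ * τ) := by
        rw [← div_le_iff₀ (by positivity)]
        exact Nat.le_ceil _
      have h3 := norm_response_callTime_le (n := n) hτ hΔ h2 hω h1
      have h4 : (1 / 2 : ℝ) ^ n ≤ Real.exp (-(18 * s)) := half_pow_le_exp (by linarith)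
      have h5 : 0 ≤ ω / Ω := div_nonneg (hΔ.le.trans hω) hΩ.le
      linarith
    · have : Nonempty (Fin M) := ⟨⟨0, hM⟩⟩
      have h1 := norm_response_le_one (callTime n M τ) ω
      have h2 : 1 ≤ ω / Ω := by rw [le_div_iff₀ hΩ]; linarith
      have h3 := Real.exp_pos (-(18 * s))
      linarith

/-- The radius at which truncation changes the time average by at most half the allowed error. The
number `a'` stands for the size of the region, `T` for the largest call time. -/
lemma exists_patchRadius {D q R : ℕ} {Δ s u a' T : ℝ} (hΔ : 0 < Δ)
    (hΔ1 : Δ ≤ 18 * termsPerSite D R) (hs : 0 ≤ s) (hu : 69 / 100 ≤ u) (ha' : a' ≤ Real.exp u)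
    (hT : T = 183 * s / Δ) :
    ∃ r n : ℕ, (n + 1) * R ≤ r ∧
      4 * a' * termsPerSite D R * T * ((2 * q * termsPerSite D R * T) ^ n / n.factorial) ≤
        Real.exp (-(16 * s)) / 2 ∧
      (r : ℝ) ≤ (4 + termsPerSite D R * (1752 + 1098 * q)) * (R + 1) * (s / Δ + u) := by
  set n₀ : ℝ := (termsPerSite D R : ℝ) with hn₀
  have hn₀0 : 0 ≤ n₀ := Nat.cast_nonneg _
  have hq : (0 : ℝ) ≤ q := Nat.cast_nonneg _
  have hR : (0 : ℝ) ≤ R := Nat.cast_nonneg _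
  have hsΔ : 0 ≤ s / Δ := div_nonneg hs hΔ.le
  have hT' : T = 183 * (s / Δ) := by rw [hT]; ring
  have hT0 : 0 ≤ T := by rw [hT']; positivity
  have hs1 : s ≤ 18 * n₀ * (s / Δ) := by
    calc s = Δ * (s / Δ) := by field_simp
      _ ≤ _ := by gcongr
  set e := u + 8 * n₀ * T + 16 * s + 3 * (2 * q * n₀ * T) with he
  have he0 : 0 ≤ e := by rw [he]; positivity
  set n := ⌈e⌉₊ with hn
  have hn1 : e ≤ n := Nat.le_ceil _
  have hn2 : (n : ℝ) ≤ e + 1 := (Nat.ceil_lt_add_one he0).le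
  refine ⟨(n + 1) * R, n, le_rfl, ?_, ?_⟩
  · have h1 := pow_div_factorial_le_exp (x := 2 * q * n₀ * T) (by positivity) n
    have h2 : 8 * n₀ * T ≤ Real.exp (8 * n₀ * T) := by
      have := Real.add_one_le_exp (8 * n₀ * T)
      linarith
    calc 4 * a' * n₀ * T * ((2 * q * n₀ * T) ^ n / n.factorial)
        = a' * (8 * n₀ * T) * ((2 * q * n₀ * T) ^ n / n.factorial) / 2 := by ring
      _ ≤ Real.exp u * Real.exp (8 * n₀ * T) * Real.exp (3 * (2 * q * n₀ * T) - n) / 2 := by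
          gcongr
      _ ≤ Real.exp (-(16 * s)) / 2 := by
          rw [← Real.exp_add, ← Real.exp_add]
          gcongr
          linarith
  · push_cast
    have h1 : (n : ℝ) + 1 ≤ (4 + n₀ * (1752 + 1098 * q)) * (s / Δ + u) := by
      have h2 : e ≤ u + n₀ * (1752 + 1098 * q) * (s / Δ) := by
        rw [he, hT']
        linarith
      have h3 : 0 ≤ n₀ * (1752 + 1098 * q) * u := by positivity
      nlinarith
    have h3 : (0 : ℝ) ≤ (4 + n₀ * (1752 + 1098 * q)) * (s / Δ + u) := by positivity
    calc ((n : ℝ) + 1) * R ≤ (4 + n₀ * (1752 + 1098 * q)) * (s / Δ + u) * (R + 1) := by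
          gcongr; linarith
      _ = _ := by ring

lemma abs_expectation_le {Q : Type} [Fintype Q] [DecidableEq Q] {A : Matrix Q Q ℂ} {ψ : Q → ℂ}
    (hψ : vnorm ψ = 1) (hA : opNorm A ≤ 1) : |expectation A ψ| ≤ 1 := by
  have h1 := norm_dotProduct_le ψ (A *ᵥ ψ)
  have h2 := vnorm_mulVec_le A ψ
  rw [hψ, mul_one] at h2
  rw [hψ, one_mul] at h1
  exact (Complex.abs_re_le_norm _).trans (h1.trans (h2.trans hA))

end Parameters

end CatalyticTomography

theorem mainTheorem2 :
    ∃ c : ℝ, 0 < c ∧ ∀ D q R : ℕ, ∃ C : ℝ, 0 < C ∧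
      ∀ (Δ ε δ : ℝ), 0 < Δ → 0 < ε → ε ≤ 1 → 0 < δ → δ ≤ 1 / 2 →
      ∀ (a b : ℕ), 0 < a →
      ∃ (P : Protocol b) (r : ℕ),
        P.time ≤ c * (Real.log (1 / δ) * (Real.log (1 / δ) + Real.log (1 / ε)) / (Δ * ε)) ∧
        (P.calls : ℝ) ≤ c * (Real.log (1 / δ) / ε) ∧
        (r : ℝ) ≤ C * ((Real.log (1 / δ) + Real.log (1 / ε)) / Δ + Real.log (a / δ)) ∧
        ∀ (k : Kind) (L : ℕ) (h : Finset (Site D L) → Op D L), IsLocalInteraction k q R h →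
        ∀ ψ₀ : Config D L → ℂ, IsGappedGroundState (hamiltonian h) Δ ψ₀ →
        ∀ (X : Finset (Site D L)) (A : Op D L), X.card = a → A ∈ localAlgebra k X →
          A.IsHermitian → opNorm A ≤ 1 →
        ∀ V : Matrix (Config D L × Reg b) (Config D L × Reg b) ℂ, IsBlockEncoding V A →
          P.Succeeds (hamiltonian h) V A ψ₀ ε δ ∧
          P.Succeeds (patchHamiltonian h X r) V A ψ₀ ε δ := by
  refine ⟨500000, by norm_num, fun D q R => ⟨(4 + termsPerSite D R * (1752 + 1098 * q)) * (R + 1),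
    by positivity, fun Δ ε δ hΔ hε hε1 hδ hδ2 a b ha => ?_⟩⟩
  have hx := log_inv_ge hδ hδ2
  have hy : 0 ≤ Real.log (1 / ε) := Real.log_nonneg (by rw [le_div_iff₀ hε]; linarith)
  have ha1 : (1 : ℝ) ≤ a := by exact_mod_cast ha
  have hu : 69 / 100 ≤ Real.log (a / δ) := by
    refine hx.trans (Real.log_le_log (by positivity) ?_)
    gcongr
  have hau : (a : ℝ) ≤ Real.exp (Real.log (a / δ)) := by
    rw [Real.exp_log (by positivity), le_div_iff₀ hδ]
    nlinarith
  set x := Real.log (1 / δ) with hxdef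
  set y := Real.log (1 / ε) with hydef
  by_cases hΔ1 : Δ ≤ 18 * termsPerSite D R
  · have hn₀ : (0 : ℝ) < termsPerSite D R := by
      by_contra hn
      linarith
    have hη := Real.exp_pos (-(16 * (x + y)))
    set η := Real.exp (-(16 * (x + y))) with hηdef
    -- with this cutoff the frequencies above `Ω` contribute at most `η / 4`
    obtain ⟨n, M, τ, hM, ht0, htT, hF⟩ := exists_callTime (Δ := Δ)
      (Ω := 8 * a * termsPerSite D R / η) (s := x + y) hΔ (by positivity) (by linarith)
    have : Nonempty (Fin M) := ⟨⟨0, hM⟩⟩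
    obtain ⟨l, hl, hlx⟩ := exists_repetitions hδ hδ2
    obtain ⟨N, hN, hNε, hN1⟩ := exists_registerSize hε hε1
    obtain ⟨r, m, hmr, hmη, hr⟩ := exists_patchRadius (D := D) (q := q) (R := R) (s := x + y) hΔ hΔ1
      (by linarith) hu hau rfl
    set T := 183 * (x + y) / Δ with hTdef
    have hT0 : 0 ≤ T := by positivity
    set P := tomography b (callTime n M τ) ε l hN with hP
    have hcalls : (P.calls : ℝ) ≤ 2730 * x / ε := by
      rw [hP, tomography_calls]
      push_cast
      have h1 : 112 ≤ 112 / ε := by rw [le_div_iff₀ hε]; linarith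
      calc (2 * (2 * (2 * l * 14) + l * (N - 1 : ℕ)) : ℝ)
          = l * (112 + 2 * (N - 1 : ℕ)) := by ring
        _ ≤ 13 * x * (112 / ε + 2 * (49 / ε)) := by gcongr
        _ = 2730 * x / ε := by ring
    have hcη := mul_exp_neg_le hε hδ hδ2 hcalls hε1
    refine ⟨P, r, ?_, ?_, hr, ?_⟩
    · refine (tomography_time_le (T := T) l hT0 (fun j => ?_) ε hN).trans ?_
      · rw [abs_of_nonneg (ht0 j)]
        exact htT j
      · calc (P.calls : ℝ) * T ≤ 2730 * x / ε * T := by gcongr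
          _ = 499590 * (x * (x + y) / (Δ * ε)) := by rw [hTdef]; field_simp; norm_num
          _ ≤ _ := by gcongr; norm_num
    · refine hcalls.trans ?_
      rw [mul_div_assoc]
      gcongr
      norm_num
    · intro k L h hh ψ hψ X A hX hAX hA hA1 V hV
      have hψ1 := vnorm_eq_one hψ.1
      have hη₁ : Real.exp (-(18 * (x + y))) ≤ η / 4 := by
        have h1 : Real.exp (-(2 * (x + y))) ≤ 1 / 4 := by
          calc Real.exp (-(2 * (x + y))) ≤ Real.exp ((2 : ℕ) * -x) := by
                rw [Real.exp_le_exp]; push_cast; linarith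
            _ = δ ^ 2 := by rw [Real.exp_nat_mul, exp_neg_log_inv hδ]
            _ ≤ (1 / 2) ^ 2 := pow_le_pow_left₀ hδ.le hδ2 2
            _ = 1 / 4 := by norm_num
        have h2 : Real.exp (-(18 * (x + y))) = η * Real.exp (-(2 * (x + y))) := by
          rw [hηdef, ← Real.exp_add]
          congr 1
          ring
        rw [h2]
        nlinarith
      have h1 : vnorm (timeAverage (hamiltonian h) A (callTime n M τ) *ᵥ ψ -
          (expectation A ψ : ℂ) • ψ) ≤ η / 2 := by
        refine (vnorm_timeAverage_mulVec_sub_le (hamiltonian_isHermitian hh) hΔ hψ hA hA1 _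
          (Real.exp_pos _).le (by positivity) hF).trans ?_
        have h2 := opNorm_commutator_le hh hAX hA1
        rw [hX] at h2
        push_cast at h2
        have h3 : opNorm (hamiltonian h * A - A * hamiltonian h) /
            (8 * a * termsPerSite D R / η) ≤ η / 4 := by
          rw [div_le_iff₀ (by positivity)]
          refine h2.trans (le_of_eq ?_)
          field_simp
          norm_num
        linarith
      have h2 := vnorm_timeAverage_patch_sub_le hh hAX hA1 hmr ht0 htT hψ1 (expectation A ψ : ℂ)
      rw [hX] at h2
      have hexp := abs_expectation_le hψ1 hA1
      exact ⟨tomography_succeeds l (hamiltonian_isHermitian hh) hA hV hψ1 hexp _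
          (h1.trans (by linarith)) hε hN hNε hl hcη,
        tomography_succeeds l (patchHamiltonian_isHermitian hh X r) hA hV hψ1 hexp _
          (h2.trans (by linarith)) hε hN hNε hl hcη⟩
  · -- no local Hamiltonian has such a large gap
    refine ⟨⟨1, 0, [], fun _ => 0⟩, 0, ?_, ?_, ?_, ?_⟩
    · simp only [Protocol.time, List.map_nil, List.sum_nil]
      positivity
    · simp only [Protocol.calls, List.map_nil, List.sum_nil, Nat.cast_zero]
      positivity
    · rw [Nat.cast_zero]
      positivity
    · intro k L h hh ψ hψ X A hX
      obtain ⟨z, -⟩ := Finset.card_pos.mp (hX ▸ ha)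
      exact absurd (gap_le hh hΔ hψ z) hΔ1
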